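/- Let $B$ be a compact (Hausdorff) $n$-dimensional special integral affine manifold, i.e. a manifold with an atlas whose coordinate changes lie in $SL(n,\mathbb Z)\ltimes\mathbb R^n$, and assume that $B$ is complete, i.e. its universal cover is affinely diffeomorphic to $\mathbb R^n$. Let $\Lambda\subset TB$ and $\Lambda^*\subset T^*B$ be the induced dual lattice bundles, $X=T^*B/\Lambda^*$, and let $\check X=TB/\Lambda\to B$ be the semi-flat torus fibration, with the complex structure whose local holomorphic coordinates are $\check y^j+ix^j$, where $x^j$ are affine coordinates and $\check y^j$ the corresponding fibre coordinates. Let $g$ be an integral Hessian type metric on $B$: a Riemannian metric for which there are affine charts $x_U:U\to\mathbb R^n$ covering $B$ and smooth $\phi_U:U\to\mathbb R$ such that $g=\sum\frac{\partial^2\phi_U}{\partial x_U^j\partial x_U^k}dx_U^j\otimes dx_U^k$ on $U$, and $\phi_U-\phi_V=\langle m_{UV},x_V\rangle+a_{UV}$ on $U\cap V$ with $m_{UV}\in\mathbb Z^n$, $a_{UV}\in\mathbb R$. Fix such potentials, and let $L_g=\{(x,[d\phi(x)])\}\subset X$; let $L_0\subset X$ be the zero section. Let $\check L_g\to\check X$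 be the SYZ transform of $L_g$, i.e. the pullback along $L_g$ of the Poincaré line bundle on $X\times_B\check X$. It has over $U$ the frame $\check 1=e^{i\pi\langle d\phi_U,\check y\rangle}$, in which its connection is $\nabla=d+2\pi i\sum_j\frac{\partial\phi_U}{\partial x^j}d\check y^j$; it is the prequantum line bundle of $\check\omega_g=\sum g_{jk}d\check y^j\wedge dx^k$. A fibre $\check F_x$ of $\check X\to B$ is Bohr–Sommerfeld if $(\check L_g,\nabla)|_{\check F_x}$ is trivial, i.e. has a nowhere vanishing covariantly constant section. Let $\Gamma_{P_{\mathbb R}}$ be the space of real polarized sections: the sections $s$ of $\check L_g$, with no regularity required transversally to the fibres, such that $\nabla_vs=0$ for all $v$ tangent to the fibres. Let $\Gamma_{P_{\mathbb C}}=H^0(\check X,\check L_g)$ be the space of complex polarized sections: the smooth sections $s$ with $\nabla_vs=0$ for all $v\in T^{0,1}\check X$. Let $P(L_0,L_g)=\{(x,y): y\in T_x^*B,\ [y]\in L_g\}$ be the fibrewise geodesic path space, a covering of $B$ (the point $(x,y)$ is the path $t\mapsto[ty]$, $0\le t\le1$), let $d\mathcal A=\sum_jy_jdx^j$ be the differential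 of the area function on it, and let $d_W=d+2\pi\,d\mathcal A\wedge$. Let $A^0_{r.d.}(P(L_0,L_g))$ be the space of smooth complex functions $\alpha$ on $P(L_0,L_g)$ such that $\sup_{x\in K}|y|^k|\nabla^l\alpha(x,y)|\to0$ as $|y|\to\infty$ for all compact $K\subset B$ and all $k,l\ge0$, with $\nabla$ the flat affine connection and norms taken with respect to $g$. The SYZ transform of $\alpha$ is $$\mathcal F(\alpha)(x,\check y)=\sum_{\mu\in\Lambda_x^*}\alpha(x,d\phi(x)+\mu)\,e^{2\pi i\langle\mu,\check y\rangle}\,\check 1 .$$ Then: 1. The Bohr–Sommerfeld fibres are exactly the fibres $\check F_x$ over the points $x$ with $p=(x,[0])\in L_0\cap L_g$, and they give a basis of $\Gamma_{P_{\mathbb R}}$: the basis element $\check F_x$ is the covariantly constant section on $\check F_x$ with coefficient $1$ in the frame of the lift $y=0$, extended by zero to the other fibres. 2. For each $p=(x,[0])\in L_0\cap L_g$ the $1$-form $d\mathcal A$ has a primitive $\mathcal A_p$ vanishing at $(x,0)$ on the connected component $P_p$ of $(x,0)$ in $P(L_0,L_g)$, and the functions $e^{-2\pi\mathcal A_p}$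 (extended by zero to the other components), $p\in L_0\cap L_g$, form a basis of $\ker(d_W)\cap A^0_{r.d.}(P(L_0,L_g))$. 3. The SYZ transform (given on this space by absolutely convergent series) is a linear isomorphism $\mathcal F:\ker(d_W)\cap A^0_{r.d.}(P(L_0,L_g))\to H^0(\check X,\check L_g)$. Consequently there is a canonical linear isomorphism $$\Gamma_{P_{\mathbb R}}(\check X,\check L_g)=\bigoplus_{\check F_x\ \text{Bohr–Sommerfeld}}\mathbb C\cdot\check F_x\ \xrightarrow{\ \sim\ }\ \Gamma_{P_{\mathbb C}}(\check X,\check L_g)=H^0(\check X,\check L_g),\qquad \check F_x\mapsto\mathcal F(e^{-2\pi\mathcal A_p}),\quad p=(x,[0]).$$ -/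

import Mathlib

open Set Filter Topology Manifold Bundle
open scoped ContDiff

noncomputable section

namespace SemiFlat

/-- The model space `ℝⁿ` of affine coordinates. -/
abbrev E (n : ℕ) : Type := Fin n → ℝ

/-- `f` is locally on `s` of the form `x ↦ A x + b` with `A ∈ SL(n, ℤ)`, `b ∈ ℝⁿ`. -/
def IsSpecialIntegralAffineOn (n : ℕ) (f : E n → E n) (s : Set (E n)) : Prop :=
  ∀ x ∈ s, ∃ (A : Matrix.SpecialLinearGroup (Fin n) ℤ) (b : E n) (u : Set (E n)),
    IsOpen u ∧ x ∈ u ∧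
      ∀ z ∈ s ∩ u, f z = (A.1.map (Int.cast : ℤ → ℝ)).mulVec z + b

/-- The pregroupoid of local `SL(n, ℤ) ⋉ ℝⁿ` maps. -/
def specialIntegralAffinePregroupoid (n : ℕ) : Pregroupoid (E n) where
  property := IsSpecialIntegralAffineOn n
  comp := by
    intro f g u v hf hg hu hv huv x hx
    obtain ⟨A, b, s, hs, hxs, hA⟩ := hf x hx.1
    obtain ⟨C, d, t, ht, hxt, hC⟩ := hg (f x) hx.2
    obtain ⟨w, hw, hwe⟩ : ∃ w : Set (E n), IsOpen w ∧ w = {z | (A.1.map (Int.cast : ℤ → ℝ)).mulVec z + b ∈ t} := by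
      refine ⟨_, ?_, rfl⟩
      exact ht.preimage (by fun_prop)
    refine ⟨C * A, (C.1.map (Int.cast : ℤ → ℝ)).mulVec b + d, s ∩ w, hs.inter hw, ⟨hxs, ?_⟩, ?_⟩
    · rw [hwe]
      change _ ∈ t
      rw [← hA x ⟨hx.1, hxs⟩]
      exact hxt
    · rintro z ⟨hz, hzs, hzw⟩
      have h1 := hA z ⟨hz.1, hzs⟩
      rw [hwe] at hzw
      change _ ∈ t at hzw
      rw [← h1] at hzw
      have h2 := hC (f z) ⟨hz.2, hzw⟩
      have h3 : (C * A).1.map (Int.cast : ℤ → ℝ)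
          = C.1.map (Int.cast : ℤ → ℝ) * A.1.map (Int.cast : ℤ → ℝ) := by
        rw [Matrix.SpecialLinearGroup.coe_mul]
        exact Matrix.map_mul (f := Int.castRingHom ℝ)
      change g (f z) = _
      rw [h2, h1, h3, Matrix.mulVec_add, Matrix.mulVec_mulVec, add_assoc]
  id_mem := by
    intro x _
    exact ⟨1, 0, univ, isOpen_univ, mem_univ _, fun z _ => by simp⟩
  locality := by
    intro f u hu h x hx
    obtain ⟨v, hv, hxv, hf⟩ := h x hx
    obtain ⟨A, b, s, hs, hxs, hA⟩ := hf x ⟨hx, hxv⟩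
    exact ⟨A, b, v ∩ s, hv.inter hs, ⟨hxv, hxs⟩,
      fun z hz => hA z ⟨⟨hz.1, hz.2.1⟩, hz.2.2⟩⟩
  congr := by
    intro f g u hu hfg hf x hx
    obtain ⟨A, b, s, hs, hxs, hA⟩ := hf x hx
    exact ⟨A, b, s, hs, hxs, fun z hz => by rw [hfg z hz.1, hA z hz]⟩

/-- The structure groupoid `SL(n, ℤ) ⋉ ℝⁿ`. A special integral affine manifold is a charted space
over `ℝⁿ` whose coordinate changes belong to it. -/
def specialIntegralAffineGroupoid (n : ℕ) : StructureGroupoid (E n) :=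
  (specialIntegralAffinePregroupoid n).groupoid

theorem IsSpecialIntegralAffineOn.contDiffOn {n : ℕ} {f : E n → E n} {s : Set (E n)}
    (h : IsSpecialIntegralAffineOn n f s) (k : ℕ∞ω) : ContDiffOn ℝ k f s := by
  intro x hx
  obtain ⟨A, b, u, hu, hxu, hA⟩ := h x hx
  have h1 : ContDiff ℝ k (fun z : E n => (A.1.map (Int.cast : ℤ → ℝ)).mulVec z + b) := by
    have : ContDiff ℝ k (fun z : E n => Matrix.toLin' (A.1.map (Int.cast : ℤ → ℝ)) z) :=
      (LinearMap.toContinuousLinearMap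
        (Matrix.toLin' (A.1.map (Int.cast : ℤ → ℝ)))).contDiff
    simpa using this.add contDiff_const
  have h2 : ContDiffWithinAt ℝ k f (s ∩ u) x :=
    h1.contDiffAt.contDiffWithinAt.congr hA (hA x ⟨hx, hxu⟩)
  exact (contDiffWithinAt_inter (hu.mem_nhds hxu)).1 h2

/-- A special integral affine manifold is a smooth manifold. -/
instance instIsManifold (n : ℕ) (k : ℕ∞ω) (B : Type*) [TopologicalSpace B] [ChartedSpace (E n) B]
    [HasGroupoid B (specialIntegralAffineGroupoid n)] : IsManifold 𝓘(ℝ, E n) k B := by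
  apply isManifold_of_contDiffOn
  intro e e' he he'
  have h := HasGroupoid.compatible (G := specialIntegralAffineGroupoid n) he he'
  have h1 : IsSpecialIntegralAffineOn n (e.symm ≫ₕ e') (e.symm ≫ₕ e').source :=
    ((mem_groupoid_of_pregroupoid).1 h).1
  simpa using h1.contDiffOn k

section Base

variable (n : ℕ) {B : Type*} [TopologicalSpace B] [ChartedSpace (E n) B]

/-- The affine manifold `B` is complete: its universal cover is `ℝⁿ` as an affine manifold, that is,
there is a covering map `ℝⁿ → B` which is affine in all affine charts of `B`. -/
def IsCompleteAffine (B : Type*) [TopologicalSpace B] [ChartedSpace (E n) B] : Prop :=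
  ∃ p : E n → B, IsCoveringMap p ∧ Function.Surjective p ∧
    ∀ e ∈ (specialIntegralAffineGroupoid n).maximalAtlas B, ∀ a : E n, p a ∈ e.source →
      ∃ T : E n ≃ᵃ[ℝ] E n, ∀ᶠ z in 𝓝 a, e (p z) = T z

/-- The tangent space `T_x B`. -/
abbrev Tan (x : B) : Type := TangentSpace 𝓘(ℝ, E n) x

/-- The cotangent space `T_x^* B`. -/
abbrev Cot (x : B) : Type := Tan n x →L[ℝ] ℝ

/-- The cotangent bundle `T^*B` (with Mathlib's topology). -/
abbrev CotangentBundle (B : Type*) [TopologicalSpace B] [ChartedSpace (E n) B] : Type _ :=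
  TotalSpace (E n →L[ℝ] ℝ) (fun x : B => Cot n x)

/-- The differential at `x` of the affine chart `e`. -/
def chartDiff (e : OpenPartialHomeomorph B (E n)) (x : B) : Tan n x →L[ℝ] E n :=
  mfderiv 𝓘(ℝ, E n) 𝓘(ℝ, E n) e x

/-- The lattice `Λ_x ⊂ T_x B`: the vectors with integral components in affine charts. -/
def lattice (x : B) : AddSubgroup (Tan n x) where
  carrier := {v | ∀ e ∈ (specialIntegralAffineGroupoid n).maximalAtlas B, x ∈ e.source →
    ∀ j, ∃ k : ℤ, chartDiff n e x v j = k}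
  zero_mem' := fun e _ _ j => ⟨0, by simp⟩
  add_mem' := fun {v w} hv hw e he hx j => by
    obtain ⟨k, hk⟩ := hv e he hx j
    obtain ⟨l, hl⟩ := hw e he hx j
    exact ⟨k + l, by simp [map_add, hk, hl]⟩
  neg_mem' := fun {v} hv e he hx j => by
    obtain ⟨k, hk⟩ := hv e he hx j
    exact ⟨-k, by simp [map_neg, hk]⟩

/-- The dual lattice `Λ^*_x ⊂ T_x^* B`. -/
def dualLattice (x : B) : AddSubgroup (Cot n x) where
  carrier := {y | ∀ v ∈ lattice n x, ∃ k : ℤ, y v = k}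
  zero_mem' := fun v _ => ⟨0, by simp⟩
  add_mem' := fun {y z} hy hz v hv => by
    obtain ⟨k, hk⟩ := hy v hv
    obtain ⟨l, hl⟩ := hz v hv
    exact ⟨k + l, by simp [hk, hl]⟩
  neg_mem' := fun {y} hy v hv => by
    obtain ⟨k, hk⟩ := hy v hv
    exact ⟨-k, by simp [hk]⟩

/-- `X̌ = TB / Λ`. -/
def MirrorX (B : Type*) [TopologicalSpace B] [ChartedSpace (E n) B] : Type _ :=
  Σ x : B, Tan n x ⧸ lattice n x

/-- `X = T^*B / Λ^*`. -/
def DualX (B : Type*) [TopologicalSpace B] [ChartedSpace (E n) B] : Type _ :=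
  Σ x : B, Cot n x ⧸ dualLattice n x

variable {n}

/-- The point `[x, v]` of `X̌`. -/
def MirrorX.mk (x : B) (v : Tan n x) : MirrorX n B := ⟨x, QuotientAddGroup.mk v⟩

/-- The point `[x, y]` of `X`. -/
def DualX.mk (x : B) (y : Cot n x) : DualX n B := ⟨x, QuotientAddGroup.mk y⟩

/-- The zero section `L₀ ⊂ X`. -/
def zeroSection (n : ℕ) (B : Type*) [TopologicalSpace B] [ChartedSpace (E n) B] :
    Set (DualX n B) := {p | p.2 = 0}

end Base

variable {n : ℕ} {B : Type*} [TopologicalSpace B] [ChartedSpace (E n) B]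
  [HasGroupoid B (specialIntegralAffineGroupoid n)]

/-- A smooth Riemannian metric on `B`. -/
abbrev RiemMetric (n : ℕ) (B : Type*) [TopologicalSpace B] [ChartedSpace (E n) B]
    [HasGroupoid B (specialIntegralAffineGroupoid n)] : Type _ :=
  ContMDiffRiemannianMetric 𝓘(ℝ, E n) ∞ (E n) (fun x : B => Tan n x)

/-- A system of potentials showing that `g` is an integral Hessian type metric: affine charts
`x_i` with domains `U_i` covering `B` and smooth functions `φ_i` on `U_i` such that `g` is the
Hessian of `φ_i` in the coordinates `x_i`, and `φ_i - φ_j = ⟨m, x_j⟩ + a` on `U_i ∩ U_j` with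
`m ∈ ℤⁿ` and `a ∈ ℝ`. -/
structure IntegralPotentials (g : RiemMetric n B) (ι : Type*) where
  /-- the affine charts `x_i : U_i → ℝⁿ` -/
  chart : ι → OpenPartialHomeomorph B (E n)
  chart_mem : ∀ i, chart i ∈ (specialIntegralAffineGroupoid n).maximalAtlas B
  cover : ∀ x, ∃ i, x ∈ (chart i).source
  /-- the potentials -/
  φ : ι → B → ℝ
  smooth : ∀ i, ContMDiffOn 𝓘(ℝ, E n) 𝓘(ℝ, ℝ) ∞ (φ i) (chart i).source
  hessian : ∀ i, ∀ x ∈ (chart i).source, ∀ v w : Tan n x,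
    g.inner x v w = fderiv ℝ (fderiv ℝ (φ i ∘ (chart i).symm)) (chart i x)
      (chartDiff n (chart i) x v) (chartDiff n (chart i) x w)
  integral : ∀ i j, ∃ (m : Fin n → ℤ) (a : ℝ), ∀ x ∈ (chart i).source ∩ (chart j).source,
    φ i x - φ j x = ∑ k, (m k : ℝ) * chart j x k + a

namespace IntegralPotentials

variable {g : RiemMetric n B} {ι : Type*} (Φ : IntegralPotentials g ι)

/-- The covector `dφ_i(x) ∈ T_x^* B`. -/
def dpot (i : ι) (x : B) : Cot n x := mfderiv 𝓘(ℝ, E n) 𝓘(ℝ, ℝ) (Φ.φ i) x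

/-- The Lagrangian section `L_g = {(x, [dφ(x)])} ⊂ X`. -/
def lagrangian : Set (DualX n B) :=
  {p | ∃ (i : ι) (x : B), x ∈ (Φ.chart i).source ∧ p = DualX.mk x (Φ.dpot i x)}

/-- The fibrewise geodesic path space `P(L₀, L_g)`. In the flat torus `T_x^*B / Λ_x^*` every
homotopy class of paths from the zero section to `L_g` has exactly one geodesic representative
`t ↦ [t y]` (`0 ≤ t ≤ 1`), whose velocity `y ∈ T_x^*B` satisfies `[y] ∈ L_g`. So `P(L₀, L_g)` is the
preimage of `L_g` in `T^*B`, a covering space of `B`. -/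
def pathSpace : Set (CotangentBundle n B) := {p | DualX.mk p.1 p.2 ∈ Φ.lagrangian}

/-! ### Functions on the path space

A function on `P(L₀, L_g)` is a function `α x y` of `x : B` and `y ∈ T_x^*B` that vanishes outside
of `P(L₀, L_g)`. Over `U_i` the sheets of the covering are `x ↦ dφ_i(x) + ∑ m_k dx_i^k`,
`m ∈ ℤⁿ`. -/

/-- The covector `dφ_i(x) + ∑ m_k dx_i^k`. -/
def sheet (i : ι) (m : Fin n → ℤ) (x : B) : Cot n x :=
  Φ.dpot i x + ∑ k, (m k : ℝ) • (ContinuousLinearMap.proj (R := ℝ) k).comp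
    (chartDiff n (Φ.chart i) x)

/-- The function `α` on the sheet `m` over `U_i`, in the affine coordinates `x_i`. -/
def onSheet {F : Type*} (α : (x : B) → Cot n x → F) (i : ι) (m : Fin n → ℤ) (a : E n) : F :=
  α ((Φ.chart i).symm a) (Φ.sheet i m ((Φ.chart i).symm a))

/-- The differential `d𝒜` of the area function on the sheet `m` over `U_i`, in the
coordinates `x_i`: the `1`-form `∑ (∂φ_i/∂x^k + m_k) dx^k`. -/
def dArea (i : ι) (m : Fin n → ℤ) (a : E n) : E n →L[ℝ] ℝ :=
  fderiv ℝ (Φ.φ i ∘ (Φ.chart i).symm) a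
    + ∑ k, (m k : ℝ) • ContinuousLinearMap.proj (R := ℝ) k

/-- The space `A⁰(P(L₀, L_g))` of smooth complex functions on the path space. -/
def smoothFunctions : Submodule ℂ ((x : B) → Cot n x → ℂ) where
  carrier := {α | (∀ x y, (⟨x, y⟩ : CotangentBundle n B) ∉ Φ.pathSpace → α x y = 0) ∧
    ∀ i m, ContDiffOn ℝ ∞ (Φ.onSheet α i m) (Φ.chart i).target}
  zero_mem' := ⟨fun _ _ _ => rfl, fun _ _ => contDiffOn_const⟩
  add_mem' := fun {α β} hα hβ => ⟨fun x y h => by simp [hα.1 x y h, hβ.1 x y h],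
    fun i m => (hα.2 i m).add (hβ.2 i m)⟩
  smul_mem' := fun c α hα => ⟨fun x y h => by simp [hα.1 x y h],
    fun i m => (hα.2 i m).const_smul c⟩

/-- The norm of a covector with respect to `g`. -/
def cotNorm (_Φ : IntegralPotentials g ι) (x : B) (y : Cot n x) : ℝ :=
  sSup {c | ∃ v : Tan n x, g.inner x v v ≤ 1 ∧ c = |y v|}

/-- Rapid decay: for every compact `K ⊂ B` and all `k, l ≥ 0`, the supremum over `K` of
`|y|^k |∇^l α (x, y)|` tends to `0` as `|y| → ∞`. Here `∇` is the flat affine connection, so that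
`∇^l` is the `l`-th derivative in affine coordinates, and norms are taken with respect to `g`. -/
def RapidlyDecaying (α : (x : B) → Cot n x → ℂ) : Prop :=
  ∀ K : Set B, IsCompact K → ∀ k l : ℕ, ∀ ε : ℝ, 0 < ε → ∃ R : ℝ,
    ∀ (i : ι) (m : Fin n → ℤ) (x : B), x ∈ K → x ∈ (Φ.chart i).source →
      R < Φ.cotNorm x (Φ.sheet i m x) →
      ∀ v : Fin l → Tan n x, (∀ j, g.inner x (v j) (v j) ≤ 1) →
        Φ.cotNorm x (Φ.sheet i m x) ^ k *
          ‖iteratedFDeriv ℝ l (Φ.onSheet α i m) (Φ.chart i x)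
            (fun j => chartDiff n (Φ.chart i) x (v j))‖ ≤ ε

theorem cotNorm_nonneg (x : B) (y : Cot n x) : 0 ≤ Φ.cotNorm x y := by
  apply Real.sSup_nonneg
  rintro c ⟨v, _, rfl⟩
  exact abs_nonneg _

theorem contDiffAt_onSheet {α : (x : B) → Cot n x → ℂ} (hα : α ∈ Φ.smoothFunctions) (i : ι)
    (m : Fin n → ℤ) {a : E n} (ha : a ∈ (Φ.chart i).target) (k : ℕ) :
    ContDiffAt ℝ k (Φ.onSheet α i m) a :=
  ((hα.2 i m).contDiffAt ((Φ.chart i).open_target.mem_nhds ha)).of_le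
    (by exact_mod_cast le_top)

/-- The space `A⁰_{r.d.}(P(L₀, L_g))`. -/
def rapidlyDecayingFunctions : Submodule ℂ ((x : B) → Cot n x → ℂ) where
  carrier := {α | α ∈ Φ.smoothFunctions ∧ Φ.RapidlyDecaying α}
  zero_mem' := by
    refine ⟨Submodule.zero_mem _, fun K _ k l ε hε => ⟨0, ?_⟩⟩
    intro i m x _ _ _ v _
    have : Φ.onSheet (0 : (x : B) → Cot n x → ℂ) i m = 0 := rfl
    rw [this]
    simpa using hε.le
  add_mem' := by
    intro α β hα hβ
    refine ⟨Submodule.add_mem _ hα.1 hβ.1, fun K hK k l ε hε => ?_⟩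
    obtain ⟨R, hR⟩ := hα.2 K hK k l (ε / 2) (by positivity)
    obtain ⟨S, hS⟩ := hβ.2 K hK k l (ε / 2) (by positivity)
    refine ⟨max R S, fun i m x hxK hx hRS v hv => ?_⟩
    have h1 := hR i m x hxK hx (lt_of_le_of_lt (le_max_left _ _) hRS) v hv
    have h2 := hS i m x hxK hx (lt_of_le_of_lt (le_max_right _ _) hRS) v hv
    have ht := (Φ.chart i).map_source hx
    have : Φ.onSheet (α + β) i m = Φ.onSheet α i m + Φ.onSheet β i m := rfl
    rw [this, iteratedFDeriv_add_apply (Φ.contDiffAt_onSheet hα.1 i m ht l)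
      (Φ.contDiffAt_onSheet hβ.1 i m ht l), add_apply]
    have h3 := mul_le_mul_of_nonneg_left (norm_add_le
      (iteratedFDeriv ℝ l (Φ.onSheet α i m) (Φ.chart i x)
        (fun j => chartDiff n (Φ.chart i) x (v j)))
      (iteratedFDeriv ℝ l (Φ.onSheet β i m) (Φ.chart i x)
        (fun j => chartDiff n (Φ.chart i) x (v j))))
      (pow_nonneg (Φ.cotNorm_nonneg x (Φ.sheet i m x)) k)
    rw [mul_add] at h3
    linarith
  smul_mem' := by
    intro c α hα
    refine ⟨Submodule.smul_mem _ c hα.1, fun K hK k l ε hε => ?_⟩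
    have hc : 0 < ‖c‖ + 1 := by positivity
    obtain ⟨R, hR⟩ := hα.2 K hK k l (ε / (‖c‖ + 1)) (by positivity)
    refine ⟨R, fun i m x hxK hx hRS v hv => ?_⟩
    have h1 := hR i m x hxK hx hRS v hv
    have ht := (Φ.chart i).map_source hx
    have : Φ.onSheet (c • α) i m = c • Φ.onSheet α i m := rfl
    rw [this, iteratedFDeriv_const_smul_apply (Φ.contDiffAt_onSheet hα.1 i m ht l),
      smul_apply, norm_smul]
    rw [le_div_iff₀ hc] at h1
    have h0 : 0 ≤ Φ.cotNorm x (Φ.sheet i m x) ^ k *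
        ‖iteratedFDeriv ℝ l (Φ.onSheet α i m) (Φ.chart i x)
          (fun j => chartDiff n (Φ.chart i) x (v j))‖ :=
      mul_nonneg (pow_nonneg (Φ.cotNorm_nonneg x _) k) (norm_nonneg _)
    nlinarith [norm_nonneg c]

/-- The space `ker(d_W) ∩ A⁰_{r.d.}(P(L₀, L_g))`, where `d_W = d + 2π d𝒜 ∧`. -/
def wittenKernel : Submodule ℂ ((x : B) → Cot n x → ℂ) where
  carrier := {α | α ∈ Φ.rapidlyDecayingFunctions ∧
    ∀ i m, ∀ a ∈ (Φ.chart i).target, ∀ u : E n,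
      fderiv ℝ (Φ.onSheet α i m) a u
        + 2 * Real.pi * (Φ.dArea i m a u : ℂ) * Φ.onSheet α i m a = 0}
  zero_mem' := by
    refine ⟨Submodule.zero_mem _, fun i m a _ u => ?_⟩
    have : Φ.onSheet (0 : (x : B) → Cot n x → ℂ) i m = 0 := rfl
    rw [this]
    simp
  add_mem' := by
    intro α β hα hβ
    refine ⟨Submodule.add_mem _ hα.1 hβ.1, fun i m a ha u => ?_⟩
    have : Φ.onSheet (α + β) i m = Φ.onSheet α i m + Φ.onSheet β i m := rfl
    rw [this, fderiv_add
      ((Φ.contDiffAt_onSheet hα.1.1 i m ha 1).differentiableAt (by norm_num))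
      ((Φ.contDiffAt_onSheet hβ.1.1 i m ha 1).differentiableAt (by norm_num))]
    have h1 := hα.2 i m a ha u
    have h2 := hβ.2 i m a ha u
    simp only [add_apply, Pi.add_apply]
    linear_combination h1 + h2
  smul_mem' := by
    intro c α hα
    refine ⟨Submodule.smul_mem _ c hα.1, fun i m a ha u => ?_⟩
    have : Φ.onSheet (c • α) i m = c • Φ.onSheet α i m := rfl
    rw [this, fderiv_const_smul
      ((Φ.contDiffAt_onSheet hα.1.1 i m ha 1).differentiableAt (by norm_num))]
    have h1 := hα.2 i m a ha u
    simp only [smul_apply, Pi.smul_apply, smul_eq_mul]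
    linear_combination c * h1

/-- The connected component `P_x(L₀, L_g)` of the constant path at the point `(x, 0)`. -/
def component (x : B) : Set (CotangentBundle n B) := connectedComponentIn Φ.pathSpace ⟨x, 0⟩

/-- `𝒜` is the primitive of `d𝒜` on the component of the constant path at `(x₀, 0)` that
vanishes at this constant path. (Its values outside of the component are irrelevant.) -/
def IsAreaPrimitive (x₀ : B) (𝒜 : (x : B) → Cot n x → ℝ) : Prop :=
  𝒜 x₀ 0 = 0 ∧ ∀ i m, ∀ a ∈ (Φ.chart i).target,
    (⟨(Φ.chart i).symm a, Φ.sheet i m ((Φ.chart i).symm a)⟩ : CotangentBundle n B)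
        ∈ Φ.component x₀ →
      HasFDerivAt (Φ.onSheet 𝒜 i m) (Φ.dArea i m a) a

open Classical in
/-- The function `e^{-2π𝒜}` on the component of the constant path at `(x₀, 0)`, extended by zero
to the other components. -/
def wittenState (x₀ : B) (𝒜 : (x : B) → Cot n x → ℝ) (x : B) (y : Cot n x) : ℂ :=
  if (⟨x, y⟩ : CotangentBundle n B) ∈ Φ.component x₀ then
    Complex.exp (-(2 * Real.pi * 𝒜 x y : ℝ)) else 0

/-! ### The mirror line bundle

The Poincaré bundle is the quotient of `(T^*B ⊕ TB) × ℂ` by `(y, v, t) ↦ (y + μ, v, e^{-iπ⟨μ,v⟩} t)`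
for `μ ∈ Λ^*` and `(y, v, t) ↦ (y, v + ν, e^{iπ⟨y,ν⟩} t)` for `ν ∈ Λ`, with the connection
`d + iπ(⟨y, dv⟩ - ⟨v, dy⟩)`. The line bundle `Ľ_g` on `X̌` is its pullback along `L_g`.
An element of the fibre of such a quotient bundle is an equivariant function on an orbit. -/

/-- The fibre of `Ľ_g` at `q ∈ X̌`. -/
def mirrorLine (q : MirrorX n B) : Submodule ℂ (Cot n q.1 → Tan n q.1 → ℂ) where
  carrier := {t |
    (∀ y v, t y v ≠ 0 → DualX.mk q.1 y ∈ Φ.lagrangian ∧ MirrorX.mk q.1 v = q) ∧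
    (∀ y v, ∀ μ ∈ dualLattice n q.1,
      t (y + μ) v = Complex.exp (-(Real.pi * μ v : ℝ) * Complex.I) * t y v) ∧
    (∀ y v, ∀ ν ∈ lattice n q.1,
      t y (v + ν) = Complex.exp ((Real.pi * y ν : ℝ) * Complex.I) * t y v)}
  zero_mem' := ⟨fun _ _ h => absurd rfl h, fun _ _ _ _ => by simp, fun _ _ _ _ => by simp⟩
  add_mem' := by
    rintro s t ⟨hs1, hs2, hs3⟩ ⟨ht1, ht2, ht3⟩
    refine ⟨fun y v h => ?_, fun y v μ hμ => ?_, fun y v ν hν => ?_⟩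
    · by_cases h0 : s y v = 0
      · exact ht1 y v (fun h1 => h (by simp [h0, h1]))
      · exact hs1 y v h0
    · simp only [Pi.add_apply, hs2 y v μ hμ, ht2 y v μ hμ, mul_add]
    · simp only [Pi.add_apply, hs3 y v ν hν, ht3 y v ν hν, mul_add]
  smul_mem' := by
    rintro c t ⟨ht1, ht2, ht3⟩
    refine ⟨fun y v h => ht1 y v (fun h1 => h (by simp [h1])), fun y v μ hμ => ?_,
      fun y v ν hν => ?_⟩
    · simp only [Pi.smul_apply, smul_eq_mul, ht2 y v μ hμ]; ring
    · simp only [Pi.smul_apply, smul_eq_mul, ht3 y v ν hν]; ring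

/-- Sections of `Ľ_g` over `X̌`, without any regularity. -/
abbrev RoughSection : Type _ := (q : MirrorX n B) → Φ.mirrorLine q

/-- The equivariant function of `x ∈ B`, `y ∈ T_x^*B` and `v ∈ T_xB` given by a section. -/
def eval (s : Φ.RoughSection) (x : B) (y : Cot n x) (v : Tan n x) : ℂ :=
  (s (MirrorX.mk x v)).1 y v

/-- The function `t y v` of `y ∈ T_x^*B` with `[y] ∈ L_g` and of `v ∈ T_xB` is covariantly constant
along the fibre of `X̌` over `x`. -/
def FlatAlongFibre (x : B) (t : Cot n x → Tan n x → ℂ) : Prop :=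
  ∀ y, DualX.mk x y ∈ Φ.lagrangian → ∀ v u : Tan n x,
    HasLineDerivAt ℝ (t y) (-((Real.pi * y u : ℝ) * Complex.I * t y v)) v u

/-- The fibre of `X̌` over `x` is Bohr–Sommerfeld: the restriction of `Ľ_g` to it, with its
connection, is trivial, that is, has a nowhere vanishing covariantly constant section. -/
def IsBohrSommerfeld (x : B) : Prop :=
  ∃ t : (w : Tan n x ⧸ lattice n x) → Φ.mirrorLine ⟨x, w⟩, (∀ w, t w ≠ 0) ∧
    Φ.FlatAlongFibre x (fun y v => (t (QuotientAddGroup.mk v)).1 y v)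

/-- The real polarized sections of `Ľ_g`: sections with `∇_v s = 0` for all `v` tangent to the
fibres of `X̌ → B`. No regularity transverse to the fibres is required. -/
def realPolarized : Submodule ℂ Φ.RoughSection where
  carrier := {s | ∀ x, Φ.FlatAlongFibre x (Φ.eval s x)}
  zero_mem' := by
    intro x y _ v u
    have : Φ.eval (0 : Φ.RoughSection) x y = fun _ => 0 := rfl
    rw [this]
    simpa [HasLineDerivAt] using hasDerivAt_const (0 : ℝ) (0 : ℂ)
  add_mem' := by
    intro s t hs ht x y hy v u
    have : Φ.eval (s + t) x y = fun v => Φ.eval s x y v + Φ.eval t x y v := rfl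
    rw [this]
    have h := HasDerivAt.add (hs x y hy v u) (ht x y hy v u)
    refine HasDerivAt.congr_deriv (f := fun r : ℝ => Φ.eval s x y (v + r • u)
      + Φ.eval t x y (v + r • u)) h ?_
    ring
  smul_mem' := by
    intro c s hs x y hy v u
    have : Φ.eval (c • s) x y = fun v => c * Φ.eval s x y v := rfl
    rw [this]
    have h := HasDerivAt.const_mul c (hs x y hy v u)
    refine HasDerivAt.congr_deriv (f := fun r : ℝ => c * Φ.eval s x y (v + r • u)) h ?_
    ring

/-- The coefficient of a section over `U_i` with respect to the unitary frame
`1̌ = e^{iπ⟨dφ_i, v⟩}`, in the coordinates `(x, y̌)` of `TU_i` given by the affine chart. -/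
def coeff (s : Φ.RoughSection) (i : ι) (z : E n × E n) : ℂ :=
  let x := (Φ.chart i).symm z.1
  let v : Tan n x := mfderiv 𝓘(ℝ, E n) 𝓘(ℝ, E n) (Φ.chart i).symm z.1 z.2
  Complex.exp (-(Real.pi * Φ.dpot i x v : ℝ) * Complex.I) * Φ.eval s x (Φ.dpot i x) v

/-- The covariant derivative of a coefficient function along `V`, for the connection
`∇ = d + 2πi ∑ (∂φ_i/∂x^j) dy̌^j`, whose curvature satisfies
`(i/2π) F = ∑ g_jk dy̌^j ∧ dx^k`. -/
def covDeriv (i : ι) (f : E n × E n → ℂ) (z V : E n × E n) : ℂ :=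
  fderiv ℝ f z V
    + 2 * Real.pi * Complex.I * (fderiv ℝ (Φ.φ i ∘ (Φ.chart i).symm) z.1 V.2 : ℂ) * f z

/-- The complex structure of `X̌` in the coordinates `(x, y̌)`: `J(∂/∂x) = -∂/∂y̌` and
`J(∂/∂y̌) = ∂/∂x`, so that the functions `y̌ + i x` are holomorphic. -/
def complexStructure (V : E n × E n) : E n × E n := (V.2, -V.1)

theorem coeff_add (s t : Φ.RoughSection) (i : ι) :
    Φ.coeff (s + t) i = Φ.coeff s i + Φ.coeff t i := by
  funext z
  exact mul_add _ _ _

theorem coeff_smul (c : ℂ) (s : Φ.RoughSection) (i : ι) :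
    Φ.coeff (c • s) i = c • Φ.coeff s i := by
  funext z
  exact mul_left_comm _ _ _

/-- The complex polarized sections `H⁰(X̌, Ľ_g)`: the smooth sections with `∇_w s = 0` for all
`w ∈ T^{0,1}X̌ = {V + i J V}`. -/
def holomorphicSections : Submodule ℂ Φ.RoughSection where
  carrier := {s | ∀ i, ContDiffOn ℝ ∞ (Φ.coeff s i) ((Φ.chart i).target ×ˢ univ) ∧
    ∀ z ∈ (Φ.chart i).target ×ˢ (univ : Set (E n)), ∀ V : E n × E n,
      Φ.covDeriv i (Φ.coeff s i) z V
        + Complex.I * Φ.covDeriv i (Φ.coeff s i) z (complexStructure V) = 0}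
  zero_mem' := by
    intro i
    have : Φ.coeff (0 : Φ.RoughSection) i = 0 := by
      funext z
      exact mul_zero _
    rw [this]
    exact ⟨contDiffOn_const, fun z _ V => by simp [covDeriv]⟩
  add_mem' := by
    intro s t hs ht i
    rw [Φ.coeff_add]
    refine ⟨(hs i).1.add (ht i).1, fun z hz V => ?_⟩
    have hn := ((Φ.chart i).open_target.prod isOpen_univ).mem_nhds hz
    have h1 := (hs i).2 z hz V
    have h2 := (ht i).2 z hz V
    have d1 := (((hs i).1.contDiffAt hn).differentiableAt (by simp))
    have d2 := (((ht i).1.contDiffAt hn).differentiableAt (by simp))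
    simp only [covDeriv, fderiv_add d1 d2, add_apply, Pi.add_apply] at *
    linear_combination h1 + h2
  smul_mem' := by
    intro c s hs i
    rw [Φ.coeff_smul]
    refine ⟨(hs i).1.const_smul c, fun z hz V => ?_⟩
    have hn := ((Φ.chart i).open_target.prod isOpen_univ).mem_nhds hz
    have h1 := (hs i).2 z hz V
    have d1 := (((hs i).1.contDiffAt hn).differentiableAt (by simp))
    simp only [covDeriv, fderiv_const_smul d1, smul_apply, Pi.smul_apply,
      smul_eq_mul] at *
    linear_combination c * h1

/-! ### The SYZ transform -/

/-- The term `α(x, y + μ) e^{2πi⟨μ, v⟩}` of the SYZ transform. -/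
def syzTerm (α : (x : B) → Cot n x → ℂ) (x : B) (y : Cot n x) (v : Tan n x)
    (μ : dualLattice n x) : ℂ :=
  α x (y + μ.1) * Complex.exp ((2 * Real.pi * μ.1 v : ℝ) * Complex.I)

/-- The SYZ transform of a function on the path space:
`𝓕(α) = (∑_μ α(x, y + μ) e^{2πi⟨μ, v⟩}) 1̌`, where `1̌ = e^{iπ⟨y, v⟩}` is the unitary frame given by
the lift `y ∈ T_x^*B` of the point of `L_g` over `x`. -/
def syzTransform (α : (x : B) → Cot n x → ℂ) (x : B) (y : Cot n x) (v : Tan n x) : ℂ :=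
  (∑' μ : dualLattice n x, syzTerm α x y v μ) *
    Complex.exp ((Real.pi * y v : ℝ) * Complex.I)

open Classical in
/-- The basic section supported on the fibre of `X̌` over `x₀`: there it is the covariantly
constant section `e^{-iπ⟨y, v⟩}`, normalized to be `1` at `y = 0`, and it vanishes on all other
fibres. -/
def fibreSection (x₀ x : B) (y : Cot n x) (v : Tan n x) : ℂ :=
  if x = x₀ ∧ DualX.mk x y ∈ Φ.lagrangian then
    Complex.exp (-(Real.pi * y v : ℝ) * Complex.I) else 0

/-- The base points of the Bohr–Sommerfeld fibres. -/
abbrev BSFibre : Type _ := {x : B // Φ.IsBohrSommerfeld x}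

/-- The intersection points of the zero section `L₀` and `L_g` in `X`. -/
abbrev Intersection : Type _ := ↥(zeroSection n B ∩ Φ.lagrangian)

end IntegralPotentials

end SemiFlat

end

/-! Everything is lifted to ℝⁿ. Completeness provides a covering `p : ℝⁿ → B` that is affine in all
charts; after composition with one affine map it is special integral affine in all of them
(`exists_development`). The second derivatives of the pulled back potentials are all the pullback of
the metric, so they glue, and two integrations give a function `f` on ℝⁿ with differential `Y` and
Hessian the metric. With the right constant of integration, `f` differs from each local potential by
an affine function with integral linear part (`exists_globalPotential`). Hence the path space is
covered by the sheets `S m`, `a ↦ Y a + m` with m ∈ ℤⁿ, and `ψ m = f + ⟨m, ·⟩` is a primitive of d𝒜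
on the sheet `m`.

In this picture both sides of the SYZ transform are the same sequences (c_m). The Witten equation
says that α = c_m e^{-2πψ_m} on the sheet `m`. Decay over single points bounds |c_m| e^{-2π⟨m,a⟩} in
m for every a, so c decays faster than any exponential (`exists_isWittenSum`); conversely a compact
fundamental domain in ℝⁿ makes such coefficients give decay of α with all derivatives
(`IsWittenSum.mem_wittenKernel`). On the mirror side e^{-2πf} 1̌ is a holomorphic frame over the
universal cover, so a section is holomorphic exactly when its coefficient h(a, v) is holomorphic in
v + ia (`mem_holomorphicSections_iff`). As h is ℤⁿ-periodic in v, it is a Fourier series ∑ c_m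
e^{2πi⟨m, v + ia⟩}, again with rapidly decaying c (`exists_theta`). The identity e^{-2πψ_m(a)}
e^{2πi⟨m,v⟩} = e^{-2πf(a)} e^{2πi⟨m, v + ia⟩} matches the two expansions term by term
(`hasSum_sheets`). Uniqueness of Fourier coefficients gives injectivity, and also shows that the
function α built from a holomorphic section is consistent on B (`exists_isWittenSum_of_hol_eq`).

For the basis of the Witten kernel, intersection points lift to the zeros of `Y + m`. Convexity of
`f` makes such a zero unique on its sheet and the minimum of `ψ m`. No nontrivial deck
transformation preserves this sheet, so the primitive 𝒜 descends to the component, and e^{-2π𝒜} ≤ 1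
gives the coefficient bounds (`wittenState_mem`). Evaluation at the intersection points sends these
functions to the standard basis. It is injective on the kernel by a maximum principle: |α| attains
its maximum if α ≠ 0, there `ψ m` has a minimum, and so this is an intersection point where α does
not vanish (`IsWittenSum.exists_zero_ne`).

A section that is flat along a fibre is t(y, 0) e^{-iπ⟨y,v⟩}. Comparison with the equivariance
factor e^{iπ⟨y,ν⟩} forces ⟨y,ν⟩ ∈ ℤ, so nonzero real polarized sections live exactly over
intersection points (`isBohrSommerfeld_iff`, `exists_realBasis`). The final isomorphism matches the
two finite bases. -/

noncomputable section

namespace SemiFlat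

/-! ### Integral linear algebra -/

/-- The linear automorphism of `ℝⁿ` given by an element of `SL(n, ℤ)`. -/
def slEquiv {n : ℕ} (A : Matrix.SpecialLinearGroup (Fin n) ℤ) : E n ≃L[ℝ] E n :=
  LinearEquiv.toContinuousLinearEquiv
    { Matrix.mulVecLin (A.1.map (Int.cast : ℤ → ℝ)) with
      invFun := (A⁻¹.1.map (Int.cast : ℤ → ℝ)).mulVec
      left_inv := fun v => by
        have h : A⁻¹.1.map (Int.cast : ℤ → ℝ) * A.1.map (Int.cast : ℤ → ℝ) = 1 := by
          have := Matrix.map_mul (f := Int.castRingHom ℝ) (L := A⁻¹.1) (M := A.1)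
          rw [← Matrix.SpecialLinearGroup.coe_mul, inv_mul_cancel] at this
          simpa using this.symm
        change (A⁻¹.1.map (Int.cast : ℤ → ℝ)).mulVec
          ((A.1.map (Int.cast : ℤ → ℝ)).mulVec v) = v
        rw [Matrix.mulVec_mulVec, h, Matrix.one_mulVec]
      right_inv := fun v => by
        have h : A.1.map (Int.cast : ℤ → ℝ) * A⁻¹.1.map (Int.cast : ℤ → ℝ) = 1 := by
          have := Matrix.map_mul (f := Int.castRingHom ℝ) (L := A.1) (M := A⁻¹.1)
          rw [← Matrix.SpecialLinearGroup.coe_mul, mul_inv_cancel] at this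
          simpa using this.symm
        change (A.1.map (Int.cast : ℤ → ℝ)).mulVec
          ((A⁻¹.1.map (Int.cast : ℤ → ℝ)).mulVec v) = v
        rw [Matrix.mulVec_mulVec, h, Matrix.one_mulVec] }

theorem slEquiv_apply {n : ℕ} (A : Matrix.SpecialLinearGroup (Fin n) ℤ) (v : E n) :
    slEquiv A v = (A.1.map (Int.cast : ℤ → ℝ)).mulVec v := rfl

theorem slEquiv_symm_apply {n : ℕ} (A : Matrix.SpecialLinearGroup (Fin n) ℤ) (v : E n) :
    (slEquiv A).symm v = (A⁻¹.1.map (Int.cast : ℤ → ℝ)).mulVec v := rfl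

theorem slEquiv_symm {n : ℕ} (A : Matrix.SpecialLinearGroup (Fin n) ℤ) :
    (slEquiv A).symm = slEquiv A⁻¹ := by
  ext v
  rw [slEquiv_symm_apply, slEquiv_apply]

theorem slEquiv_mul {n : ℕ} (A C : Matrix.SpecialLinearGroup (Fin n) ℤ) (v : E n) :
    slEquiv (A * C) v = slEquiv A (slEquiv C v) := by
  have := Matrix.map_mul (f := Int.castRingHom ℝ) (L := A.1) (M := C.1)
  simp only [slEquiv_apply, Matrix.mulVec_mulVec, Matrix.SpecialLinearGroup.coe_mul]
  congr 1

/-- The dual space of `ℝⁿ`. -/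
abbrev Dual (n : ℕ) : Type := E n →L[ℝ] ℝ

/-- The covector with integral components `m`. -/
def intCov {n : ℕ} (m : Fin n → ℤ) : Dual n :=
  ∑ k, (m k : ℝ) • ContinuousLinearMap.proj (R := ℝ) k

theorem intCov_apply {n : ℕ} (m : Fin n → ℤ) (v : E n) : intCov m v = ∑ k, (m k : ℝ) * v k := by
  simp [intCov]

theorem intCov_single {n : ℕ} (m : Fin n → ℤ) (k : Fin n) :
    intCov m (Pi.single k 1) = m k := by
  simp [intCov_apply, Pi.single_apply]

theorem intCov_add {n : ℕ} (m k : Fin n → ℤ) : intCov (m + k) = intCov m + intCov k := by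
  ext v
  simp [intCov_apply, add_mul, Finset.sum_add_distrib]

theorem intCov_neg {n : ℕ} (m : Fin n → ℤ) : intCov (-m) = -intCov m := by
  ext v
  simp [intCov_apply]

theorem intCov_sub {n : ℕ} (m k : Fin n → ℤ) : intCov (m - k) = intCov m - intCov k := by
  rw [sub_eq_add_neg, intCov_add, intCov_neg, sub_eq_add_neg]

@[simp] theorem intCov_zero {n : ℕ} : intCov (0 : Fin n → ℤ) = 0 := by
  ext v
  simp [intCov_apply]

theorem intCov_injective {n : ℕ} : Function.Injective (intCov (n := n)) := by
  intro m k h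
  funext j
  have := congrArg (fun f : Dual n => f (Pi.single j 1)) h
  simp only [intCov_single] at this
  exact_mod_cast this

theorem intCov_int {n : ℕ} (m : Fin n → ℤ) {v : E n} (hv : ∀ j, ∃ k : ℤ, v j = k) :
    ∃ k : ℤ, intCov m v = k := by
  choose k hk using hv
  exact ⟨∑ j, m j * k j, by simp [intCov_apply, hk]⟩

theorem exists_intCov {n : ℕ} (η : Dual n) (h : ∀ v : E n, (∀ j, ∃ k : ℤ, v j = k) →
    ∃ k : ℤ, η v = k) : ∃ m, η = intCov m := by
  have h1 : ∀ j, ∃ k : ℤ, η (Pi.single j 1) = k := fun j => h _ fun i => by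
    by_cases hij : i = j
    · subst hij; exact ⟨1, by simp⟩
    · exact ⟨0, by simp [hij]⟩
  choose m hm using h1
  refine ⟨m, ?_⟩
  ext v
  rw [intCov_apply]
  conv_lhs => rw [pi_eq_sum_univ' v]
  rw [map_sum]
  refine Finset.sum_congr rfl fun j _ => ?_
  rw [map_smul, smul_eq_mul, mul_comm]
  congr 1
  exact hm j ▸ by congr 1

/-- The right action of `SL(n, ℤ)` on integral covectors. -/
def covAct {n : ℕ} (m : Fin n → ℤ) (A : Matrix.SpecialLinearGroup (Fin n) ℤ) : Fin n → ℤ :=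
  Matrix.vecMul m A.1

theorem intCov_slEquiv {n : ℕ} (m : Fin n → ℤ) (A : Matrix.SpecialLinearGroup (Fin n) ℤ)
    (v : E n) : intCov m (slEquiv A v) = intCov (covAct m A) v := by
  simp only [intCov_apply, slEquiv_apply, covAct, Matrix.mulVec, Matrix.vecMul, dotProduct,
    Matrix.map_apply, Int.cast_sum, Int.cast_mul, Finset.mul_sum, Finset.sum_mul]
  rw [Finset.sum_comm]
  refine Finset.sum_congr rfl fun i _ => Finset.sum_congr rfl fun j _ => by ring

theorem intCov_comp_slEquiv {n : ℕ} (m : Fin n → ℤ) (A : Matrix.SpecialLinearGroup (Fin n) ℤ) :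
    (intCov m).comp (slEquiv A : E n →L[ℝ] E n) = intCov (covAct m A) := by
  ext v
  exact intCov_slEquiv m A v

theorem covAct_inv {n : ℕ} (m : Fin n → ℤ) (A : Matrix.SpecialLinearGroup (Fin n) ℤ) :
    covAct (covAct m A⁻¹) A = m := by
  simp only [covAct, Matrix.vecMul_vecMul, ← Matrix.SpecialLinearGroup.coe_mul,
    inv_mul_cancel, Matrix.SpecialLinearGroup.coe_one, Matrix.vecMul_one]

theorem slEquiv_int {n : ℕ} (A : Matrix.SpecialLinearGroup (Fin n) ℤ) {v : E n}
    (hv : ∀ j, ∃ k : ℤ, v j = k) (j : Fin n) : ∃ k : ℤ, slEquiv A v j = k := by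
  choose k hk using hv
  exact ⟨∑ i, A.1 j i * k i, by simp [slEquiv_apply, Matrix.mulVec, dotProduct, hk]⟩

/-! ### The development of a complete special integral affine manifold -/

section Development

variable {n : ℕ} {B : Type*} [TopologicalSpace B] [ChartedSpace (E n) B]

/-- The covering map `p` is given near `a` by a special integral affine map in the chart `e`. -/
def IsIntegralAt (p : E n → B) (e : OpenPartialHomeomorph B (E n)) (a : E n) : Prop :=
  ∃ (A : Matrix.SpecialLinearGroup (Fin n) ℤ) (b : E n), ∀ᶠ z in 𝓝 a, e (p z) = slEquiv A z + b

/-- Chart changes are themselves locally in SL(n, ℤ) ⋉ ℝⁿ. So integrality of `p` at `a` does not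
depend on the chart, which allows a clopen argument over ℝⁿ. -/
theorem isIntegralAt_of_chart [HasGroupoid B (specialIntegralAffineGroupoid n)] {p : E n → B}
    (hp : Continuous p) {e e' : OpenPartialHomeomorph B (E n)}
    (he : e ∈ (specialIntegralAffineGroupoid n).maximalAtlas B)
    (he' : e' ∈ (specialIntegralAffineGroupoid n).maximalAtlas B) {a : E n}
    (ha : p a ∈ e.source) (ha' : p a ∈ e'.source) (h : IsIntegralAt p e a) :
    IsIntegralAt p e' a := by
  obtain ⟨A, b, hA⟩ := h
  have hc := (specialIntegralAffineGroupoid n).compatible_of_mem_maximalAtlas he he'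
  have h1 : IsSpecialIntegralAffineOn n (e.symm ≫ₕ e') (e.symm ≫ₕ e').source :=
    ((mem_groupoid_of_pregroupoid).1 hc).1
  obtain ⟨C, d, u, hu, hau, hC⟩ := h1 (e (p a)) (by simp [ha, ha'])
  refine ⟨C * A, slEquiv C b + d, ?_⟩
  have c1 : ∀ᶠ z in 𝓝 a, p z ∈ e.source := hp.continuousAt.eventually (e.open_source.mem_nhds ha)
  have c2 : ∀ᶠ z in 𝓝 a, p z ∈ e'.source := hp.continuousAt.eventually (e'.open_source.mem_nhds ha')
  have c3 : ∀ᶠ z in 𝓝 a, e (p z) ∈ u :=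
    ((e.continuousAt ha).comp hp.continuousAt).eventually (hu.mem_nhds hau)
  filter_upwards [hA, c1, c2, c3] with z h1 h2 h3 h4
  have := hC (e (p z)) ⟨by simp [h2, h3], h4⟩
  simp only [OpenPartialHomeomorph.coe_trans, Function.comp_apply, e.left_inv h2] at this
  rw [this, h1, ← slEquiv_apply, map_add, slEquiv_mul, add_assoc]

variable (B) in
/-- A developing covering `ℝⁿ → B` that is special integral affine in all charts. -/
structure Development (n : ℕ) [ChartedSpace (E n) B] where
  /-- the covering map -/
  p : E n → B
  cov : IsCoveringMap p
  surj : Function.Surjective p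
  integral : ∀ e ∈ (specialIntegralAffineGroupoid n).maximalAtlas B, ∀ a, p a ∈ e.source →
    IsIntegralAt p e a

/-- Completeness only makes `p₀` affine with arbitrary real linear part. Normalizing it to be the
identity in one chart makes it integral at one point, and integrality then spreads over the
connected space ℝⁿ. -/
theorem exists_development [HasGroupoid B (specialIntegralAffineGroupoid n)]
    (hB : IsCompleteAffine n B) : Nonempty (Development B n) := by
  obtain ⟨p₀, hcov, hsurj, haff⟩ := hB
  have hch : ∀ x : B, chartAt (E n) x ∈ (specialIntegralAffineGroupoid n).maximalAtlas B :=
    fun x => (specialIntegralAffineGroupoid n).subset_maximalAtlas (chart_mem_atlas _ x)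
  obtain ⟨T₀, hT₀⟩ := haff _ (hch (p₀ 0)) 0 (mem_chart_source _ _)
  -- Precomposition with `T₀⁻¹` turns the covering into the identity in the chart at `p₀ 0`.
  let L : E n ≃ᵃ[ℝ] E n := T₀.symm
  have hL : Continuous L := L.toAffineMap.continuous_of_finiteDimensional
  have hLs : Continuous L.symm := L.symm.toAffineMap.continuous_of_finiteDimensional
  let Lh : E n ≃ₜ E n := ⟨L.toEquiv, hL, hLs⟩
  let p : E n → B := p₀ ∘ Lh
  have hpc : IsCoveringMap p := hcov.comp_homeomorph Lh
  have haff' : ∀ e ∈ (specialIntegralAffineGroupoid n).maximalAtlas B, ∀ a : E n, p a ∈ e.source →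
      ∃ T : E n ≃ᵃ[ℝ] E n, ∀ᶠ z in 𝓝 a, e (p z) = T z := by
    intro e he a ha
    obtain ⟨T, hT⟩ := haff e he (L a) ha
    exact ⟨L.trans T, hL.continuousAt.eventually hT⟩
  have hfd : ∀ T : E n ≃ᵃ[ℝ] E n, ∃ M : E n →L[ℝ] E n, ∀ z, T z = M z + T 0 := fun T => by
    refine ⟨LinearMap.toContinuousLinearMap (T.linear : E n →ₗ[ℝ] E n), fun z => ?_⟩
    have := T.map_vadd 0 z
    simpa using this
  have key : ∀ a, IsIntegralAt p (chartAt (E n) (p a)) a := by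
    let S : Set (E n) := {a | IsIntegralAt p (chartAt (E n) (p a)) a}
    have hmem : ∀ a, ∀ᶠ a' in 𝓝 a, p a' ∈ (chartAt (E n) (p a)).source := fun a =>
      hpc.continuous.continuousAt.eventually
        ((chartAt (E n) (p a)).open_source.mem_nhds (mem_chart_source _ _))
    have hopen : IsOpen S := by
      rw [isOpen_iff_eventually]
      rintro a ⟨A, b, hA⟩
      filter_upwards [hA.eventually_nhds, hmem a] with a' h1 h2
      exact isIntegralAt_of_chart hpc.continuous (hch _) (hch _) h2 (mem_chart_source _ _)
        ⟨A, b, h1⟩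
    -- Near a limit point the map is a single affine `T`; at a nearby point of `S` its linear part
    -- is that of an element of SL(n, ℤ), hence so it is at the limit point.
    have hclosed : IsClosed S := by
      rw [← closure_subset_iff_isClosed]
      intro a ha
      obtain ⟨T, hT⟩ := haff' _ (hch (p a)) a (mem_chart_source _ _)
      obtain ⟨a', h3, h1, h2⟩ := ((mem_closure_iff_frequently.1 ha).and_eventually
        (hT.eventually_nhds.and (hmem a))).exists
      obtain ⟨A, b, hA⟩ := isIntegralAt_of_chart hpc.continuous (hch _) (hch (p a))
        (mem_chart_source _ _) h2 h3
      obtain ⟨M, hM⟩ := hfd T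
      have hd : HasFDerivAt (fun z => slEquiv A z + b) (slEquiv A : E n →L[ℝ] E n) a' :=
        (slEquiv A).hasFDerivAt.add_const b
      have hd' : HasFDerivAt (fun z => M z + T 0) M a' := M.hasFDerivAt.add_const _
      have he : (fun z => slEquiv A z + b) =ᶠ[𝓝 a'] fun z => M z + T 0 := by
        filter_upwards [h1, hA] with z e1 e2
        rw [← e2, e1, hM]
      have hMA : (slEquiv A : E n →L[ℝ] E n) = M := hd.unique (hd'.congr_of_eventuallyEq he)
      refine ⟨A, T 0, ?_⟩
      filter_upwards [hT] with z hz
      rw [hz, hM, ← hMA]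
      rfl
    have hne : S.Nonempty := by
      refine ⟨T₀ 0, ?_⟩
      have h0 : p (T₀ 0) = p₀ 0 := congrArg p₀ (T₀.symm_apply_apply 0)
      change IsIntegralAt p (chartAt (E n) (p (T₀ 0))) (T₀ 0)
      rw [h0]
      refine ⟨1, 0, ?_⟩
      have hl : L (T₀ 0) = 0 := T₀.symm_apply_apply 0
      have : ∀ᶠ z in 𝓝 (T₀ 0), (chartAt (E n) (p₀ 0)) (p₀ (L z)) = T₀ (L z) :=
        (hL.tendsto' _ _ hl).eventually hT₀
      filter_upwards [this] with z hz
      change (chartAt (E n) (p₀ 0)) (p₀ (L z)) = _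
      rw [hz, T₀.apply_symm_apply]
      simp [slEquiv_apply]
    have := IsClopen.eq_univ ⟨hclosed, hopen⟩ hne
    exact fun a => (this ▸ mem_univ a : a ∈ S)
  exact ⟨⟨p, hpc, hsurj.comp Lh.surjective, fun e he a ha =>
    isIntegralAt_of_chart hpc.continuous (hch _) he (mem_chart_source _ _) ha (key a)⟩⟩

end Development

/-! ### Differentials and lattices in the coordinates of the universal cover -/

section Base

variable {n : ℕ} {B : Type*} [TopologicalSpace B] [ChartedSpace (E n) B]

theorem specialIntegralAffineGroupoid_le_contDiffGroupoid (n : ℕ) (k : ℕ∞ω) :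
    specialIntegralAffineGroupoid n ≤ contDiffGroupoid k 𝓘(ℝ, E n) := by
  refine groupoid_of_pregroupoid_le _ _ fun f s hf => ?_
  have := IsSpecialIntegralAffineOn.contDiffOn hf k
  simpa [contDiffPregroupoid] using this

theorem mem_smooth_maximalAtlas {e : OpenPartialHomeomorph B (E n)}
    (he : e ∈ (specialIntegralAffineGroupoid n).maximalAtlas B) (k : ℕ∞ω) :
    e ∈ IsManifold.maximalAtlas 𝓘(ℝ, E n) k B :=
  StructureGroupoid.maximalAtlas_mono (specialIntegralAffineGroupoid_le_contDiffGroupoid n k) he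

theorem mdifferentiableAt_of_mem_maximalAtlas {e : OpenPartialHomeomorph B (E n)}
    (he : e ∈ (specialIntegralAffineGroupoid n).maximalAtlas B) {x : B} (hx : x ∈ e.source) :
    MDifferentiableAt 𝓘(ℝ, E n) 𝓘(ℝ, E n) e x :=
  (contMDiffAt_of_mem_maximalAtlas (mem_smooth_maximalAtlas he 1) hx).mdifferentiableAt (by simp)

theorem mdifferentiableAt_symm_of_mem_maximalAtlas {e : OpenPartialHomeomorph B (E n)}
    (he : e ∈ (specialIntegralAffineGroupoid n).maximalAtlas B) {z : E n} (hz : z ∈ e.target) :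
    MDifferentiableAt 𝓘(ℝ, E n) 𝓘(ℝ, E n) e.symm z :=
  (contMDiffAt_symm_of_mem_maximalAtlas (mem_smooth_maximalAtlas he 1) hz).mdifferentiableAt
    (by simp)

theorem chartAt_mem_maximalAtlas [HasGroupoid B (specialIntegralAffineGroupoid n)] (x : B) :
    chartAt (E n) x ∈ (specialIntegralAffineGroupoid n).maximalAtlas B :=
  (specialIntegralAffineGroupoid n).subset_maximalAtlas (chart_mem_atlas _ x)

variable [HasGroupoid B (specialIntegralAffineGroupoid n)]

namespace Development

variable (δ : Development B n)

/-- The linear part of the developing map at `a` in the preferred chart. -/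
def linPart (a : E n) : Matrix.SpecialLinearGroup (Fin n) ℤ :=
  (δ.integral _ (chartAt_mem_maximalAtlas (δ.p a)) a (mem_chart_source _ _)).choose

theorem linPart_spec (a : E n) : ∃ b : E n, ∀ᶠ z in 𝓝 a,
    chartAt (E n) (δ.p a) (δ.p z) = slEquiv (δ.linPart a) z + b :=
  (δ.integral _ (chartAt_mem_maximalAtlas (δ.p a)) a (mem_chart_source _ _)).choose_spec

/-- The differential of the developing map. -/
def D (a : E n) : E n ≃L[ℝ] Tan n (δ.p a) := slEquiv (δ.linPart a)

/-- Tangent spaces are identified with ℝⁿ by the preferred chart at the point, and `D a` is the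
linear part of `p` in exactly this chart. So this is the ordinary chain rule. -/
theorem hasFDerivAt_comp {F : Type*} [NormedAddCommGroup F] [NormedSpace ℝ F] {f : B → F}
    {a : E n} (hf : MDifferentiableAt 𝓘(ℝ, E n) 𝓘(ℝ, F) f (δ.p a)) :
    HasFDerivAt (f ∘ δ.p) ((show Tan n (δ.p a) →L[ℝ] F from
      mfderiv 𝓘(ℝ, E n) 𝓘(ℝ, F) f (δ.p a)).comp (δ.D a : E n →L[ℝ] Tan n (δ.p a))) a := by
  have h1 : HasFDerivWithinAt (𝕜 := ℝ) (f ∘ (chartAt (E n) (δ.p a)).symm)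
      (show E n →L[ℝ] F from mfderiv 𝓘(ℝ, E n) 𝓘(ℝ, F) f (δ.p a)) (range 𝓘(ℝ, E n))
      (chartAt (E n) (δ.p a) (δ.p a)) := hf.hasMFDerivAt.2
  rw [modelWithCornersSelf_coe, range_id, hasFDerivWithinAt_univ] at h1
  obtain ⟨b, hb⟩ := δ.linPart_spec a
  have h2 : HasFDerivAt (fun z => chartAt (E n) (δ.p a) (δ.p z))
      (slEquiv (δ.linPart a) : E n →L[ℝ] E n) a :=
    ((slEquiv (δ.linPart a)).hasFDerivAt.add_const b).congr_of_eventuallyEq hb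
  have h3 := HasFDerivAt.comp a h1 h2
  refine h3.congr_of_eventuallyEq ?_
  filter_upwards [δ.cov.continuous.continuousAt.eventually
    ((chartAt (E n) (δ.p a)).open_source.mem_nhds (mem_chart_source _ _))] with z hz
  simp [(chartAt (E n) (δ.p a)).left_inv hz]

theorem chartDiff_comp_D {e : OpenPartialHomeomorph B (E n)}
    (he : e ∈ (specialIntegralAffineGroupoid n).maximalAtlas B) {a : E n}
    (ha : δ.p a ∈ e.source) {A : Matrix.SpecialLinearGroup (Fin n) ℤ} {b : E n}
    (hA : ∀ᶠ z in 𝓝 a, e (δ.p z) = slEquiv A z + b) (u : E n) :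
    chartDiff n e (δ.p a) (δ.D a u) = slEquiv A u := by
  have h1 := δ.hasFDerivAt_comp (mdifferentiableAt_of_mem_maximalAtlas he ha)
  have h2 : HasFDerivAt (e ∘ δ.p) (slEquiv A : E n →L[ℝ] E n) a :=
    ((slEquiv A).hasFDerivAt.add_const b).congr_of_eventuallyEq hA
  exact congrArg (fun L : E n →L[ℝ] E n => L u) (h1.unique h2)

/-- In every chart the differential of `p` lies in SL(n, ℤ), which preserves ℤⁿ together with its
inverse; so Λ pulls back to the constant lattice ℤⁿ. -/
theorem mem_lattice_iff (a : E n) (v : Tan n (δ.p a)) :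
    v ∈ lattice n (δ.p a) ↔ ∀ j, ∃ k : ℤ, (δ.D a).symm v j = k := by
  constructor
  · intro h
    have he := chartAt_mem_maximalAtlas (n := n) (δ.p a)
    obtain ⟨A, b, hA⟩ := δ.integral _ he a (mem_chart_source _ _)
    have h1 := h _ he (mem_chart_source _ _)
    have h2 := δ.chartDiff_comp_D he (mem_chart_source _ _) hA ((δ.D a).symm v)
    rw [ContinuousLinearEquiv.apply_symm_apply] at h2
    rw [h2] at h1
    intro j
    have := slEquiv_int A⁻¹ h1 j
    rwa [← slEquiv_symm, ContinuousLinearEquiv.symm_apply_apply] at this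
  · intro h e he hx
    obtain ⟨A, b, hA⟩ := δ.integral e he a hx
    have h2 := δ.chartDiff_comp_D he hx hA ((δ.D a).symm v)
    rw [ContinuousLinearEquiv.apply_symm_apply] at h2
    rw [h2]
    exact slEquiv_int A h

/-- The covector at `p a` whose pullback is `η`. -/
def push (a : E n) (η : Dual n) : Cot n (δ.p a) := η.comp ((δ.D a).symm : Tan n (δ.p a) →L[ℝ] E n)

/-- The pullback of a covector at `p a`. -/
def pull (a : E n) (y : Cot n (δ.p a)) : Dual n := y.comp (δ.D a : E n →L[ℝ] Tan n (δ.p a))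

@[simp] theorem pull_push (a : E n) (η : Dual n) : δ.pull a (δ.push a η) = η := by
  ext v; simp [pull, push]

@[simp] theorem push_pull (a : E n) (y : Cot n (δ.p a)) : δ.push a (δ.pull a y) = y := by
  ext v; simp [pull, push]

theorem push_apply_D (a : E n) (η : Dual n) (v : E n) : δ.push a η (δ.D a v) = η v := by
  simp [push]

theorem push_add (a : E n) (η θ : Dual n) : δ.push a (η + θ) = δ.push a η + δ.push a θ := rfl

theorem push_zero (a : E n) : δ.push a 0 = 0 := rfl

theorem push_injective (a : E n) : Function.Injective (δ.push a) :=
  Function.LeftInverse.injective (δ.pull_push a)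

theorem mem_dualLattice_iff (a : E n) (y : Cot n (δ.p a)) :
    y ∈ dualLattice n (δ.p a) ↔ ∃ m, y = δ.push a (intCov m) := by
  constructor
  · intro h
    obtain ⟨m, hm⟩ := exists_intCov (δ.pull a y) (fun v hv => h (δ.D a v)
      ((δ.mem_lattice_iff a _).2 (by simpa using hv)))
    exact ⟨m, by rw [← hm, push_pull]⟩
  · rintro ⟨m, rfl⟩ v hv
    exact intCov_int m ((δ.mem_lattice_iff a v).1 hv)

/-- The integral covectors parametrize the dual lattice. -/
def dualLatticeEquiv (a : E n) : (Fin n → ℤ) ≃ dualLattice n (δ.p a) :=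
  Equiv.ofBijective (fun m => ⟨δ.push a (intCov m), (δ.mem_dualLattice_iff a _).2 ⟨m, rfl⟩⟩)
    ⟨fun m k h => intCov_injective (δ.push_injective a (congrArg Subtype.val h)),
      fun y => by
        obtain ⟨m, hm⟩ := (δ.mem_dualLattice_iff a _).1 y.2
        exact ⟨m, Subtype.ext hm.symm⟩⟩

theorem dualLatticeEquiv_apply (a : E n) (m : Fin n → ℤ) :
    ((δ.dualLatticeEquiv a m : dualLattice n (δ.p a)) : Cot n (δ.p a)) = δ.push a (intCov m) := rfl

end Development

end Base

theorem eventually_const_of_hasFDerivAt_zero {V F : Type*} [NormedAddCommGroup V]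
    [NormedSpace ℝ V] [NormedAddCommGroup F] [NormedSpace ℝ F] {f : V → F} {a : V}
    (h : ∀ᶠ z in 𝓝 a, HasFDerivAt f (0 : V →L[ℝ] F) z) : ∀ᶠ z in 𝓝 a, f z = f a := by
  obtain ⟨r, hr, hb⟩ := Metric.eventually_nhds_iff_ball.1 h
  filter_upwards [Metric.ball_mem_nhds a hr] with z hz
  refine Metric.isOpen_ball.eqOn_of_fderiv_eq (𝕜 := ℝ) (f := f) (g := fun _ => f a)
    (convex_ball a r).isPreconnected
    (fun y hy => (hb y hy).differentiableAt.differentiableWithinAt)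
    (differentiableOn_const _) (fun y hy => ?_) (Metric.mem_ball_self hr) rfl hz
  rw [(hb y hy).fderiv, fderiv_fun_const]
  rfl

/-! ### The global convex potential on the universal cover -/

section Potential

variable {n : ℕ} {B : Type*} [TopologicalSpace B] [ChartedSpace (E n) B]
  [HasGroupoid B (specialIntegralAffineGroupoid n)] {g : RiemMetric n B} {ι : Type*}

namespace IntegralPotentials

variable (Φ : IntegralPotentials g ι) (δ : Development B n)

theorem exists_affine {i : ι} {a : E n} (ha : δ.p a ∈ (Φ.chart i).source) :
    ∃ (A : Matrix.SpecialLinearGroup (Fin n) ℤ) (b : E n), ∀ᶠ z in 𝓝 a,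
      δ.p z ∈ (Φ.chart i).source ∧ Φ.chart i (δ.p z) = slEquiv A z + b := by
  obtain ⟨A, b, hA⟩ := δ.integral _ (Φ.chart_mem i) a ha
  exact ⟨A, b, (δ.cov.continuous.continuousAt.eventually
    ((Φ.chart i).open_source.mem_nhds ha)).and hA⟩

theorem contDiffOn_local (i : ι) :
    ContDiffOn ℝ ∞ (Φ.φ i ∘ (Φ.chart i).symm) (Φ.chart i).target := by
  rw [← contMDiffOn_iff_contDiffOn]
  exact (Φ.smooth i).comp
    (contMDiffOn_symm_of_mem_maximalAtlas (mem_smooth_maximalAtlas (Φ.chart_mem i) ∞))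
    fun z hz => (Φ.chart i).map_target hz

theorem contDiffAt_local (i : ι) {z : E n} (hz : z ∈ (Φ.chart i).target) :
    ContDiffAt ℝ ∞ (Φ.φ i ∘ (Φ.chart i).symm) z :=
  (Φ.contDiffOn_local i).contDiffAt ((Φ.chart i).open_target.mem_nhds hz)

variable {δ}

theorem eventuallyEq_local {i : ι} {a : E n} {A : Matrix.SpecialLinearGroup (Fin n) ℤ} {b : E n}
    (hA : ∀ᶠ z in 𝓝 a, δ.p z ∈ (Φ.chart i).source ∧ Φ.chart i (δ.p z) = slEquiv A z + b) :
    (Φ.φ i ∘ δ.p) =ᶠ[𝓝 a] fun z => (Φ.φ i ∘ (Φ.chart i).symm) (slEquiv A z + b) := by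
  filter_upwards [hA] with z hz
  simp only [Function.comp_apply]
  rw [← hz.2, (Φ.chart i).left_inv hz.1]

theorem contDiffAt_pot {i : ι} {a : E n} (ha : δ.p a ∈ (Φ.chart i).source) :
    ContDiffAt ℝ ∞ (Φ.φ i ∘ δ.p) a := by
  obtain ⟨A, b, hA⟩ := Φ.exists_affine δ ha
  refine ContDiffAt.congr_of_eventuallyEq ?_ (Φ.eventuallyEq_local hA)
  have h1 : slEquiv A a + b ∈ (Φ.chart i).target := by
    rw [← hA.self_of_nhds.2]
    exact (Φ.chart i).map_source ha
  exact ContDiffAt.comp a (f := fun z => slEquiv A z + b) (Φ.contDiffAt_local i h1)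
    ((slEquiv A).contDiff.add contDiff_const).contDiffAt

theorem fderiv_pot {i : ι} {a : E n} {A : Matrix.SpecialLinearGroup (Fin n) ℤ} {b : E n}
    (hA : ∀ᶠ z in 𝓝 a, δ.p z ∈ (Φ.chart i).source ∧ Φ.chart i (δ.p z) = slEquiv A z + b) :
    fderiv ℝ (Φ.φ i ∘ δ.p) =ᶠ[𝓝 a] fun z =>
      (fderiv ℝ (Φ.φ i ∘ (Φ.chart i).symm) (slEquiv A z + b)).comp (slEquiv A : E n →L[ℝ] E n) := by
  filter_upwards [hA.eventually_nhds] with z hz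
  have h1 : slEquiv A z + b ∈ (Φ.chart i).target := by
    rw [← hz.self_of_nhds.2]
    exact (Φ.chart i).map_source hz.self_of_nhds.1
  have h2 := ((Φ.contDiffAt_local i h1).differentiableAt (by simp)).hasFDerivAt
  have h3 : HasFDerivAt (fun z => slEquiv A z + b) (slEquiv A : E n →L[ℝ] E n) z :=
    (slEquiv A).hasFDerivAt.add_const b
  exact ((HasFDerivAt.comp z h2 h3).congr_of_eventuallyEq (Φ.eventuallyEq_local hz)).fderiv

/-- The right side does not involve `i`; this is what makes the second derivatives of the local
potentials glue on ℝⁿ. -/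
theorem hessian_pot {i : ι} {a : E n} (ha : δ.p a ∈ (Φ.chart i).source) (u w : E n) :
    fderiv ℝ (fderiv ℝ (Φ.φ i ∘ δ.p)) a u w = g.inner (δ.p a) (δ.D a u) (δ.D a w) := by
  obtain ⟨A, b, hA⟩ := Φ.exists_affine δ ha
  have h1 : slEquiv A a + b ∈ (Φ.chart i).target := by
    rw [← hA.self_of_nhds.2]
    exact (Φ.chart i).map_source ha
  have h2 : HasFDerivAt (fderiv ℝ (Φ.φ i ∘ (Φ.chart i).symm)) _ (slEquiv A a + b) :=
    (((Φ.contDiffAt_local i h1).fderiv_right (m := 1) (by norm_cast)).differentiableAt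
      (by simp)).hasFDerivAt
  have h3 : HasFDerivAt (fun z => slEquiv A z + b) (slEquiv A : E n →L[ℝ] E n) a :=
    (slEquiv A).hasFDerivAt.add_const b
  have h4 := (HasFDerivAt.comp a h2 h3).clm_comp
    (hasFDerivAt_const (slEquiv A : E n →L[ℝ] E n) a)
  rw [(Φ.fderiv_pot hA).fderiv_eq]
  erw [h4.fderiv]
  rw [Φ.hessian i _ ha, δ.chartDiff_comp_D (Φ.chart_mem i) ha (hA.mono fun _ h => h.2),
    δ.chartDiff_comp_D (Φ.chart_mem i) ha (hA.mono fun _ h => h.2), hA.self_of_nhds.2]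
  simp

theorem overlap_pot {i j : ι} {a : E n} (hi : δ.p a ∈ (Φ.chart i).source)
    (hj : δ.p a ∈ (Φ.chart j).source) :
    ∃ m, fderiv ℝ (Φ.φ i ∘ δ.p) a = fderiv ℝ (Φ.φ j ∘ δ.p) a + intCov m := by
  obtain ⟨A, b, hA⟩ := Φ.exists_affine δ hj
  obtain ⟨m, c, hm⟩ := Φ.integral i j
  refine ⟨covAct m A, ?_⟩
  have h1 : HasFDerivAt (fun z => (Φ.φ j ∘ δ.p) z + (intCov (covAct m A) z + (intCov m b + c)))
      (fderiv ℝ (Φ.φ j ∘ δ.p) a + intCov (covAct m A)) a :=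
    ((Φ.contDiffAt_pot hj).differentiableAt (by simp)).hasFDerivAt.add
      ((intCov (covAct m A)).hasFDerivAt.add_const _)
  refine (h1.congr_of_eventuallyEq ?_).fderiv
  filter_upwards [hA, δ.cov.continuous.continuousAt.eventually
    ((Φ.chart i).open_source.mem_nhds hi)] with z hz hzi
  have := hm (δ.p z) ⟨hzi, hz.1⟩
  rw [← intCov_apply, hz.2, map_add, intCov_slEquiv] at this
  simp only [Function.comp_apply]
  linarith

end IntegralPotentials

/-- A global potential on the universal cover, together with its differential. -/
structure GlobalPotential (Φ : IntegralPotentials g ι) (δ : Development B n) where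
  /-- the potential -/
  f : E n → ℝ
  /-- the differential of the potential -/
  Y : E n → Dual n
  hasFDerivAt : ∀ a, HasFDerivAt f (Y a) a
  contDiff_Y : ContDiff ℝ ∞ Y
  hessian : ∀ a u w, fderiv ℝ Y a u w = g.inner (δ.p a) (δ.D a u) (δ.D a w)
  eq_local : ∀ a i, δ.p a ∈ (Φ.chart i).source → ∃ (m : Fin n → ℤ) (c : ℝ), ∀ᶠ z in 𝓝 a,
    Φ.φ i (δ.p z) = f z - intCov m z + c

/-- The glued Hessian `G` is closed as a `Dual`-valued form because third derivatives commute, and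
its primitive `Y` is closed because the metric is symmetric. The Poincaré lemma on ℝⁿ applies twice.
-/
theorem exists_globalPotential (Φ : IntegralPotentials g ι) (δ : Development B n) :
    Nonempty (GlobalPotential Φ δ) := by
  choose i hi using fun a => Φ.cover (δ.p a)
  let G : E n → E n →L[ℝ] Dual n := fun a => fderiv ℝ (fderiv ℝ (Φ.φ (i a) ∘ δ.p)) a
  have hGapp : ∀ a u w, G a u w = g.inner (δ.p a) (δ.D a u) (δ.D a w) := fun a u w =>
    Φ.hessian_pot (hi a) u w
  have hG : ∀ j a, δ.p a ∈ (Φ.chart j).source →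
      G =ᶠ[𝓝 a] fderiv ℝ (fderiv ℝ (Φ.φ j ∘ δ.p)) := by
    intro j a ha
    filter_upwards [δ.cov.continuous.continuousAt.eventually
      ((Φ.chart j).open_source.mem_nhds ha)] with z hz
    ext u w
    rw [hGapp, Φ.hessian_pot hz]
  have hcd : ∀ j a, δ.p a ∈ (Φ.chart j).source →
      ContDiffAt ℝ ∞ (fderiv ℝ (Φ.φ j ∘ δ.p)) a := fun j a ha =>
    (Φ.contDiffAt_pot ha).fderiv_right (by norm_cast)
  have hGs : ContDiff ℝ ∞ G := contDiff_iff_contDiffAt.2 fun a =>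
    ((hcd _ a (hi a)).fderiv_right (by norm_cast)).congr_of_eventuallyEq (hG _ a (hi a))
  obtain ⟨Y₁, hY₁⟩ : ∃ Y₁ : E n → Dual n, ∀ a ∈ (univ : Set (E n)), HasFDerivAt Y₁ (G a) a :=
    Convex.exists_forall_hasFDerivAt_of_fderiv_symmetric convex_univ isOpen_univ
      (hGs.differentiable (by simp)).differentiableOn (by
      intro a _ u w
      rw [(hG _ a (hi a)).fderiv_eq]
      exact (hcd _ a (hi a)).isSymmSndFDerivAt (by simp; norm_cast) u w)
  -- This constant makes `Y` agree with the differential of one local potential at the origin, the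
  -- starting point for integrality everywhere.
  let η₀ : Dual n := fderiv ℝ (Φ.φ (i 0) ∘ δ.p) 0 - Y₁ 0
  let Y : E n → Dual n := fun a => Y₁ a + η₀
  have hY : ∀ a, HasFDerivAt Y (G a) a := fun a => (hY₁ a (mem_univ a)).add_const η₀
  have hYf : fderiv ℝ Y = G := funext fun a => (hY a).fderiv
  have hYs : ContDiff ℝ ∞ Y := contDiff_infty_iff_fderiv.2
    ⟨fun a => (hY a).differentiableAt, hYf ▸ hGs⟩
  obtain ⟨f, hf⟩ : ∃ f : E n → ℝ, ∀ a ∈ (univ : Set (E n)), HasFDerivAt f (Y a) a :=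
    Convex.exists_forall_hasFDerivAt_of_fderiv_symmetric convex_univ isOpen_univ
      (hYs.differentiable (by simp)).differentiableOn (by
      intro a _ u w
      rw [hYf, hGapp, hGapp, g.symm])
  have hconst : ∀ j a, δ.p a ∈ (Φ.chart j).source → ∀ᶠ z in 𝓝 a,
      Y z - fderiv ℝ (Φ.φ j ∘ δ.p) z = Y a - fderiv ℝ (Φ.φ j ∘ δ.p) a := by
    intro j a ha
    refine eventually_const_of_hasFDerivAt_zero
      (f := fun z => Y z - fderiv ℝ (Φ.φ j ∘ δ.p) z) ?_
    filter_upwards [δ.cov.continuous.continuousAt.eventually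
      ((Φ.chart j).open_source.mem_nhds ha), hG j a ha] with z hz hGz
    have := (hY z).sub ((hcd j z hz).differentiableAt (by simp)).hasFDerivAt
    rwa [hGz, sub_self] at this
  -- `Y - dφ_j` is locally constant, and on overlaps the `dφ_j` differ by integral covectors. So
  -- integrality of the difference is a clopen condition.
  let S : Set (E n) := {a | ∀ j, δ.p a ∈ (Φ.chart j).source →
    ∃ m, Y a - fderiv ℝ (Φ.φ j ∘ δ.p) a = intCov m}
  have hS1 : ∀ a j, δ.p a ∈ (Φ.chart j).source →
      (∃ m, Y a - fderiv ℝ (Φ.φ j ∘ δ.p) a = intCov m) → a ∈ S := by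
    rintro a j hj ⟨m, hm⟩ k hk
    obtain ⟨m', hm'⟩ := Φ.overlap_pot hj hk
    exact ⟨m + m', by rw [intCov_add, ← hm, hm']; abel⟩
  have hS2 : ∀ a, ∀ᶠ z in 𝓝 a, (z ∈ S ↔ a ∈ S) := by
    intro a
    filter_upwards [hconst _ a (hi a), δ.cov.continuous.continuousAt.eventually
      ((Φ.chart (i a)).open_source.mem_nhds (hi a))] with z h1 h2
    constructor
    · intro hz
      exact hS1 a _ (hi a) (h1 ▸ hz _ h2)
    · intro ha
      exact hS1 z _ h2 (h1 ▸ ha _ (hi a))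
  have hSu : S = univ := by
    refine IsClopen.eq_univ ⟨?_, ?_⟩ ⟨0, hS1 0 _ (hi 0) ⟨0, ?_⟩⟩
    · rw [← isOpen_compl_iff, isOpen_iff_eventually]
      intro a ha
      filter_upwards [hS2 a] with z hz h
      exact ha (hz.1 h)
    · rw [isOpen_iff_eventually]
      intro a ha
      filter_upwards [hS2 a] with z hz
      exact hz.2 ha
    · simp [Y, η₀]
  refine ⟨⟨f, Y, fun a => hf a (mem_univ a), hYs, fun a u w => by rw [hYf, hGapp], ?_⟩⟩
  intro a j ha
  obtain ⟨m, hm⟩ := (hSu ▸ mem_univ a : a ∈ S) j ha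
  refine ⟨m, Φ.φ j (δ.p a) - f a + intCov m a, ?_⟩
  have : ∀ᶠ z in 𝓝 a, Φ.φ j (δ.p z) - f z + intCov m z = Φ.φ j (δ.p a) - f a + intCov m a := by
    refine eventually_const_of_hasFDerivAt_zero
      (f := fun z => Φ.φ j (δ.p z) - f z + intCov m z) ?_
    filter_upwards [δ.cov.continuous.continuousAt.eventually
      ((Φ.chart j).open_source.mem_nhds ha), hconst j a ha] with z hz hcz
    have := ((((Φ.contDiffAt_pot hz).differentiableAt (by simp)).hasFDerivAt).sub
      (hf z (mem_univ z))).add (intCov m).hasFDerivAt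
    have h0 : fderiv ℝ (Φ.φ j ∘ δ.p) z - Y z + intCov m = 0 := by
      rw [← hm, ← hcz]
      abel
    rwa [h0] at this
  filter_upwards [this] with z hz
  linarith

end Potential

/-! ### The topology of the cotangent bundle through the developing map -/

section Cotangent

variable {n : ℕ} {B : Type*} [TopologicalSpace B] [ChartedSpace (E n) B]
  [HasGroupoid B (specialIntegralAffineGroupoid n)]

namespace Development

variable (δ : Development B n)

/-- The map `T^*ℝⁿ → T^*B` induced by the developing map. -/
def Q (a : E n) (η : Dual n) : CotangentBundle n B := ⟨δ.p a, δ.push a η⟩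

theorem Q_injective (a : E n) : Function.Injective (δ.Q a) := fun _ _ h =>
  δ.push_injective a (eq_of_heq (TotalSpace.mk.inj h).2)

theorem push_eq_chartDiff {e : OpenPartialHomeomorph B (E n)}
    (he : e ∈ (specialIntegralAffineGroupoid n).maximalAtlas B) {a : E n}
    (ha : δ.p a ∈ e.source) {A : Matrix.SpecialLinearGroup (Fin n) ℤ} {b : E n}
    (hA : ∀ᶠ z in 𝓝 a, e (δ.p z) = slEquiv A z + b) (ζ : Dual n) :
    δ.push a (ζ.comp (slEquiv A : E n →L[ℝ] E n)) = ζ.comp (chartDiff n e (δ.p a)) := by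
  ext v
  obtain ⟨u, rfl⟩ := (δ.D a).surjective v
  rw [push_apply_D]
  simp only [ContinuousLinearMap.comp_apply]
  rw [δ.chartDiff_comp_D he ha hA]
  rfl

/-- Lifts of a point of `T^*B` along `Q` correspond under a change of affine coordinates. -/
theorem exists_transition {a c : E n} (h : δ.p a = δ.p c) :
    ∃ (A : Matrix.SpecialLinearGroup (Fin n) ℤ) (b : E n) (C : Matrix.SpecialLinearGroup (Fin n) ℤ)
      (d : E n), (∀ᶠ z in 𝓝 a, chartAt (E n) (δ.p a) (δ.p z) = slEquiv A z + b) ∧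
      (∀ᶠ z in 𝓝 c, chartAt (E n) (δ.p a) (δ.p z) = slEquiv C z + d) ∧
      ∀ᶠ z : E n × E n in 𝓝 (a, c), δ.p z.1 = δ.p z.2 → ∀ ζ : Dual n,
        δ.Q z.1 (ζ.comp (slEquiv A : E n →L[ℝ] E n))
          = δ.Q z.2 (ζ.comp (slEquiv C : E n →L[ℝ] E n)) := by
  set e := chartAt (E n) (δ.p a) with he
  have hmem : e ∈ (specialIntegralAffineGroupoid n).maximalAtlas B := chartAt_mem_maximalAtlas _
  have ha : δ.p a ∈ e.source := mem_chart_source _ _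
  obtain ⟨A, b, hA⟩ := δ.integral e hmem a ha
  obtain ⟨C, d, hC⟩ := δ.integral e hmem c (h ▸ ha)
  refine ⟨A, b, C, d, hA, hC, ?_⟩
  rw [nhds_prod_eq]
  filter_upwards [(hA.eventually_nhds.and
    (δ.cov.continuous.continuousAt.eventually (e.open_source.mem_nhds ha))).prod_mk
      hC.eventually_nhds]
  rintro ⟨z, w⟩ ⟨⟨hz, hz'⟩, hw⟩ hzw ζ
  unfold Q
  rw [δ.push_eq_chartDiff hmem hz' hz, δ.push_eq_chartDiff hmem (hzw ▸ hz') hw]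
  exact congrArg (fun x : B => (⟨x, ζ.comp (chartDiff n e x)⟩ : CotangentBundle n B)) hzw

/-- The trivialization at `p a₀` uses the differential of one fixed chart, which near `a₀` pulls
back to a constant matrix. So `Q` is the constant linear map `η ↦ η ∘ A⁻¹` in the fibre coordinates;
continuity and openness of `Q` both rest on this. -/
theorem trivialization_Q (a₀ : E n) : ∃ A : Matrix.SpecialLinearGroup (Fin n) ℤ,
    ∀ᶠ a in 𝓝 a₀, ∀ η : Dual n,
      (trivializationAt (E n →L[ℝ] ℝ) (fun x : B => Cot n x) (δ.p a₀) (δ.Q a η)).2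
        = η.comp ((slEquiv A).symm : E n →L[ℝ] E n) := by
  have hmem := chartAt_mem_maximalAtlas (n := n) (δ.p a₀)
  obtain ⟨A, b, hA⟩ := δ.integral _ hmem a₀ (mem_chart_source _ _)
  refine ⟨A, ?_⟩
  filter_upwards [hA.eventually_nhds, δ.cov.continuous.continuousAt.eventually
    ((chartAt (E n) (δ.p a₀)).open_source.mem_nhds (mem_chart_source _ _))] with a h1 h2 η
  have hb : δ.p a ∈ (trivializationAt (E n) (TangentSpace 𝓘(ℝ, E n) (M := B)) (δ.p a₀)).baseSet := by
    rw [TangentBundle.trivializationAt_baseSet]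
    exact h2
  have h3 : (trivializationAt (E n) (TangentSpace 𝓘(ℝ, E n) (M := B)) (δ.p a₀)).continuousLinearMapAt
      ℝ (δ.p a) = chartDiff n (chartAt (E n) (δ.p a₀)) (δ.p a) := by
    rw [TangentBundle.continuousLinearMapAt_trivializationAt h2]
    rfl
  rw [hom_trivializationAt_apply]
  ext v
  simp only [ContinuousLinearMap.inCoordinates, ContinuousLinearMap.comp_apply]
  refine (DFunLike.congr_fun
    (Bundle.Trivial.continuousLinearMapAt_trivialization ℝ B ℝ (δ.p a)) _).trans ?_
  change (δ.push a η) ((trivializationAt (E n) (TangentSpace 𝓘(ℝ, E n) (M := B)) (δ.p a₀)).symmL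
    ℝ (δ.p a) v) = _
  have h4 := Bundle.Trivialization.continuousLinearMapAt_symmL (R := ℝ)
    (trivializationAt (E n) (TangentSpace 𝓘(ℝ, E n) (M := B)) (δ.p a₀)) hb v
  obtain ⟨u, hu⟩ := (δ.D a).surjective ((trivializationAt (E n)
    (TangentSpace 𝓘(ℝ, E n) (M := B)) (δ.p a₀)).symmL ℝ (δ.p a) v)
  rw [← hu] at h4 ⊢
  rw [h3, δ.chartDiff_comp_D hmem h2 h1] at h4
  rw [push_apply_D]
  simp [← h4]

theorem continuous_Q : Continuous fun z : E n × Dual n => δ.Q z.1 z.2 := by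
  rw [continuous_iff_continuousAt]
  rintro ⟨a, η⟩
  rw [FiberBundle.continuousAt_totalSpace]
  refine ⟨(δ.cov.continuous.comp continuous_fst).continuousAt, ?_⟩
  obtain ⟨A, hA⟩ := δ.trivialization_Q a
  have h : ContinuousAt (fun z : E n × Dual n => z.2.comp ((slEquiv A).symm : E n →L[ℝ] E n))
      (a, η) := by fun_prop
  refine h.congr ?_
  filter_upwards [continuous_fst.continuousAt.eventually hA] with z hz
  exact (hz z.2).symm

theorem exists_Q_of_proj {q : CotangentBundle n B} {a : E n} (h : q.1 = δ.p a) :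
    ∃ η, q = δ.Q a η := by
  obtain ⟨x, y⟩ := q
  simp only at h
  subst h
  exact ⟨δ.pull a y, by simp [Q]⟩

theorem continuousAt_trivialization (q : CotangentBundle n B) :
    ContinuousAt (fun q' => (trivializationAt (E n →L[ℝ] ℝ) (fun x : B => Cot n x) q.1 q').2) q :=
  ((FiberBundle.continuousAt_totalSpace (E n →L[ℝ] ℝ) (E := fun x : B => Cot n x)
      (fun q : CotangentBundle n B => q)).1 continuousAt_id).2

theorem isOpenMap_Q : IsOpenMap fun z : E n × Dual n => δ.Q z.1 z.2 := by
  rw [isOpenMap_iff_nhds_le]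
  rintro ⟨a, η⟩
  obtain ⟨P, haP, hP⟩ := δ.cov.isLocalHomeomorph a
  obtain ⟨A, hA⟩ := δ.trivialization_Q a
  have hpP : δ.p a = P a := congrFun hP a
  let t := trivializationAt (E n →L[ℝ] ℝ) (fun x : B => Cot n x) (δ.p a)
  -- A local inverse of `Q` near the point: a local section of the covering on the base, and
  -- multiplication by `A` in the fibre coordinates.
  let R : CotangentBundle n B → E n × Dual n := fun q =>
    (P.symm q.1, (t q).2.comp (slEquiv A : E n →L[ℝ] E n))
  have hPs : ContinuousAt P.symm (δ.p a) := by
    rw [hpP]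
    exact P.continuousAt_symm (P.map_source haP)
  have hπ : ContinuousAt (fun q : CotangentBundle n B => q.1) (δ.Q a η) :=
    (FiberBundle.continuous_proj (E n →L[ℝ] ℝ) (fun x : B => Cot n x)).continuousAt
  have h1 : ContinuousAt (fun q : CotangentBundle n B => P.symm q.1) (δ.Q a η) :=
    ContinuousAt.comp (f := fun q : CotangentBundle n B => q.1) (g := P.symm) hPs hπ
  have h2 : ContinuousAt (fun q => (t q).2) (δ.Q a η) :=
    continuousAt_trivialization (δ.Q a η)
  have hR : ContinuousAt R (δ.Q a η) := h1.prodMk (by fun_prop)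
  have hPa : P.symm (δ.p a) = a := by rw [hpP, P.left_inv haP]
  have hRa : R (δ.Q a η) = (a, η) := by
    refine Prod.ext hPa ?_
    change (t (δ.Q a η)).2.comp (slEquiv A : E n →L[ℝ] E n) = η
    rw [hA.self_of_nhds η]
    ext v
    simp
  have hQR : ∀ᶠ q in 𝓝 (δ.Q a η), δ.Q (R q).1 (R q).2 = q := by
    have e1 : ∀ᶠ q : CotangentBundle n B in 𝓝 (δ.Q a η), q.1 ∈ P.target :=
      hπ.eventually (P.open_target.mem_nhds (by
        change δ.p a ∈ P.target
        rw [hpP]; exact P.map_source haP))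
    have e2 : ∀ᶠ q : CotangentBundle n B in 𝓝 (δ.Q a η), ∀ η : Dual n,
        (t (δ.Q (P.symm q.1) η)).2 = η.comp ((slEquiv A).symm : E n →L[ℝ] E n) :=
      (h1.tendsto.mono_right (congrArg 𝓝 hPa).le).eventually hA
    filter_upwards [e1, e2] with q hq1 hq2
    have hq : q.1 = δ.p (P.symm q.1) := by rw [hP, P.right_inv hq1]
    obtain ⟨θ, hθ⟩ := δ.exists_Q_of_proj hq
    have h3 : (t q).2 = θ.comp ((slEquiv A).symm : E n →L[ℝ] E n) := by
      rw [← hq2 θ, ← hθ]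
    change δ.Q (P.symm q.1) ((t q).2.comp (slEquiv A : E n →L[ℝ] E n)) = q
    rw [h3]
    conv_rhs => rw [hθ]
    congr 1
    ext v
    simp
  intro S hS
  have := hR.eventually (p := fun z => δ.Q z.1 z.2 ∈ S) (by rw [hRa]; exact hS)
  filter_upwards [this, hQR] with q h3 h4
  rwa [h4] at h3

end Development

end Cotangent

/-! ### Sheets of the path space over the universal cover -/

section Sheets

variable {n : ℕ} {B : Type*} [TopologicalSpace B] [ChartedSpace (E n) B]

theorem DualX.mk_eq_mk_iff (x : B) (y z : Cot n x) :
    DualX.mk x y = DualX.mk x z ↔ y - z ∈ dualLattice n x := by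
  rw [← neg_mem_iff, neg_sub, sub_eq_neg_add, ← QuotientAddGroup.eq]
  exact ⟨fun h => eq_of_heq (Sigma.mk.inj h).2, fun h => congrArg (Sigma.mk x) h⟩

variable [HasGroupoid B (specialIntegralAffineGroupoid n)] {g : RiemMetric n B} {ι : Type*}
  {Φ : IntegralPotentials g ι} {δ : Development B n}

theorem IntegralPotentials.mk_mem_lagrangian_iff (x : B) (y : Cot n x) :
    DualX.mk x y ∈ Φ.lagrangian ↔
      ∃ i, x ∈ (Φ.chart i).source ∧ y - Φ.dpot i x ∈ dualLattice n x := by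
  constructor
  · rintro ⟨i, x', hx', h⟩
    obtain rfl : x = x' := congrArg Sigma.fst h
    exact ⟨i, hx', (DualX.mk_eq_mk_iff _ _ _).1 h⟩
  · rintro ⟨i, hx, h⟩
    exact ⟨i, x, hx, (DualX.mk_eq_mk_iff _ _ _).2 h⟩

namespace GlobalPotential

variable (σ : GlobalPotential Φ δ)

/-- The lift to `ℝⁿ` of the sheet of the path space with label `m`. -/
def S (m : Fin n → ℤ) (a : E n) : CotangentBundle n B := δ.Q a (σ.Y a + intCov m)

theorem S_injective (a : E n) : Function.Injective fun m => σ.S m a := fun _ _ h =>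
  intCov_injective (add_left_cancel (δ.Q_injective a h))

theorem continuous_S (m : Fin n → ℤ) : Continuous (σ.S m) :=
  δ.continuous_Q.comp (continuous_id.prodMk (σ.contDiff_Y.continuous.add continuous_const))

theorem dpot_eventually {a : E n} {i : ι} {m : Fin n → ℤ} {c : ℝ}
    (h : ∀ᶠ z in 𝓝 a, Φ.φ i (δ.p z) = σ.f z - intCov m z + c)
    (ha : δ.p a ∈ (Φ.chart i).source) :
    ∀ᶠ z in 𝓝 a, Φ.dpot i (δ.p z) = δ.push z (σ.Y z - intCov m) := by
  filter_upwards [h.eventually_nhds, δ.cov.continuous.continuousAt.eventually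
    ((Φ.chart i).open_source.mem_nhds ha)] with z hz hsrc
  have h1 : MDifferentiableAt 𝓘(ℝ, E n) 𝓘(ℝ, ℝ) (Φ.φ i) (δ.p z) :=
    (((Φ.smooth i).contMDiffAt ((Φ.chart i).open_source.mem_nhds hsrc))).mdifferentiableAt
      (by simp)
  have h2 := δ.hasFDerivAt_comp h1
  have h3 : HasFDerivAt (Φ.φ i ∘ δ.p) (σ.Y z - intCov m) z :=
    (((σ.hasFDerivAt z).sub (intCov m).hasFDerivAt).add_const c).congr_of_eventuallyEq hz
  rw [← h2.unique h3]
  exact (δ.push_pull z (Φ.dpot i (δ.p z))).symm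

/-- The description of charts, potentials and sheets near a point of the universal cover. -/
theorem exists_local (a : E n) (i : ι) (ha : δ.p a ∈ (Φ.chart i).source) :
    ∃ (A : Matrix.SpecialLinearGroup (Fin n) ℤ) (b : E n) (m : Fin n → ℤ) (c : ℝ),
      ∀ᶠ z in 𝓝 a, δ.p z ∈ (Φ.chart i).source ∧ Φ.chart i (δ.p z) = slEquiv A z + b ∧
        Φ.φ i (δ.p z) = σ.f z - intCov m z + c ∧
        Φ.dpot i (δ.p z) = δ.push z (σ.Y z - intCov m) ∧
        (∀ u : E n, chartDiff n (Φ.chart i) (δ.p z) (δ.D z u) = slEquiv A u) ∧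
        (∀ k, Φ.sheet i k (δ.p z) = δ.push z (σ.Y z + intCov (covAct k A - m))) ∧
        (∀ k (u : E n), Φ.dArea i k (slEquiv A z + b) (slEquiv A u)
          = (σ.Y z + intCov (covAct k A - m)) u) := by
  obtain ⟨A, b, hA⟩ := Φ.exists_affine δ ha
  obtain ⟨m, c, hm⟩ := σ.eq_local a i ha
  refine ⟨A, b, m, c, ?_⟩
  filter_upwards [hA.eventually_nhds, hm, σ.dpot_eventually hm ha, hm.eventually_nhds]
    with z h1 h2 h3 h2'
  have h4 : ∀ u : E n, chartDiff n (Φ.chart i) (δ.p z) (δ.D z u) = slEquiv A u := fun u =>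
    δ.chartDiff_comp_D (Φ.chart_mem i) h1.self_of_nhds.1 (h1.mono fun _ h => h.2) u
  refine ⟨h1.self_of_nhds.1, h1.self_of_nhds.2, h2, h3, h4, fun k => ?_, fun k u => ?_⟩
  swap
  · have h6 : HasFDerivAt (Φ.φ i ∘ δ.p) (σ.Y z - intCov m) z :=
      (((σ.hasFDerivAt z).sub (intCov m).hasFDerivAt).add_const c).congr_of_eventuallyEq h2'
    have h7 := (Φ.fderiv_pot h1).self_of_nhds
    rw [h6.fderiv] at h7
    have h8 := congrArg (fun L : Dual n => L u) h7
    simp only [ContinuousLinearMap.comp_apply, sub_apply] at h8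
    have h9 : Φ.dArea i k (slEquiv A z + b) = fderiv ℝ (Φ.φ i ∘ (Φ.chart i).symm) (slEquiv A z + b)
      + intCov k := rfl
    rw [h9, add_apply, add_apply, intCov_sub, sub_apply, ← intCov_slEquiv]
    have h10 : fderiv ℝ (Φ.φ i ∘ (Φ.chart i).symm) (slEquiv A z + b) (slEquiv A u)
      = σ.Y z u - intCov m u := h8.symm
    rw [h10]
    ring
  have h5 : ∑ j, (k j : ℝ) • (ContinuousLinearMap.proj (R := ℝ) j).comp
      (chartDiff n (Φ.chart i) (δ.p z)) = δ.push z (intCov (covAct k A)) := by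
    rw [← intCov_comp_slEquiv, δ.push_eq_chartDiff (Φ.chart_mem i) h1.self_of_nhds.1
      (h1.mono fun _ h => h.2)]
    ext v
    simp [intCov]
  unfold IntegralPotentials.sheet
  rw [h5, h3, ← δ.push_add]
  congr 1
  rw [intCov_sub]
  abel

/-- Each `dφ_i` is `Y` minus an integral covector, and Λ* pulls back to the integral covectors.
Hence the translates of `Y` by ℤⁿ are all the lifts of `L_g`, whichever chart is used. -/
theorem Q_mem_pathSpace_iff (a : E n) (η : Dual n) :
    δ.Q a η ∈ Φ.pathSpace ↔ ∃ m, η = σ.Y a + intCov m := by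
  have key : ∀ i, δ.p a ∈ (Φ.chart i).source →
      (δ.push a η - Φ.dpot i (δ.p a) ∈ dualLattice n (δ.p a) ↔ ∃ m, η = σ.Y a + intCov m) := by
    intro i hi
    obtain ⟨A, b, m, c, h⟩ := σ.exists_local a i hi
    obtain ⟨-, -, -, h, -⟩ := h.self_of_nhds
    rw [h, δ.mem_dualLattice_iff]
    constructor
    · rintro ⟨k, hk⟩
      refine ⟨k - m, ?_⟩
      have h1 : δ.push a (η - (σ.Y a - intCov m)) = δ.push a (intCov k) := hk
      have h2 := δ.push_injective a h1
      rw [intCov_sub, ← h2]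
      abel
    · rintro ⟨k, hk⟩
      refine ⟨k + m, ?_⟩
      change δ.push a (η - (σ.Y a - intCov m)) = _
      rw [hk, intCov_add]
      congr 1
      abel
  change DualX.mk (δ.p a) (δ.push a η) ∈ Φ.lagrangian ↔ _
  rw [Φ.mk_mem_lagrangian_iff]
  constructor
  · rintro ⟨i, hi, h⟩
    exact (key i hi).1 h
  · intro h
    obtain ⟨i, hi⟩ := Φ.cover (δ.p a)
    exact ⟨i, hi, (key i hi).2 h⟩

theorem S_mem_pathSpace (m : Fin n → ℤ) (a : E n) : σ.S m a ∈ Φ.pathSpace :=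
  (σ.Q_mem_pathSpace_iff a _).2 ⟨m, rfl⟩

theorem exists_S {q : CotangentBundle n B} (hq : q ∈ Φ.pathSpace) {a : E n} (h : q.1 = δ.p a) :
    ∃ m, q = σ.S m a := by
  obtain ⟨η, rfl⟩ := δ.exists_Q_of_proj h
  obtain ⟨m, rfl⟩ := (σ.Q_mem_pathSpace_iff a η).1 hq
  exact ⟨m, rfl⟩

/-! ### Deck transformations -/

/-- Seen in one chart, `p` is `A z + b` near `z₀` and `C z + d` near `γ z₀`. Then `γ z = C⁻¹(A z + b
- d)` near `z₀`, and covectors are pulled back by `C⁻¹A`. -/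
theorem _root_.SemiFlat.Development.deck_local {γ : E n → E n} (hγc : Continuous γ)
    (hγ : ∀ z, δ.p (γ z) = δ.p z) (z₀ : E n) :
    ∃ T : Matrix.SpecialLinearGroup (Fin n) ℤ, HasFDerivAt γ (slEquiv T : E n →L[ℝ] E n) z₀ ∧
      ∀ᶠ z in 𝓝 z₀, ∀ η : Dual n, δ.Q (γ z) η = δ.Q z (η.comp (slEquiv T : E n →L[ℝ] E n)) := by
  obtain ⟨A, b, C, d, hA, hC, hAC⟩ := δ.exists_transition (hγ z₀).symm
  have hT : ∀ v, slEquiv (C⁻¹ * A) v = (slEquiv C).symm (slEquiv A v) := fun v => by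
    rw [slEquiv_mul, slEquiv_symm]
  refine ⟨C⁻¹ * A, ?_, ?_⟩
  · have h1 : HasFDerivAt (fun z => slEquiv (C⁻¹ * A) z + (slEquiv C).symm (b - d))
        (slEquiv (C⁻¹ * A) : E n →L[ℝ] E n) z₀ := (slEquiv _).hasFDerivAt.add_const _
    refine h1.congr_of_eventuallyEq ?_
    filter_upwards [hA, hγc.continuousAt.eventually hC] with z h2 h3
    rw [hγ, h2] at h3
    apply (slEquiv C).injective
    rw [map_add, hT, ContinuousLinearEquiv.apply_symm_apply, ContinuousLinearEquiv.apply_symm_apply,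
      add_sub, h3, add_sub_cancel_right]
  · have h1 : ContinuousAt (fun z => (z, γ z)) z₀ := by fun_prop
    filter_upwards [h1.eventually hAC] with z hz η
    have := hz (hγ z).symm (η.comp ((slEquiv C).symm : E n →L[ℝ] E n))
    have e1 : (η.comp ((slEquiv C).symm : E n →L[ℝ] E n)).comp (slEquiv C : E n →L[ℝ] E n) = η := by
      ext v
      simp
    rw [e1] at this
    rw [← this]
    congr 1
    ext v
    exact congrArg η (hT v).symm

/-- `γ` is the lift of `p` through `p` that starts at `c`. The label of `S k (γ z)` over `z` is
integral and varies continuously, so it keeps its value `m` at `a`. -/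
theorem exists_deck {a c : E n} {m k : Fin n → ℤ} (h : σ.S m a = σ.S k c) :
    ∃ γ : C(E n, E n), δ.p ∘ γ = δ.p ∧ γ a = c ∧ ∀ z, σ.S m z = σ.S k (γ z) := by
  have hp : δ.p a = δ.p c := congrArg TotalSpace.proj h
  obtain ⟨γ, ⟨hγa, hγ⟩, -⟩ := δ.cov.existsUnique_continuousMap_lifts
    (⟨δ.p, δ.cov.continuous⟩ : C(E n, B)) a c hp.symm
  refine ⟨γ, hγ, hγa, ?_⟩
  have hγ' : ∀ z, δ.p (γ z) = δ.p z := congrFun hγ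
  have hex : ∀ z, ∃ l, σ.S k (γ z) = σ.S l z := fun z =>
    σ.exists_S (σ.S_mem_pathSpace k (γ z)) (hγ' z)
  choose l hl using hex
  have hloc : IsLocallyConstant l := by
    rw [IsLocallyConstant.iff_eventually_eq]
    intro z₀
    obtain ⟨T, -, hT⟩ := δ.deck_local γ.continuous hγ' z₀
    have h3 : ∀ᶠ z in 𝓝 z₀, intCov (l z)
        = (σ.Y (γ z) + intCov k).comp (slEquiv T : E n →L[ℝ] E n) - σ.Y z := by
      filter_upwards [hT] with z hz
      rw [eq_sub_iff_add_eq']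
      apply δ.Q_injective z
      rw [← hz]
      exact (hl z).symm
    have hcont : ContinuousAt (fun z => (σ.Y (γ z) + intCov k).comp
        (slEquiv T : E n →L[ℝ] E n) - σ.Y z) z₀ := by
      have := γ.continuous
      have hY := σ.contDiff_Y.continuous
      fun_prop
    have h4 : ContinuousAt (fun z => intCov (l z)) z₀ := hcont.congr (h3.mono fun z hz => hz.symm)
    have h5 : ∀ j, ∀ᶠ z in 𝓝 z₀, l z j = l z₀ j := by
      intro j
      have h6 : ContinuousAt (fun z => intCov (l z) (Pi.single j 1)) z₀ :=
        h4.clm_apply continuousAt_const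
      simp only [intCov_single] at h6
      filter_upwards [Metric.continuousAt_iff'.1 h6 1 one_pos] with z hz
      rw [Real.dist_eq, ← Int.cast_sub, ← Int.cast_abs] at hz
      have : |l z j - l z₀ j| < 1 := by exact_mod_cast hz
      rw [Int.abs_lt_one_iff] at this
      linarith
    filter_upwards [eventually_all.2 h5] with z hz
    exact funext hz
  intro z
  have h6 : l z = l a := hloc.apply_eq_of_preconnectedSpace z a
  have h7 : l a = m := by
    apply σ.S_injective a
    change σ.S (l a) a = σ.S m a
    rw [← hl a, hγa, h]
  rw [hl z, h6, h7]

/-- The potential of the sheet with label `m`: a primitive of the area form. -/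
def ψ (m : Fin n → ℤ) (a : E n) : ℝ := σ.f a + intCov m a

theorem hasFDerivAt_ψ (m : Fin n → ℤ) (a : E n) :
    HasFDerivAt (σ.ψ m) (σ.Y a + intCov m) a :=
  (σ.hasFDerivAt a).add (intCov m).hasFDerivAt

/-- Both `ψ k ∘ γ` and `ψ m` are primitives of the pullback of d𝒜 to the same sheet, so their
difference is constant. -/
theorem ψ_deck {γ : E n → E n} (hγc : Continuous γ) (hγ : ∀ z, δ.p (γ z) = δ.p z)
    {m k : Fin n → ℤ} (h : ∀ z, σ.S m z = σ.S k (γ z)) (z w : E n) :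
    σ.ψ k (γ z) - σ.ψ m z = σ.ψ k (γ w) - σ.ψ m w := by
  have hd : ∀ x, HasFDerivAt (fun x => σ.ψ k (γ x) - σ.ψ m x) (0 : Dual n) x := by
    intro x
    obtain ⟨T, hT, hQ⟩ := δ.deck_local hγc hγ x
    have h1 := (HasFDerivAt.comp x (σ.hasFDerivAt_ψ k (γ x)) hT).sub (σ.hasFDerivAt_ψ m x)
    have h2 : (σ.Y (γ x) + intCov k).comp (slEquiv T : E n →L[ℝ] E n) = σ.Y x + intCov m := by
      apply δ.Q_injective x
      rw [← hQ.self_of_nhds]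
      exact (h x).symm
    rw [h2, sub_self] at h1
    exact h1
  exact is_const_of_fderiv_eq_zero (𝕜 := ℝ) (fun x => (hd x).differentiableAt)
    (fun x => (hd x).fderiv) z w

/-! ### Convexity -/

/-- The derivative of `Y` along the segment, evaluated on its direction, is the metric on a nonzero
vector. -/
theorem Y_strictMono {a c : E n} (h : a ≠ c) : 0 < (σ.Y c - σ.Y a) (c - a) := by
  let F : ℝ → ℝ := fun t => σ.Y (a + t • (c - a)) (c - a)
  have hF : ∀ t, HasDerivAt F (fderiv ℝ σ.Y (a + t • (c - a)) (c - a) (c - a)) t := by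
    intro t
    have h1 : HasDerivAt (fun t : ℝ => a + t • (c - a)) (c - a) t := by
      simpa using ((hasDerivAt_id t).smul_const (c - a)).const_add a
    have h2 := ((σ.contDiff_Y.differentiable (by simp)) (a + t • (c - a))).hasFDerivAt
    have h3 := h2.comp_hasDerivAt t h1
    exact h3.clm_apply (hasDerivAt_const t (c - a)) |>.congr_deriv (by simp)
  have hmono : StrictMono F := strictMono_of_deriv_pos fun t => by
    rw [(hF t).deriv, σ.hessian]
    apply g.pos
    exact fun h0 => sub_ne_zero.2 h.symm ((δ.D _).map_eq_zero_iff.1 h0)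
  have := hmono zero_lt_one
  simp only [F, zero_smul, add_zero, one_smul, add_sub_cancel] at this
  rw [sub_apply]
  linarith

theorem Y_injective : Function.Injective σ.Y := by
  intro a c h
  by_contra hac
  have := σ.Y_strictMono hac
  rw [h, sub_self] at this
  simp at this

/-- A critical point of a convex function is a global minimum; here strict monotonicity of `Y` gives
the sign of the derivative along the ray from `a` to `c`. -/
theorem ψ_le_of_zero {m : Fin n → ℤ} {a : E n} (ha : σ.Y a + intCov m = 0) (c : E n) :
    σ.ψ m a ≤ σ.ψ m c := by
  let F : ℝ → ℝ := fun t => σ.ψ m (a + t • (c - a))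
  have hF : ∀ t, HasDerivAt F ((σ.Y (a + t • (c - a)) + intCov m) (c - a)) t := by
    intro t
    have h1 : HasDerivAt (fun t : ℝ => a + t • (c - a)) (c - a) t := by
      simpa using ((hasDerivAt_id t).smul_const (c - a)).const_add a
    exact (σ.hasFDerivAt_ψ m _).comp_hasDerivAt t h1
  have hmono : MonotoneOn F (Ici 0) := by
    refine monotoneOn_of_deriv_nonneg (convex_Ici 0)
      (fun t _ => (hF t).continuousAt.continuousWithinAt)
      (fun t _ => (hF t).differentiableAt.differentiableWithinAt) fun t ht => ?_
    rw [interior_Ici, mem_Ioi] at ht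
    rw [(hF t).deriv]
    by_cases hac : a = c
    · simp [hac]
    · have hne : a ≠ a + t • (c - a) := by
        intro h
        have h2 : t • (c - a) = 0 := by simpa using h.symm
        rw [smul_eq_zero] at h2
        rcases h2 with h2 | h2
        · exact ht.ne' h2
        · exact hac (sub_eq_zero.1 h2).symm
      have h1 := σ.Y_strictMono hne
      rw [add_sub_cancel_left, map_smul, smul_eq_mul] at h1
      have h3 : intCov m = -σ.Y a := eq_neg_of_add_eq_zero_right ha
      rw [h3, ← sub_eq_add_neg]
      exact ((mul_pos_iff_of_pos_left ht).1 h1).le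
  have := hmono (mem_Ici.2 le_rfl) (mem_Ici.2 zero_le_one) zero_le_one
  simpa [F] using this

/-- A sheet with a zero has trivial stabilizer. -/
theorem S_injective_of_zero {m : Fin n → ℤ} {x : E n} (hx : σ.Y x + intCov m = 0) :
    Function.Injective (σ.S m) := by
  intro a c h
  obtain ⟨γ, hγ, hac, hS⟩ := σ.exists_deck h
  have h1 : δ.Q x 0 = δ.Q (γ x) (σ.Y (γ x) + intCov m) := by
    have := hS x
    unfold S at this
    rwa [hx] at this
  have h2 : σ.Y (γ x) + intCov m = 0 := by
    have hp : δ.p x = δ.p (γ x) := congrArg TotalSpace.proj h1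
    have h0 : δ.Q x 0 = δ.Q (γ x) 0 :=
      congrArg (fun y : B => (⟨y, 0⟩ : CotangentBundle n B)) hp
    exact δ.Q_injective _ (h1.symm.trans h0)
  -- A deck transformation preserving the sheet moves a zero to a zero, and there is only one. Lifts
  -- that agree at one point agree everywhere, so `γ` is the identity.
  have h3 : γ x = x := σ.Y_injective (add_right_cancel (h2.trans hx.symm))
  have h4 : (γ : E n → E n) = id := by
    refine δ.cov.eq_of_comp_eq γ.continuous continuous_id ?_ x h3
    rw [hγ, Function.comp_id]
  rw [← hac, h4]
  rfl

/-! ### Connected components of the path space -/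

/-- An open set of `T^*B` meeting the path space in the sheet with label `m`. -/
def nbhd (m : Fin n → ℤ) : Set (CotangentBundle n B) :=
  (fun z : E n × Dual n => δ.Q z.1 z.2) ''
    {z | ∀ j, |z.2 (Pi.single j 1) - (σ.Y z.1 + intCov m) (Pi.single j 1)| < 1}

theorem isOpen_nbhd (m : Fin n → ℤ) : IsOpen (σ.nbhd m) := by
  refine δ.isOpenMap_Q _ ?_
  rw [ofPred_forall]
  refine isOpen_iInter_of_finite fun j => isOpen_lt ?_ continuous_const
  have := σ.contDiff_Y.continuous
  fun_prop

theorem range_S_subset_nbhd (m : Fin n → ℤ) : range (σ.S m) ⊆ σ.nbhd m := by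
  rintro _ ⟨a, rfl⟩
  exact ⟨(a, σ.Y a + intCov m), by simp, rfl⟩

/-- Two points of ℤⁿ whose coordinates differ by less than 1 coincide, so the open set isolates the
sheet within the path space. -/
theorem nbhd_inter_pathSpace (m : Fin n → ℤ) : σ.nbhd m ∩ Φ.pathSpace ⊆ range (σ.S m) := by
  rintro _ ⟨⟨⟨a, η⟩, h, rfl⟩, hq⟩
  obtain ⟨k, hk⟩ := (σ.Q_mem_pathSpace_iff a η).1 hq
  subst hk
  have : k = m := by
    funext j
    have := h j
    simp only [add_apply, intCov_single, add_sub_add_left_eq_sub] at this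
    rw [← Int.cast_sub, ← Int.cast_abs] at this
    have : |k j - m j| < 1 := by exact_mod_cast this
    rw [Int.abs_lt_one_iff] at this
    linarith
  exact ⟨a, by rw [this]; rfl⟩

theorem range_S_eq {m k : Fin n → ℤ} {a c : E n} (h : σ.S m a = σ.S k c) :
    range (σ.S m) ⊆ range (σ.S k) := by
  obtain ⟨γ, -, -, hγ⟩ := σ.exists_deck h
  rintro _ ⟨z, rfl⟩
  exact ⟨γ z, (hγ z).symm⟩

/-- Images of sheets are connected, and by deck transformations two of them are equal or disjoint.
The open sets `nbhd` separate one image from the union of all images disjoint from it. -/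
theorem connectedComponentIn_S (m : Fin n → ℤ) (a : E n) :
    connectedComponentIn Φ.pathSpace (σ.S m a) = range (σ.S m) := by
  apply Subset.antisymm
  · have hpre := isPreconnected_connectedComponentIn (x := σ.S m a) (F := Φ.pathSpace)
    have hsub := connectedComponentIn_subset Φ.pathSpace (σ.S m a)
    have hmem : σ.S m a ∈ connectedComponentIn Φ.pathSpace (σ.S m a) :=
      mem_connectedComponentIn (σ.S_mem_pathSpace m a)
    let V : Set (CotangentBundle n B) :=
      ⋃ k ∈ {k | Disjoint (range (σ.S k)) (range (σ.S m))}, σ.nbhd k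
    have hV : IsOpen V := isOpen_biUnion fun k _ => σ.isOpen_nbhd k
    have hVd : ∀ q ∈ Φ.pathSpace, q ∈ V → q ∉ range (σ.S m) := by
      intro q hq hqV
      simp only [V, mem_iUnion] at hqV
      obtain ⟨k, hk, hqk⟩ := hqV
      exact disjoint_left.1 hk (σ.nbhd_inter_pathSpace k ⟨hqk, hq⟩)
    rcases isPreconnected_iff_subset_of_disjoint.1 hpre (σ.nbhd m) V (σ.isOpen_nbhd m) hV
      (by
        intro q hq
        obtain ⟨c, hc⟩ := δ.surj q.1
        obtain ⟨k, rfl⟩ := σ.exists_S (hsub hq) hc.symm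
        by_cases hd : Disjoint (range (σ.S k)) (range (σ.S m))
        · exact Or.inr (mem_biUnion hd (σ.range_S_subset_nbhd k ⟨c, rfl⟩))
        · left
          rw [not_disjoint_iff] at hd
          obtain ⟨_, ⟨z, rfl⟩, ⟨w, hw⟩⟩ := hd
          exact σ.range_S_subset_nbhd m (σ.range_S_eq hw.symm ⟨c, rfl⟩))
      (by
        rw [eq_empty_iff_forall_notMem]
        rintro q ⟨hq, hq1, hq2⟩
        exact hVd q (hsub hq) hq2 (σ.nbhd_inter_pathSpace m ⟨hq1, hsub hq⟩)) with h | h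
    · exact fun q hq => σ.nbhd_inter_pathSpace m ⟨h hq, hsub hq⟩
    · exact absurd ⟨a, rfl⟩ (hVd _ (hsub hmem) (h hmem))
  · refine IsPreconnected.subset_connectedComponentIn
      (isPreconnected_range (σ.continuous_S m)) ⟨a, rfl⟩ ?_
    rintro _ ⟨z, rfl⟩
    exact σ.S_mem_pathSpace m z

end GlobalPotential

end Sheets

/-! ### Fourier series of holomorphic functions periodic in the real directions -/

section Fourier

variable {n : ℕ}

/-- Coefficient sequences that decay faster than any exponential. -/
def RapidSeq (c : (Fin n → ℤ) → ℂ) : Prop :=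
  ∀ R : ℝ, ∃ M : ℝ, ∀ m, ‖c m‖ ≤ M * Real.exp (-R * ‖m‖)

theorem abs_intCov_le (m : Fin n → ℤ) (v : E n) : |intCov m v| ≤ n * ‖m‖ * ‖v‖ := by
  rw [intCov_apply]
  calc |∑ k, (m k : ℝ) * v k| ≤ ∑ k, |(m k : ℝ) * v k| := Finset.abs_sum_le_sum_abs _ _
    _ ≤ ∑ _k : Fin n, ‖m‖ * ‖v‖ := by
        refine Finset.sum_le_sum fun k _ => ?_
        rw [abs_mul]
        refine mul_le_mul ?_ ?_ (abs_nonneg _) (norm_nonneg _)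
        · have := norm_le_pi_norm m k
          rwa [Int.norm_eq_abs] at this
        · exact norm_le_pi_norm v k
    _ = n * ‖m‖ * ‖v‖ := by simp; ring

theorem summable_exp_neg_abs : Summable fun k : ℤ => Real.exp (-|(k : ℝ)|) := by
  have h : Summable fun k : ℕ => Real.exp (-(k : ℝ)) := by
    simpa using Real.summable_exp_neg_nat
  refine Summable.of_nat_of_neg ?_ ?_
  · simpa using h
  · simpa using h

theorem summable_prod_exp (n : ℕ) :
    Summable fun m : Fin n → ℤ => ∏ j, Real.exp (-|(m j : ℝ)|) := by
  induction n with
  | zero => exact (hasSum_fintype _).summable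
  | succ n ih =>
    rw [← (Fin.consEquiv fun _ => ℤ).summable_iff]
    have := Summable.mul_of_nonneg summable_exp_neg_abs ih (fun _ => (Real.exp_pos _).le)
      (fun _ => Finset.prod_nonneg fun _ _ => (Real.exp_pos _).le)
    refine this.congr fun z => ?_
    simp [Fin.consEquiv, Fin.prod_univ_succ]

/-- The sum of the |m_j| is at most `n` times the sup norm, so the product of one-dimensional
geometric series dominates. -/
theorem summable_exp_neg_norm (n : ℕ) :
    Summable fun m : Fin n → ℤ => Real.exp (-(n : ℝ) * ‖m‖) := by
  refine Summable.of_nonneg_of_le (fun _ => (Real.exp_pos _).le) (fun m => ?_) (summable_prod_exp n)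
  rw [← Real.exp_sum, Real.exp_le_exp, Finset.sum_neg_distrib, neg_mul, neg_le_neg_iff]
  calc ∑ j, |(m j : ℝ)| ≤ ∑ _j : Fin n, ‖m‖ := Finset.sum_le_sum fun j _ => by
        have := norm_le_pi_norm m j
        rwa [Int.norm_eq_abs] at this
    _ = n * ‖m‖ := by simp

namespace RapidSeq

variable {c : (Fin n → ℤ) → ℂ}

theorem exists_bound (hc : RapidSeq c) (K : ℝ) :
    ∃ u : (Fin n → ℤ) → ℝ, Summable u ∧ ∀ m, ‖c m‖ * Real.exp (K * ‖m‖) ≤ u m := by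
  -- `K` absorbs the given exponential; the extra rate `n` leaves a summable majorant.
  obtain ⟨M, hM⟩ := hc (n + K)
  refine ⟨fun m => M * Real.exp (-(n : ℝ) * ‖m‖), (summable_exp_neg_norm n).mul_left M,
    fun m => ?_⟩
  calc ‖c m‖ * Real.exp (K * ‖m‖)
      ≤ M * Real.exp (-(n + K) * ‖m‖) * Real.exp (K * ‖m‖) := by gcongr; exact hM m
    _ = M * Real.exp (-(n : ℝ) * ‖m‖) := by
        rw [mul_assoc, ← Real.exp_add]
        congr 2
        ring

/-- Differentiating the Fourier series multiplies its coefficients by coordinates of `m`; this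
closure property drives the induction in `contDiff_theta`. -/
theorem mul_coord (hc : RapidSeq c) (j : Fin n) : RapidSeq fun m => c m * (m j : ℂ) := by
  intro R
  obtain ⟨M, hM⟩ := hc (R + 1)
  refine ⟨M, fun m => ?_⟩
  have h1 : ‖(m j : ℂ)‖ ≤ Real.exp ‖m‖ := by
    have h2 := norm_le_pi_norm m j
    rw [Int.norm_eq_abs] at h2
    have h3 : ‖(m j : ℂ)‖ = |(m j : ℝ)| := by simp
    rw [h3]
    linarith [Real.add_one_le_exp ‖m‖]
  rw [norm_mul]
  calc ‖c m‖ * ‖(m j : ℂ)‖ ≤ M * Real.exp (-(R + 1) * ‖m‖) * Real.exp ‖m‖ :=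
        mul_le_mul (hM m) h1 (norm_nonneg _) ((norm_nonneg _).trans (hM m))
    _ = M * Real.exp (-R * ‖m‖) := by
        rw [mul_assoc, ← Real.exp_add]
        congr 2
        ring

end RapidSeq

/-- The sup norm of `m` is attained at some |m_j|. Choosing `a = ± r e_j` with the sign opposite to
that of `m_j` turns the hypothesis into decay at rate `2πr = |R|`. The constant adds up the finitely
many choices of `a`, with `a = 0` for `m = 0`. -/
theorem rapidSeq_of_bounded {c : (Fin n → ℤ) → ℂ}
    (h : ∀ a : E n, ∃ M : ℝ, ∀ m, ‖c m‖ * Real.exp (-(2 * Real.pi * intCov m a)) ≤ M) :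
    RapidSeq c := by
  intro R
  choose M hM using h
  set r : ℝ := |R| / (2 * Real.pi) with hr
  have hMnn : ∀ a, 0 ≤ M a := fun a => (by positivity : (0 : ℝ) ≤ _).trans (hM a 0)
  refine ⟨M 0 + ∑ j, (M (Pi.single j r) + M (-Pi.single j r)), fun m => ?_⟩
  suffices h : ‖c m‖ * Real.exp (R * ‖m‖) ≤
      M 0 + ∑ j, (M (Pi.single j r) + M (-Pi.single j r)) by
    rw [neg_mul, Real.exp_neg]
    rwa [← div_eq_mul_inv, le_div_iff₀ (Real.exp_pos _)]
  have hsum : ∀ j, M (Pi.single j r) + M (-Pi.single j r)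
      ≤ M 0 + ∑ j, (M (Pi.single j r) + M (-Pi.single j r)) := fun j => by
    have := Finset.single_le_sum (f := fun j => M (Pi.single j r) + M (-Pi.single j r))
      (fun i _ => add_nonneg (hMnn _) (hMnn _)) (Finset.mem_univ j)
    linarith [hMnn 0]
  by_cases h0 : ‖m‖ = 0
  · have := hM 0 m
    rw [map_zero, mul_zero, neg_zero, Real.exp_zero] at this
    rw [h0, mul_zero, Real.exp_zero]
    exact this.trans (le_add_of_nonneg_right
      (Finset.sum_nonneg fun i _ => add_nonneg (hMnn _) (hMnn _)))
  · have hn : Nonempty (Fin n) := by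
      by_contra hne
      rw [not_nonempty_iff] at hne
      exact h0 (by rw [Subsingleton.elim m 0, norm_zero])
    obtain ⟨j, hj⟩ := Finite.exists_max fun j => ‖m j‖
    have hjm : ‖m‖ = ‖m j‖ := le_antisymm ((pi_norm_le_iff_of_nonneg (norm_nonneg _)).2 hj)
      (norm_le_pi_norm m j)
    have hval : ∀ t : ℝ, intCov m (Pi.single j t) = m j * t := fun t => by
      simp [intCov_apply, Pi.single_apply]
    have hRr : 2 * Real.pi * r = |R| := by rw [hr]; field_simp
    have hle : Real.exp (R * ‖m‖) ≤ Real.exp (|R| * |(m j : ℝ)|) := by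
      rw [Real.exp_le_exp, hjm, Int.norm_eq_abs]
      exact mul_le_mul_of_nonneg_right (le_abs_self R) (abs_nonneg _)
    refine (mul_le_mul_of_nonneg_left hle (norm_nonneg _)).trans ?_
    rcases le_total 0 (m j : ℝ) with hs | hs
    · have := hM (-Pi.single j r) m
      rw [map_neg, hval] at this
      have e : -(2 * Real.pi * -(↑(m j) * r)) = |R| * |(m j : ℝ)| := by
        rw [abs_of_nonneg hs, ← hRr]; ring
      rw [e] at this
      linarith [hsum j, hMnn (Pi.single j r)]
    · have := hM (Pi.single j r) m
      rw [hval] at this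
      have e : -(2 * Real.pi * (↑(m j) * r)) = |R| * |(m j : ℝ)| := by
        rw [abs_of_nonpos hs, ← hRr]; ring
      rw [e] at this
      linarith [hsum j, hMnn (-Pi.single j r)]

/-- The `j`-th coordinate of `2πi(v + ia)` as a function of `(a, v)`. -/
def expCoord (j : Fin n) : E n × E n →L[ℝ] ℂ :=
  (2 * Real.pi * Complex.I : ℂ) • Complex.ofRealCLM.comp
      ((ContinuousLinearMap.proj (R := ℝ) j).comp (ContinuousLinearMap.snd ℝ (E n) (E n)))
    - (2 * Real.pi : ℂ) • Complex.ofRealCLM.comp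
      ((ContinuousLinearMap.proj (R := ℝ) j).comp (ContinuousLinearMap.fst ℝ (E n) (E n)))

theorem expCoord_apply (j : Fin n) (z : E n × E n) :
    expCoord j z = 2 * Real.pi * Complex.I * z.2 j - 2 * Real.pi * z.1 j := by
  simp [expCoord]

/-- The function `2πi⟨m, v + ia⟩` of `(a, v)`. -/
def expLin (m : Fin n → ℤ) : E n × E n →L[ℝ] ℂ := ∑ j, (m j : ℝ) • expCoord j

theorem expLin_apply (m : Fin n → ℤ) (z : E n × E n) :
    expLin m z = 2 * Real.pi * Complex.I * (intCov m z.2 : ℝ) - 2 * Real.pi * (intCov m z.1 : ℝ) := by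
  simp only [expLin, FunLike.coe_sum, Finset.sum_apply, smul_apply,
    expCoord_apply, intCov_apply, Complex.ofReal_sum, Complex.ofReal_mul, Finset.mul_sum,
    Complex.real_smul]
  rw [← Finset.sum_sub_distrib]
  refine Finset.sum_congr rfl fun j _ => ?_
  push_cast
  ring

theorem norm_exp_expLin (m : Fin n → ℤ) (z : E n × E n) :
    ‖Complex.exp (expLin m z)‖ = Real.exp (-(2 * Real.pi * intCov m z.1)) := by
  rw [Complex.norm_exp, expLin_apply]
  simp

theorem norm_exp_expLin_le (m : Fin n → ℤ) (z : E n × E n) :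
    ‖Complex.exp (expLin m z)‖ ≤ Real.exp (2 * Real.pi * n * ‖z.1‖ * ‖m‖) := by
  rw [norm_exp_expLin, Real.exp_le_exp]
  have h1 := (abs_le.1 (abs_intCov_le m z.1)).1
  have : 2 * Real.pi * (-(n * ‖m‖ * ‖z.1‖)) ≤ 2 * Real.pi * intCov m z.1 :=
    mul_le_mul_of_nonneg_left h1 (by positivity)
  linarith

/-- The Fourier series `∑ c_m e^{2πi⟨m, v + ia⟩}`. -/
def theta (c : (Fin n → ℤ) → ℂ) (z : E n × E n) : ℂ := ∑' m, c m * Complex.exp (expLin m z)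

theorem RapidSeq.summable_theta {c : (Fin n → ℤ) → ℂ} (hc : RapidSeq c) (z : E n × E n) :
    Summable fun m => c m * Complex.exp (expLin m z) := by
  obtain ⟨u, hu, hcu⟩ := hc.exists_bound (2 * Real.pi * n * ‖z.1‖)
  refine Summable.of_norm_bounded hu fun m => ?_
  rw [norm_mul]
  exact (mul_le_mul_of_nonneg_left (norm_exp_expLin_le m z) (norm_nonneg _)).trans (hcu m)

/-- Termwise differentiation: on the unit ball about `z` the factor e^{-2π⟨m,a⟩} grows at a fixed
exponential rate in ‖m‖, which the coefficients beat. The derivative consists of series of the same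
kind, so smoothness follows by induction. -/
theorem RapidSeq.hasFDerivAt_theta {c : (Fin n → ℤ) → ℂ} (hc : RapidSeq c) (z : E n × E n) :
    HasFDerivAt (theta c) (∑ j, theta (fun m => c m * (m j : ℂ)) z • expCoord j) z := by
  have hterm : ∀ m (w : E n × E n), HasFDerivAt (fun w => c m * Complex.exp (expLin m w))
      (∑ j, (c m * (m j : ℂ) * Complex.exp (expLin m w)) • (expCoord j : E n × E n →L[ℝ] ℂ)) w := by
    intro m w
    refine (((expLin m).hasFDerivAt (x := w)).cexp.const_mul (c m)).congr_fderiv ?_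
    simp only [expLin, Finset.smul_sum]
    refine Finset.sum_congr rfl fun j _ => ?_
    ext u
    · simp
      ring
    · simp
      ring
  let s : Set (E n × E n) := Metric.ball z 1
  have hb : ∀ j : Fin n, ∃ u : (Fin n → ℤ) → ℝ, Summable u ∧ ∀ m, ∀ w ∈ s,
      ‖(c m * (m j : ℂ) * Complex.exp (expLin m w)) • (expCoord j : E n × E n →L[ℝ] ℂ)‖ ≤ u m := by
    intro j
    obtain ⟨u, hu, hcu⟩ := (hc.mul_coord j).exists_bound (2 * Real.pi * n * (‖z.1‖ + 1))
    refine ⟨fun m => u m * ‖(expCoord j : E n × E n →L[ℝ] ℂ)‖, hu.mul_right _, fun m w hw => ?_⟩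
    rw [norm_smul, norm_mul]
    refine mul_le_mul_of_nonneg_right ?_ (norm_nonneg _)
    refine le_trans (mul_le_mul_of_nonneg_left ?_ (norm_nonneg _)) (hcu m)
    refine (norm_exp_expLin_le m w).trans ?_
    rw [Real.exp_le_exp]
    have h1 : ‖w.1‖ ≤ ‖z.1‖ + 1 := by
      have h2 : dist w.1 z.1 < 1 := lt_of_le_of_lt (le_max_left _ _) hw
      rw [dist_eq_norm] at h2
      have h3 := norm_add_le (w.1 - z.1) z.1
      rw [sub_add_cancel] at h3
      linarith
    gcongr
  choose u hu hub using hb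
  have key := hasFDerivAt_tsum_of_isPreconnected (𝕜 := ℝ) (u := fun m => ∑ j, u j m)
    (summable_sum fun j _ => hu j) Metric.isOpen_ball (convex_ball z 1).isPreconnected
    (fun m w _ => hterm m w)
    (fun m w hw => (norm_sum_le _ _).trans (Finset.sum_le_sum fun j _ => hub j m w hw))
    (Metric.mem_ball_self one_pos) (hc.summable_theta z) (Metric.mem_ball_self one_pos)
  refine key.congr_fderiv ?_
  rw [Summable.tsum_finsetSum fun j _ =>
    Summable.of_norm_bounded (hu j) fun m => hub j m z (Metric.mem_ball_self one_pos)]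
  refine Finset.sum_congr rfl fun j _ => ?_
  rw [theta, ((hc.mul_coord j).summable_theta z).tsum_smul_const]

theorem RapidSeq.contDiff_theta {c : (Fin n → ℤ) → ℂ} (hc : RapidSeq c) :
    ContDiff ℝ ∞ (theta c) := by
  rw [contDiff_infty]
  intro k
  induction k generalizing c with
  | zero =>
    exact contDiff_zero.2 (continuous_iff_continuousAt.2 fun z => (hc.hasFDerivAt_theta z).continuousAt)
  | succ k ih =>
    push_cast
    rw [contDiff_succ_iff_fderiv]
    refine ⟨fun z => (hc.hasFDerivAt_theta z).differentiableAt, by simp, ?_⟩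
    have : fderiv ℝ (theta c) = fun z => ∑ j, theta (fun m => c m * (m j : ℂ)) z •
        (expCoord j : E n × E n →L[ℝ] ℂ) := funext fun z => (hc.hasFDerivAt_theta z).fderiv
    rw [this]
    exact ContDiff.sum fun j _ => (ih (hc.mul_coord j)).smul contDiff_const

theorem RapidSeq.theta_holomorphic {c : (Fin n → ℤ) → ℂ} (hc : RapidSeq c) (z : E n × E n)
    (u : E n) : fderiv ℝ (theta c) z (u, 0) = Complex.I * fderiv ℝ (theta c) z (0, u) := by
  rw [(hc.hasFDerivAt_theta z).fderiv]
  simp only [FunLike.coe_sum, Finset.sum_apply, smul_apply, expCoord_apply,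
    smul_eq_mul, Finset.mul_sum]
  refine Finset.sum_congr rfl fun j _ => ?_
  simp only [Pi.zero_apply, Complex.ofReal_zero, mul_zero]
  linear_combination (-2 * theta (fun m => c m * (m j : ℂ)) z * Real.pi * u j) * Complex.I_sq

end Fourier

/-! ### Fourier coefficients on the torus and the expansion of periodic holomorphic functions -/

section Fourier

open MeasureTheory

/-- The normalized Haar measure of the circle, as in Mathlib's theory of Fourier series. -/
local instance : MeasureSpace UnitAddCircle := ⟨AddCircle.haarAddCircle⟩

local instance : IsProbabilityMeasure (volume : Measure UnitAddCircle) :=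
  inferInstanceAs (IsProbabilityMeasure AddCircle.haarAddCircle)

variable {n : ℕ}

/-- The projection `ℝⁿ → ℝⁿ / ℤⁿ`. -/
def torusMk (v : E n) : UnitAddTorus (Fin n) := fun i => (v i : UnitAddCircle)

theorem isOpenQuotientMap_torusMk : IsOpenQuotientMap (torusMk (n := n)) where
  surjective := fun θ => by
    choose v hv using fun i => QuotientAddGroup.mk_surjective (θ i)
    exact ⟨v, funext hv⟩
  continuous := continuous_pi fun i => (AddCircle.continuous_mk' 1).comp (continuous_apply i)
  isOpenMap := IsOpenMap.piMap (fun _ => QuotientAddGroup.isOpenMap_coe)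
    (Eventually.of_forall fun _ => QuotientAddGroup.mk_surjective)

theorem torusMk_eq_iff (v w : E n) :
    torusMk v = torusMk w ↔ ∃ k : Fin n → ℤ, w = v + fun i => (k i : ℝ) := by
  constructor
  · intro h
    have h1 : ∀ i, ∃ k : ℤ, w i = v i + k := fun i => by
      have := congrFun h i
      simp only [torusMk] at this
      obtain ⟨k, hk⟩ := (AddCircle.coe_eq_zero_iff 1 (x := w i - v i)).1 (by
        rw [AddCircle.coe_sub, this, sub_self])
      exact ⟨k, by rw [zsmul_one] at hk; linarith⟩
    choose k hk using h1
    exact ⟨k, funext hk⟩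
  · rintro ⟨k, rfl⟩
    funext i
    simp [torusMk]

theorem exists_torus_lift {f : E n → ℂ} (hf : Continuous f)
    (hp : ∀ v (k : Fin n → ℤ), f (v + fun i => (k i : ℝ)) = f v) :
    ∃ g : C(UnitAddTorus (Fin n), ℂ), ∀ v, g (torusMk v) = f v := by
  have hq := isOpenQuotientMap_torusMk (n := n)
  let g : UnitAddTorus (Fin n) → ℂ := fun θ => f (Function.surjInv hq.surjective θ)
  have hg : ∀ v, g (torusMk v) = f v := fun v => by
    obtain ⟨k, hk⟩ := (torusMk_eq_iff v _).1
      (Function.surjInv_eq hq.surjective (torusMk v)).symm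
    change f _ = f v
    rw [hk, hp]
  refine ⟨⟨g, ?_⟩, hg⟩
  rw [← hq.continuous_comp_iff]
  exact hf.congr fun v => (hg v).symm

theorem mFourier_torusMk (m : Fin n → ℤ) (v : E n) :
    UnitAddTorus.mFourier m (torusMk v) = Complex.exp (2 * Real.pi * Complex.I * (intCov m v : ℝ)) := by
  simp only [UnitAddTorus.mFourier, ContinuousMap.coe_mk, torusMk, fourier_coe_apply]
  rw [← Complex.exp_sum, intCov_apply]
  congr 1
  push_cast
  rw [Finset.mul_sum]
  refine Finset.sum_congr rfl fun i _ => ?_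
  ring

/-- The series converges uniformly, hence in L², where pairing with an orthonormal character picks
out one coefficient. -/
theorem eq_zero_of_tsum_mFourier {u : (Fin n → ℤ) → ℂ} (hu : Summable u)
    (h : ∀ v : E n, ∑' m, u m * Complex.exp (2 * Real.pi * Complex.I * (intCov m v : ℝ)) = 0) :
    u = 0 := by
  have hs : Summable fun m => u m • UnitAddTorus.mFourier m := by
    refine Summable.of_norm ?_
    simpa only [norm_smul, UnitAddTorus.mFourier_norm, mul_one] using hu.norm
  have h0 : ∑' m, u m • UnitAddTorus.mFourier m = 0 := by
    ext θ
    obtain ⟨v, rfl⟩ := isOpenQuotientMap_torusMk.surjective θ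
    have h1 := (ContinuousMap.evalCLM ℂ (torusMk v)).map_tsum hs
    change (∑' m, u m • UnitAddTorus.mFourier m) (torusMk v) = _ at h1
    rw [h1]
    refine Eq.trans ?_ (h v)
    refine tsum_congr fun m => ?_
    change u m • UnitAddTorus.mFourier m (torusMk v) = _
    rw [mFourier_torusMk, smul_eq_mul]
  have h1 : HasSum (fun m => u m • UnitAddTorus.mFourier m) 0 := h0 ▸ hs.hasSum
  have h2 := (ContinuousMap.toLp (E := ℂ) 2
    (volume : Measure (UnitAddTorus (Fin n))) ℂ).hasSum h1
  funext k
  have h3 := (innerSL ℂ (UnitAddTorus.mFourierLp 2 k)).hasSum h2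
  have h4 := orthonormal_iff_ite.1 (UnitAddTorus.orthonormal_mFourier (d := Fin n))
  have h5 : HasSum (fun m => if m = k then u k else 0) (0 : ℂ) := by
    rw [map_zero, map_zero] at h3
    suffices e : (fun m => if m = k then u k else 0) = fun m => innerSL ℂ
        (UnitAddTorus.mFourierLp 2 k) (ContinuousMap.toLp (E := ℂ) 2
          (volume : Measure (UnitAddTorus (Fin n))) ℂ (u m • UnitAddTorus.mFourier m)) by
      rw [e]
      exact h3
    funext m
    rw [map_smul]
    change _ = inner ℂ (UnitAddTorus.mFourierLp 2 k) (u m • UnitAddTorus.mFourierLp 2 m)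
    rw [inner_smul_right, h4 k m]
    by_cases hmk : m = k
    · simp [hmk]
    · simp [hmk, Ne.symm hmk]
  exact (hasSum_ite_eq k (u k)).unique h5

/-- The unit cube with lower corner `b`. -/
def cube (b : E n) : Set (E n) := {x | ∀ i, x i ∈ Ioc (b i) (b i + 1)}

theorem measurableSet_cube (b : E n) : MeasurableSet (cube b) :=
  MeasurableSet.univ_pi' fun _ => measurableSet_Ioc

theorem cube_subset_Icc : cube (0 : E n) ⊆ Icc 0 1 := fun x hx =>
  ⟨fun i => (hx i).1.le, fun i => by simpa using (hx i).2⟩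

theorem volume_cube_lt_top : volume (cube (0 : E n)) < ⊤ :=
  (measure_mono cube_subset_Icc).trans_lt isCompact_Icc.measure_lt_top

theorem hasDerivAt_integral_cube {K K' : ℝ → E n → ℂ}
    (hK : Continuous fun z : ℝ × E n => K z.1 z.2) (hK' : Continuous fun z : ℝ × E n => K' z.1 z.2)
    (hd : ∀ t v, HasDerivAt (fun t => K t v) (K' t v) t) (t₀ : ℝ) :
    HasDerivAt (fun t => ∫ v in cube 0, K t v) (∫ v in cube 0, K' t₀ v) t₀ := by
  obtain ⟨C, hC⟩ := ((isCompact_Icc (a := t₀ - 1) (b := t₀ + 1)).prod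
    (isCompact_Icc (a := (0 : E n)) (b := 1))).exists_bound_of_continuousOn hK'.continuousOn
  have : IsFiniteMeasure (volume.restrict (cube (0 : E n))) :=
    ⟨by simpa using volume_cube_lt_top⟩
  have hcont : ∀ t, Continuous (K t) := fun t => hK.comp (by fun_prop : Continuous fun v => (t, v))
  have hcont' : ∀ t, Continuous (K' t) := fun t =>
    hK'.comp (by fun_prop : Continuous fun v => (t, v))
  refine (hasDerivAt_integral_of_dominated_loc_of_deriv_le (bound := fun _ => C)
    (s := Icc (t₀ - 1) (t₀ + 1)) (Icc_mem_nhds (by linarith) (by linarith)) ?_ ?_ ?_ ?_ ?_ ?_).2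
  · exact Eventually.of_forall fun t => (hcont t).aestronglyMeasurable
  · exact ((hcont t₀).continuousOn.integrableOn_compact isCompact_Icc).mono_set cube_subset_Icc
  · exact (hcont' t₀).aestronglyMeasurable
  · filter_upwards [ae_restrict_mem (measurableSet_cube 0)] with v hv t ht
    exact hC (t, v) ⟨ht, cube_subset_Icc hv⟩
  · exact integrable_const C
  · exact Eventually.of_forall fun v t _ => hd t v

theorem integral_cube_add (f : E n → ℂ) (b : E n) :
    ∫ v in cube 0, f (v + b) = ∫ v in cube b, f v := by
  have h := (measurePreserving_add_right (volume : Measure (E n)) b).setIntegral_preimage_emb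
    (measurableEmbedding_addRight b) f (cube b)
  rw [← h]
  congr 2
  ext v
  simp only [cube, mem_ofPred_eq, mem_preimage, Pi.zero_apply, Pi.add_apply, mem_Ioc]
  refine forall_congr' fun i => ?_
  constructor <;> rintro ⟨h1, h2⟩ <;> constructor <;> linarith

theorem integral_cube_eq {f : E n → ℂ} (hf : Continuous f)
    (hp : ∀ v (k : Fin n → ℤ), f (v + fun i => (k i : ℝ)) = f v) (b : E n) :
    ∫ v in cube b, f v = ∫ v in cube 0, f v := by
  obtain ⟨g, hg⟩ := exists_torus_lift hf hp
  have h := fun b : E n => UnitAddTorus.integral_preimage g b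
  have h' : ∀ b : E n, ∫ θ, g θ = ∫ v in cube b, f v := fun b => by
    rw [h b]
    refine integral_congr_ae (Eventually.of_forall fun v => hg v)
  rw [← h', ← h']

/-- The integral over the torus of a function that is holomorphic in `v + ia` and periodic in `v`
does not depend on `a`. -/
theorem integral_cube_const {H : E n × E n → ℂ} (hH : ContDiff ℝ 1 H)
    (hp : ∀ a v (k : Fin n → ℤ), H (a, v + fun i => (k i : ℝ)) = H (a, v))
    (hol : ∀ z u, fderiv ℝ H z (u, 0) = Complex.I * fderiv ℝ H z (0, u)) (a : E n) :
    ∫ v in cube 0, H (a, v) = ∫ v in cube 0, H (0, v) := by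
  have hHc := hH.continuous
  have hH' := hH.continuous_fderiv (by simp)
  have hHd : ∀ z, HasFDerivAt H (fderiv ℝ H z) z := fun z =>
    (hH.differentiable (by simp) z).hasFDerivAt
  -- By periodicity the integral over a period cube is unchanged by translation in `v`; this is its
  -- derivative under translation.
  have hzero : ∀ x u, ∫ v in cube 0, fderiv ℝ H (x, v) (0, u) = 0 := by
    intro x u
    have h1 := hasDerivAt_integral_cube (K := fun t v => H (x, v + t • u))
      (K' := fun t v => fderiv ℝ H (x, v + t • u) (0, u)) (by fun_prop) (by fun_prop)
      (fun t v => by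
        have h2 : HasDerivAt (fun t : ℝ => (x, v + t • u)) ((0 : E n), u) t := by
          refine (hasDerivAt_const t x).prodMk ?_
          simpa using ((hasDerivAt_id t).smul_const u).const_add v
        exact (hHd _).comp_hasDerivAt t h2) 0
    have h3 : (fun t : ℝ => ∫ v in cube 0, H (x, v + t • u)) = fun _ => ∫ v in cube 0, H (x, v) := by
      funext t
      rw [integral_cube_add (fun v => H (x, v)) (t • u)]
      exact integral_cube_eq (by fun_prop) (hp x) _
    rw [h3] at h1
    simpa using h1.unique (hasDerivAt_const 0 _)
  have hd : ∀ t : ℝ, HasDerivAt (fun t : ℝ => ∫ v in cube 0, H (t • a, v)) 0 t := by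
    intro t
    have h1 := hasDerivAt_integral_cube (K := fun t v => H (t • a, v))
      (K' := fun t v => fderiv ℝ H (t • a, v) (a, 0)) (by fun_prop) (by fun_prop)
      (fun t v => by
        have h2 : HasDerivAt (fun t : ℝ => (t • a, v)) (a, (0 : E n)) t := by
          refine HasDerivAt.prodMk ?_ (hasDerivAt_const t v)
          simpa using (hasDerivAt_id t).smul_const a
        exact (hHd _).comp_hasDerivAt t h2) t
    refine h1.congr_deriv ?_
    simp_rw [hol]
    rw [integral_const_mul, hzero, mul_zero]
  have := is_const_of_deriv_eq_zero (fun t => (hd t).differentiableAt) (fun t => (hd t).deriv) 1 0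
  simpa using this

/-- A function that is periodic in `v` and holomorphic in `v + ia` is a rapidly converging Fourier
series. -/
theorem exists_theta {h : E n × E n → ℂ} (hh : ContDiff ℝ 1 h)
    (hp : ∀ a v (k : Fin n → ℤ), h (a, v + fun i => (k i : ℝ)) = h (a, v))
    (hol : ∀ z u, fderiv ℝ h z (u, 0) = Complex.I * fderiv ℝ h z (0, u)) :
    ∃ c, RapidSeq c ∧ h = theta c := by
  have hhc := hh.continuous
  choose g hg using fun a => exists_torus_lift (f := fun v => h (a, v)) (by fun_prop) (hp a)
  -- `h e^{-2πi⟨m, v + ia⟩}` is again periodic and holomorphic, so its mean `c m` does not depend on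
  -- `a`. Hence the `m`-th Fourier coefficient of `h(a, ·)` is c_m e^{-2π⟨m,a⟩}.
  let H : (Fin n → ℤ) → E n × E n → ℂ := fun m z => h z * Complex.exp (-expLin m z)
  have hHper : ∀ m a v (k : Fin n → ℤ), H m (a, v + fun i => (k i : ℝ)) = H m (a, v) := by
    intro m a v k
    simp only [H, hp]
    congr 1
    obtain ⟨l, hl⟩ := intCov_int m (v := fun i => (k i : ℝ)) fun j => ⟨k j, rfl⟩
    rw [expLin_apply, expLin_apply, map_add, hl, Complex.exp_eq_exp_iff_exists_int]
    refine ⟨-l, ?_⟩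
    push_cast
    ring
  have hHd : ∀ m z, HasFDerivAt (H m) (h z • (Complex.exp (-expLin m z) • -(expLin m))
      + Complex.exp (-expLin m z) • fderiv ℝ h z) z := fun m z =>
    (hh.differentiable (by simp) z).hasFDerivAt.mul ((expLin m).hasFDerivAt.neg.cexp)
  have hHol : ∀ m z u, fderiv ℝ (H m) z (u, 0) = Complex.I * fderiv ℝ (H m) z (0, u) := by
    intro m z u
    rw [(hHd m z).fderiv]
    generalize Complex.exp (-expLin m z) = ex
    simp only [add_apply, smul_apply, neg_apply, hol, smul_eq_mul, expLin_apply,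
      map_zero, Complex.ofReal_zero, mul_zero, zero_sub, sub_zero]
    linear_combination (2 * h z * ex * Real.pi * intCov m u) * Complex.I_sq
  have hHs : ∀ m, ContDiff ℝ 1 (H m) := fun m => hh.mul ((expLin m).contDiff.neg.cexp)
  let c : (Fin n → ℤ) → ℂ := fun m => ∫ v in cube 0, H m (0, v)
  have hc : ∀ a m, UnitAddTorus.mFourierCoeff (g a) m
      = c m * Complex.exp (-(2 * Real.pi * intCov m a : ℝ)) := by
    intro a m
    have h1 : c m = ∫ v in cube 0, H m (a, v) :=
      (integral_cube_const (hHs m) (hHper m) (hHol m) a).symm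
    rw [UnitAddTorus.mFourierCoeff_eq_integral _ _ 0, h1, ← integral_mul_const]
    refine integral_congr_ae (Eventually.of_forall fun v => ?_)
    change UnitAddTorus.mFourier (-m) (torusMk v) • g a (torusMk v) = _
    rw [hg, mFourier_torusMk, smul_eq_mul]
    simp only [H]
    rw [mul_assoc (h (a, v)), ← Complex.exp_add, mul_comm, expLin_apply, intCov_neg]
    congr 2
    simp
    ring
  -- Fourier coefficients are bounded by the sup norm of the function; using this at every height
  -- `a` forces rapid decay.
  have hrapid : RapidSeq c := by
    refine rapidSeq_of_bounded fun a => ⟨‖g a‖, fun m => ?_⟩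
    have h1 : ‖UnitAddTorus.mFourierCoeff (g a) m‖ ≤ ‖g a‖ := by
      unfold UnitAddTorus.mFourierCoeff
      refine (norm_integral_le_of_norm_le_const (C := ‖g a‖) (Eventually.of_forall fun θ => ?_)).trans
        (by simp)
      rw [norm_smul]
      have h2 := (UnitAddTorus.mFourier (-m)).norm_coe_le_norm θ
      rw [UnitAddTorus.mFourier_norm] at h2
      calc _ ≤ 1 * ‖g a‖ := mul_le_mul h2 ((g a).norm_coe_le_norm θ) (norm_nonneg _) zero_le_one
        _ = ‖g a‖ := one_mul _
    rw [hc, norm_mul, Complex.norm_exp] at h1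
    simpa using h1
  refine ⟨c, hrapid, funext fun z => ?_⟩
  obtain ⟨a, v⟩ := z
  have hterm : ∀ m, c m * Complex.exp (expLin m (a, v)) =
      UnitAddTorus.mFourierCoeff (g a) m • UnitAddTorus.mFourier m (torusMk v) := by
    intro m
    rw [hc, mFourier_torusMk, smul_eq_mul, mul_assoc, ← Complex.exp_add, expLin_apply]
    congr 2
    push_cast
    ring
  have hsum : Summable (UnitAddTorus.mFourierCoeff (g a)) := by
    obtain ⟨u, hu, hcu⟩ := hrapid.exists_bound (2 * Real.pi * n * ‖a‖)
    refine Summable.of_norm_bounded hu fun m => ?_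
    rw [hc, norm_mul]
    refine (mul_le_mul_of_nonneg_left ?_ (norm_nonneg _)).trans (hcu m)
    have := norm_exp_expLin_le m (a, v)
    rw [norm_exp_expLin] at this
    rw [Complex.norm_exp]
    simpa using this
  have := UnitAddTorus.hasSum_mFourier_series_apply_of_summable hsum (torusMk v)
  rw [hg] at this
  rw [← this.tsum_eq, theta]
  exact tsum_congr fun m => (hterm m).symm

end Fourier

/-! ### Derivative bounds for exponentials -/

section Estimates

variable {n : ℕ}

theorem norm_intCov_le (m : Fin n → ℤ) : ‖intCov m‖ ≤ n * ‖m‖ :=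
  ContinuousLinearMap.opNorm_le_bound _ (by positivity) fun v => abs_intCov_le m v

theorem norm_iteratedFDeriv_exp_clm_le (L : Dual n) (l : ℕ) (a : E n) :
    ‖iteratedFDeriv ℝ l (fun z => Real.exp (L z)) a‖ ≤ ‖L‖ ^ l * Real.exp (L a) := by
  have h := L.iteratedFDeriv_comp_right (n := ∞) Real.contDiff_exp a (i := l)
    (by exact_mod_cast le_top)
  change iteratedFDeriv ℝ l (fun z => Real.exp (L z)) a = _ at h
  rw [h]
  refine (ContinuousMultilinearMap.norm_compContinuousLinearMap_le _ _).trans ?_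
  rw [norm_iteratedFDeriv_eq_norm_iteratedDeriv, iteratedDeriv_eq_iterate, Real.iter_deriv_exp]
  simp [mul_comm, abs_of_pos (Real.exp_pos _)]

/-- The derivatives of `e^{-2π⟨m, ·⟩} G` grow at most exponentially in `m`. -/
theorem exists_iteratedFDeriv_bound {G : E n → ℂ} (hG : ContDiff ℝ ∞ G) {K : Set (E n)}
    (hK : IsCompact K) (l : ℕ) : ∃ M R : ℝ, 0 ≤ M ∧ ∀ m : Fin n → ℤ, ∀ a ∈ K,
      ‖iteratedFDeriv ℝ l (fun z => Real.exp (-(2 * Real.pi * intCov m z)) • G z) a‖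
        ≤ M * Real.exp (R * ‖m‖) := by
  have h1 : ∀ i : ℕ, ∃ C, ∀ a ∈ K, ‖iteratedFDeriv ℝ i G a‖ ≤ C := fun i =>
    hK.exists_bound_of_continuousOn
      (hG.continuous_iteratedFDeriv (m := i) (by exact_mod_cast le_top)).continuousOn
  choose C hC using h1
  obtain ⟨C₀, hC₀⟩ := hK.exists_bound_of_continuousOn (continuous_id (X := E n)).continuousOn
  -- `q‖m‖` bounds the norm of the linear form in the exponent. In the rate, `l * q` comes from at
  -- most `l` derivatives of the exponential and `q * |C₀|` from its size on `K`; the Leibniz rule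
  -- supplies the binomials.
  set q : ℝ := 2 * Real.pi * n with hq
  have hq0 : 0 ≤ q := by positivity
  refine ⟨∑ i ∈ Finset.range (l + 1), (l.choose i : ℝ) * |C (l - i)|, l * q + q * |C₀|,
    by positivity, fun m a ha => ?_⟩
  let L : Dual n := -((2 * Real.pi) • intCov m)
  have hL : (fun z => Real.exp (-(2 * Real.pi * intCov m z))) = fun z => Real.exp (L z) := by
    ext z; simp [L]
  have hLn : ‖L‖ ≤ q * ‖m‖ := by
    rw [norm_neg, norm_smul, Real.norm_of_nonneg (by positivity), hq, mul_assoc (2 * Real.pi)]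
    gcongr
    exact norm_intCov_le m
  have hLa : L a ≤ q * |C₀| * ‖m‖ := by
    calc L a ≤ ‖L‖ * ‖a‖ := (le_abs_self _).trans (L.le_opNorm a)
      _ ≤ q * ‖m‖ * |C₀| := by
          gcongr
          exact (hC₀ a ha).trans (le_abs_self _)
      _ = q * |C₀| * ‖m‖ := by ring
  have hpow : ∀ i ∈ Finset.range (l + 1), ‖L‖ ^ i ≤ Real.exp (l * q * ‖m‖) := by
    intro i hi
    have hi : i ≤ l := Nat.lt_succ_iff.1 (Finset.mem_range.1 hi)
    calc ‖L‖ ^ i ≤ Real.exp (q * ‖m‖) ^ i := by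
          gcongr
          linarith [Real.add_one_le_exp (q * ‖m‖)]
      _ ≤ Real.exp (q * ‖m‖) ^ l :=
          pow_le_pow_right₀ (Real.one_le_exp (by positivity)) hi
      _ = Real.exp (l * q * ‖m‖) := by rw [← Real.exp_nat_mul]; congr 1; ring
  refine (norm_iteratedFDeriv_smul_le (𝕜 := ℝ) (N := ∞)
    (f := fun z => Real.exp (-(2 * Real.pi * intCov m z))) (g := G)
    (by fun_prop) hG a (by exact_mod_cast le_top)).trans ?_
  rw [Finset.sum_mul]
  refine Finset.sum_le_sum fun i hi => ?_
  rw [hL]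
  have h2 : ‖iteratedFDeriv ℝ i (fun z => Real.exp (L z)) a‖
      ≤ Real.exp ((l * q + q * |C₀|) * ‖m‖) := by
    refine (norm_iteratedFDeriv_exp_clm_le L i a).trans ?_
    calc ‖L‖ ^ i * Real.exp (L a)
        ≤ Real.exp (l * q * ‖m‖) * Real.exp (q * |C₀| * ‖m‖) :=
          mul_le_mul (hpow i hi) (Real.exp_le_exp.2 hLa) (Real.exp_pos _).le (Real.exp_pos _).le
      _ = _ := by rw [← Real.exp_add]; congr 1; ring
  have h3 : ‖iteratedFDeriv ℝ (l - i) G a‖ ≤ |C (l - i)| := (hC _ a ha).trans (le_abs_self _)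
  calc _ ≤ (l.choose i : ℝ) * Real.exp ((l * q + q * |C₀|) * ‖m‖) * |C (l - i)| := by gcongr
    _ = _ := by ring

theorem finite_setOf_norm_le (R : ℝ) : {m : Fin n → ℤ | ‖m‖ ≤ R}.Finite := by
  simpa [Metric.closedBall] using (isCompact_closedBall (0 : Fin n → ℤ) R).finite_of_discrete

end Estimates

/-! ### Compact fundamental domains and comparison of norms -/

section Metric

variable {n : ℕ} {B : Type*} [TopologicalSpace B] [ChartedSpace (E n) B]

theorem Development.exists_fundamentalDomain [CompactSpace B] (δ : Development B n) :
    ∃ K : Set (E n), IsCompact K ∧ ∀ x, ∃ a ∈ K, δ.p a = x := by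
  obtain ⟨t, ht⟩ := isCompact_univ.elim_finite_subcover
    (fun N : ℕ => δ.p '' Metric.ball 0 N)
    (fun N => δ.cov.isLocalHomeomorph.isOpenMap _ Metric.isOpen_ball) (by
      intro x _
      obtain ⟨a, rfl⟩ := δ.surj x
      obtain ⟨N, hN⟩ := exists_nat_gt ‖a‖
      exact mem_iUnion.2 ⟨N, a, by simpa using hN, rfl⟩)
  refine ⟨⋃ N ∈ t, Metric.closedBall 0 N,
    t.isCompact_biUnion fun N _ => isCompact_closedBall 0 _, fun x => ?_⟩
  obtain ⟨N, hN, a, ha, rfl⟩ := by simpa using ht (mem_univ x)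
  exact ⟨a, by simpa using ⟨N, hN, ha.le⟩, rfl⟩

variable [HasGroupoid B (specialIntegralAffineGroupoid n)] {g : RiemMetric n B} {ι : Type*}
  {Φ : IntegralPotentials g ι} {δ : Development B n}

namespace GlobalPotential

/-- The metric is the continuous Hessian of `f`, so it has a positive minimum `κ` on the product of
`K` and the unit sphere; then `C = κ^{-1/2}`. -/
theorem exists_norm_le (σ : GlobalPotential Φ δ) {K : Set (E n)} (hK : IsCompact K) : ∃ C : ℝ, 0 < C ∧
    ∀ a ∈ K, ∀ w : E n, g.inner (δ.p a) (δ.D a w) (δ.D a w) ≤ 1 → ‖w‖ ≤ C := by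
  let T : Set (E n × E n) := K ×ˢ Metric.sphere 0 1
  have hT : IsCompact T := hK.prod (isCompact_sphere 0 1)
  let q : E n × E n → ℝ := fun z => fderiv ℝ σ.Y z.1 z.2 z.2
  have hq : Continuous q := by
    have h1 : Continuous fun z : E n × E n => fderiv ℝ σ.Y z.1 :=
      (σ.contDiff_Y.continuous_fderiv (by simp)).comp continuous_fst
    exact (h1.clm_apply continuous_snd).clm_apply continuous_snd
  have hpos : ∀ z ∈ T, 0 < q z := by
    rintro ⟨a, w⟩ ⟨-, hw⟩
    simp only [q]
    rw [σ.hessian]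
    refine g.pos _ _ fun h0 => ?_
    have hw0 : w = 0 := (δ.D a).map_eq_zero_iff.1 h0
    simp [hw0] at hw
  obtain ⟨κ, hκ, hle⟩ : ∃ κ, 0 < κ ∧ ∀ z ∈ T, κ ≤ q z := by
    -- `T` can be empty, for instance for `n = 0`, and then any positive `κ` will do.
    rcases T.eq_empty_or_nonempty with h | h
    · exact ⟨1, one_pos, by simp [h]⟩
    · obtain ⟨z₀, hz₀, hmin⟩ := hT.exists_isMinOn h hq.continuousOn
      exact ⟨q z₀, hpos z₀ hz₀, fun z hz => hmin hz⟩
  refine ⟨Real.sqrt (1 / κ), by positivity, fun a ha w hw => ?_⟩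
  apply Real.le_sqrt_of_sq_le
  rw [le_div_iff₀ hκ]
  refine le_trans ?_ hw
  by_cases hw0 : w = 0
  · simp [hw0]
  have hn : 0 < ‖w‖ := norm_pos_iff.2 hw0
  have h1 := hle (a, ‖w‖⁻¹ • w) ⟨ha, by simp [norm_smul, hn.ne']⟩
  simp only [q, map_smul, smul_apply, smul_eq_mul] at h1
  rw [σ.hessian] at h1
  rw [← mul_assoc, ← mul_inv, inv_mul_eq_div, le_div_iff₀ (by positivity)] at h1
  linarith [pow_two ‖w‖]

/-- The bound on the unit ball of the metric makes the set in `cotNorm` bounded above, which the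
supremum needs to dominate its members. -/
theorem cotNorm_le {C : ℝ} {a : E n}
    (h : ∀ w : E n, g.inner (δ.p a) (δ.D a w) (δ.D a w) ≤ 1 → ‖w‖ ≤ C) (η : Dual n) :
    (∀ w : E n, g.inner (δ.p a) (δ.D a w) (δ.D a w) ≤ 1 →
      |η w| ≤ Φ.cotNorm (δ.p a) (δ.push a η)) ∧ Φ.cotNorm (δ.p a) (δ.push a η) ≤ C * ‖η‖ := by
  have hb : ∀ c ∈ {c | ∃ v : Tan n (δ.p a), g.inner (δ.p a) v v ≤ 1 ∧ c = |δ.push a η v|},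
      c ≤ C * ‖η‖ := by
    rintro c ⟨v, hv, rfl⟩
    obtain ⟨w, rfl⟩ := (δ.D a).surjective v
    rw [δ.push_apply_D, mul_comm]
    exact (η.le_opNorm w).trans (mul_le_mul_of_nonneg_left (h w hv) (norm_nonneg _))
  constructor
  · intro w hw
    exact le_csSup ⟨_, hb⟩ ⟨δ.D a w, hw, by rw [δ.push_apply_D]⟩
  · refine csSup_le ⟨0, 0, by simp, by simp⟩ hb

/-- Testing the covector on basis vectors of `g`-length one bounds every coordinate of `m`. So the
decay condition over a point controls all but finitely many sheets. -/
theorem finite_cotNorm_le (σ : GlobalPotential Φ δ) (a : E n) (R : ℝ) :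
    {m : Fin n → ℤ | Φ.cotNorm (δ.p a) (δ.push a (σ.Y a + intCov m)) ≤ R}.Finite := by
  obtain ⟨C, -, hC⟩ := σ.exists_norm_le (isCompact_singleton (x := a))
  let s : Fin n → ℝ := fun j => g.inner (δ.p a) (δ.D a (Pi.single j 1)) (δ.D a (Pi.single j 1))
  have hs : ∀ j, 0 < s j := fun j => g.pos _ _ fun h0 => by
    have := congrFun ((δ.D a).map_eq_zero_iff.1 h0) j
    simp at this
  obtain ⟨r, hr⟩ : ∃ r : ℝ, ∀ j, Real.sqrt (s j) * |R| + |σ.Y a (Pi.single j 1)| ≤ r := by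
    refine ⟨∑ j, (Real.sqrt (s j) * |R| + |σ.Y a (Pi.single j 1)|), fun j => ?_⟩
    exact Finset.single_le_sum (f := fun j => Real.sqrt (s j) * |R| + |σ.Y a (Pi.single j 1)|)
      (fun i _ => by positivity) (Finset.mem_univ j)
  refine (finite_setOf_norm_le (max r 0)).subset fun m hm => ?_
  refine (pi_norm_le_iff_of_nonneg (le_max_right _ _)).2 fun j => ?_
  refine le_trans ?_ (le_max_left _ _)
  refine le_trans ?_ (hr j)
  have hsj : 0 < Real.sqrt (s j) := Real.sqrt_pos.2 (hs j)
  have h1 := (cotNorm_le (Φ := Φ) (fun w => hC a rfl w) (σ.Y a + intCov m)).1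
    ((Real.sqrt (s j))⁻¹ • Pi.single j 1) (by
      simp only [map_smul, smul_apply, smul_eq_mul]
      change (Real.sqrt (s j))⁻¹ * ((Real.sqrt (s j))⁻¹ * s j) ≤ 1
      rw [← mul_assoc, ← mul_inv, Real.mul_self_sqrt (hs j).le, inv_mul_cancel₀ (hs j).ne'])
  rw [map_smul, smul_eq_mul, abs_mul, abs_of_pos (inv_pos.2 hsj), inv_mul_eq_div,
    div_le_iff₀ hsj] at h1
  have h2 : |(m j : ℝ)| ≤ |(σ.Y a + intCov m) (Pi.single j 1)| + |σ.Y a (Pi.single j 1)| := by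
    have : (m j : ℝ) = (σ.Y a + intCov m) (Pi.single j 1) - σ.Y a (Pi.single j 1) := by
      rw [add_apply, intCov_single]; ring
    rw [this]
    exact abs_sub _ _
  rw [Int.norm_eq_abs]
  have hm' : Φ.cotNorm (δ.p a) (δ.push a (σ.Y a + intCov m)) ≤ |R| := hm.trans (le_abs_self R)
  nlinarith

end GlobalPotential

end Metric

/-! ### The Witten kernel as sequences of rapidly decaying coefficients -/

section Witten

variable {n : ℕ} {B : Type*} [TopologicalSpace B] [ChartedSpace (E n) B]

/-- A family of functions on the cotangent spaces as a function on the cotangent bundle. -/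
def total {F : Type*} (α : (x : B) → Cot n x → F) (q : CotangentBundle n B) : F := α q.1 q.2

variable [HasGroupoid B (specialIntegralAffineGroupoid n)] {g : RiemMetric n B} {ι : Type*}
  {Φ : IntegralPotentials g ι} {δ : Development B n}

theorem IntegralPotentials.onSheet_apply {F : Type*} (α : (x : B) → Cot n x → F) {i : ι}
    (k : Fin n → ℤ) {x : B} (hx : x ∈ (Φ.chart i).source) :
    Φ.onSheet α i k (Φ.chart i x) = α x (Φ.sheet i k x) := by
  unfold IntegralPotentials.onSheet
  rw [(Φ.chart i).left_inv hx]

namespace GlobalPotential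

variable (σ : GlobalPotential Φ δ)

/-- A dictionary between sheets over a chart and global sheets. The affine change `(A, b)` and the
shift `m` serve all labels `k` at once, and `k` corresponds to the global label `covAct k A - m`. -/
theorem exists_onSheet (a : E n) (i : ι) (ha : δ.p a ∈ (Φ.chart i).source) :
    ∃ (A : Matrix.SpecialLinearGroup (Fin n) ℤ) (b : E n) (m : Fin n → ℤ),
      Φ.chart i (δ.p a) = slEquiv A a + b ∧
      (∀ u : E n, chartDiff n (Φ.chart i) (δ.p a) (δ.D a u) = slEquiv A u) ∧
      ∀ k, Φ.sheet i k (δ.p a) = δ.push a (σ.Y a + intCov (covAct k A - m)) ∧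
        (∀ u : E n, Φ.dArea i k (slEquiv A a + b) (slEquiv A u)
          = (σ.Y a + intCov (covAct k A - m)) u) ∧
        ∀ {F : Type} (α : (x : B) → Cot n x → F),
          Φ.onSheet α i k =ᶠ[𝓝 (slEquiv A a + b)] fun w =>
            total α (σ.S (covAct k A - m) ((slEquiv A).symm (w - b))) := by
  obtain ⟨A, b, m, c, h⟩ := σ.exists_local a i ha
  have h0 := h.self_of_nhds
  refine ⟨A, b, m, h0.2.1, h0.2.2.2.2.1, fun k => ⟨h0.2.2.2.2.2.1 k, h0.2.2.2.2.2.2 k,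
    fun α => ?_⟩⟩
  have hc : Tendsto (fun w => (slEquiv A).symm (w - b)) (𝓝 (slEquiv A a + b)) (𝓝 a) := by
    have : Continuous fun w => (slEquiv A).symm (w - b) := by fun_prop
    simpa using this.tendsto (slEquiv A a + b)
  filter_upwards [hc.eventually h] with w hw
  have h1 : Φ.chart i (δ.p ((slEquiv A).symm (w - b))) = w := by
    rw [hw.2.1]; simp
  conv_lhs => rw [← h1]
  rw [Φ.onSheet_apply α k hw.1, hw.2.2.2.2.2.1 k]
  rfl

theorem contDiff_f : ContDiff ℝ ∞ σ.f := by
  have h : fderiv ℝ σ.f = σ.Y := funext fun a => (σ.hasFDerivAt a).fderiv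
  exact contDiff_infty_iff_fderiv.2
    ⟨fun a => (σ.hasFDerivAt a).differentiableAt, h ▸ σ.contDiff_Y⟩

/-- `α` is supported on the path space and equals `c m e^{-2πψ}` on the sheet with label `m`. -/
def IsWittenSum (c : (Fin n → ℤ) → ℂ) (α : (x : B) → Cot n x → ℂ) : Prop :=
  (∀ x y, (⟨x, y⟩ : CotangentBundle n B) ∉ Φ.pathSpace → α x y = 0) ∧
    ∀ m a, total α (σ.S m a) = c m * Complex.exp (-(2 * Real.pi * σ.ψ m a : ℝ))

variable {σ} {c : (Fin n → ℤ) → ℂ} {α : (x : B) → Cot n x → ℂ}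

theorem hasFDerivAt_exp_ψ (σ : GlobalPotential Φ δ) (s : ℝ) (m : Fin n → ℤ) (a : E n) :
    HasFDerivAt (fun z => Complex.exp ((s * σ.ψ m z : ℝ)))
      (Complex.exp ((s * σ.ψ m a : ℝ)) •
        Complex.ofRealCLM.comp (s • (σ.Y a + intCov m))) a := by
  have h1 := (σ.hasFDerivAt_ψ m a).const_mul s
  exact (Complex.ofRealCLM.hasFDerivAt.comp a h1).cexp

theorem hasFDerivAt_total (hα : α ∈ Φ.wittenKernel) (m : Fin n → ℤ) (a : E n) :
    HasFDerivAt (fun z => total α (σ.S m z))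
      ((-(2 * Real.pi) * total α (σ.S m a)) • Complex.ofRealCLM.comp (σ.Y a + intCov m)) a := by
  obtain ⟨i, hi⟩ := Φ.cover (δ.p a)
  obtain ⟨A, b, m', hb, -, h⟩ := σ.exists_onSheet a i hi
  -- The label in the chart whose global label is the given `m`.
  obtain ⟨-, h2, h3⟩ := h (covAct (m + m') A⁻¹)
  have hmm : covAct (covAct (m + m') A⁻¹) A - m' = m := by rw [covAct_inv]; abel
  rw [hmm] at h2 h3
  set k := covAct (m + m') A⁻¹
  have ht : slEquiv A a + b ∈ (Φ.chart i).target := hb ▸ (Φ.chart i).map_source hi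
  have h4 := (Φ.contDiffAt_onSheet hα.1.1 i k ht 1).differentiableAt (by norm_num)
  have hA : HasFDerivAt (fun z => slEquiv A z + b) (slEquiv A : E n →L[ℝ] E n) a :=
    (slEquiv A).hasFDerivAt.add_const b
  have h5 := HasFDerivAt.comp a h4.hasFDerivAt hA
  have h6 : Φ.onSheet α i k ∘ (fun z => slEquiv A z + b) =ᶠ[𝓝 a]
      fun z => total α (σ.S m z) := by
    filter_upwards [hA.continuousAt.eventually (h3 α)] with z hz
    simpa using hz
  refine (h5.congr_of_eventuallyEq h6.symm).congr_fderiv ?_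
  ext u
  have h7 := hα.2 i k _ ht (slEquiv A u)
  rw [h2 u] at h7
  have h8 : Φ.onSheet α i k (slEquiv A a + b) = total α (σ.S m a) := h6.self_of_nhds
  rw [h8] at h7
  simp only [ContinuousLinearMap.comp_apply, smul_apply, smul_eq_mul, Complex.ofRealCLM_apply,
    ContinuousLinearEquiv.coe_coe]
  linear_combination h7

/-- On each sheet `α e^{2πψ}` has zero derivative, so it is a constant c_m. Rapid decay over the
single point `p a`, without weight or derivatives, bounds |α| over all sheets at `a`; as `a` is
arbitrary, `rapidSeq_of_bounded` applies. -/
theorem exists_isWittenSum (σ : GlobalPotential Φ δ) (hα : α ∈ Φ.wittenKernel) :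
    ∃ c, RapidSeq c ∧ σ.IsWittenSum c α := by
  let c : (Fin n → ℤ) → ℂ := fun m =>
    total α (σ.S m 0) * Complex.exp ((2 * Real.pi * σ.ψ m 0 : ℝ))
  have hform : ∀ m a, total α (σ.S m a) = c m * Complex.exp (-(2 * Real.pi * σ.ψ m a : ℝ)) := by
    intro m a
    have hd : ∀ z, HasFDerivAt (fun z => total α (σ.S m z) *
        Complex.exp ((2 * Real.pi * σ.ψ m z : ℝ))) (0 : E n →L[ℝ] ℂ) z := by
      intro z
      refine ((hasFDerivAt_total (σ := σ) hα m z).mul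
        (σ.hasFDerivAt_exp_ψ (2 * Real.pi) m z)).congr_fderiv ?_
      ext u
      simp
      ring
    have h := is_const_of_fderiv_eq_zero (𝕜 := ℝ) (fun x => (hd x).differentiableAt)
      (fun x => (hd x).fderiv) 0 a
    simp only [c]
    rw [h, mul_assoc, ← Complex.exp_add]
    simp
  refine ⟨c, rapidSeq_of_bounded fun a => ?_, hα.1.1.1, hform⟩
  obtain ⟨R, hR⟩ := hα.1.2 {δ.p a} isCompact_singleton 0 0 1 one_pos
  obtain ⟨i, hi⟩ := Φ.cover (δ.p a)
  obtain ⟨A, b, m', hb, -, hloc⟩ := σ.exists_onSheet a i hi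
  have hfin := (σ.finite_cotNorm_le a R).image fun m => ‖total α (σ.S m a)‖
  obtain ⟨M, hM⟩ := hfin.bddAbove
  refine ⟨max M 1 * Real.exp (2 * Real.pi * σ.f a), fun m => ?_⟩
  have hnorm : ‖total α (σ.S m a)‖ =
      ‖c m‖ * Real.exp (-(2 * Real.pi * intCov m a)) * Real.exp (-(2 * Real.pi * σ.f a)) := by
    rw [hform, norm_mul, Complex.norm_exp, ← Complex.ofReal_neg, Complex.ofReal_re,
      mul_assoc ‖c m‖, ← Real.exp_add, ψ]
    congr 2
    ring
  have hle : ‖total α (σ.S m a)‖ ≤ max M 1 := by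
    by_cases hm : Φ.cotNorm (δ.p a) (δ.push a (σ.Y a + intCov m)) ≤ R
    · exact le_max_of_le_left (hM ⟨m, hm, rfl⟩)
    · have hmm : covAct (covAct (m + m') A⁻¹) A - m' = m := by rw [covAct_inv]; abel
      obtain ⟨h1, -, -⟩ := hloc (covAct (m + m') A⁻¹)
      rw [hmm] at h1
      have h2 := hR i (covAct (m + m') A⁻¹) (δ.p a) rfl hi (by rw [h1]; exact not_le.1 hm)
        (fun j => j.elim0) (fun j => j.elim0)
      rw [pow_zero, one_mul, iteratedFDeriv_zero_apply, Φ.onSheet_apply _ _ hi, h1] at h2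
      exact le_max_of_le_right h2
  rw [hnorm] at hle
  calc _ = ‖c m‖ * Real.exp (-(2 * Real.pi * intCov m a)) * Real.exp (-(2 * Real.pi * σ.f a))
        * Real.exp (2 * Real.pi * σ.f a) := by
        rw [mul_assoc (_ * _), ← Real.exp_add]; simp
    _ ≤ _ := by gcongr

theorem IsWittenSum.mem_smoothFunctions (h : σ.IsWittenSum c α) : α ∈ Φ.smoothFunctions := by
  refine ⟨h.1, fun i k t ht => ContDiffAt.contDiffWithinAt ?_⟩
  obtain ⟨a, ha⟩ := δ.surj ((Φ.chart i).symm t)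
  have hi : δ.p a ∈ (Φ.chart i).source := ha ▸ (Φ.chart i).map_target ht
  obtain ⟨A, b, m, hb, -, hloc⟩ := σ.exists_onSheet a i hi
  have ht' : t = slEquiv A a + b := by rw [← hb, ha, (Φ.chart i).right_inv ht]
  rw [ht']
  refine ContDiffAt.congr_of_eventuallyEq ?_ ((hloc k).2.2 α)
  simp only [h.2]
  have h1 : ContDiff ℝ ∞ (σ.ψ (covAct k A - m)) := σ.contDiff_f.add (intCov _).contDiff
  have h2 : ContDiff ℝ ∞ fun w => σ.ψ (covAct k A - m) ((slEquiv A).symm (w - b)) :=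
    h1.comp (by fun_prop)
  exact (contDiff_const.mul (Complex.contDiff_exp.comp (Complex.ofRealCLM.contDiff.comp
    (contDiff_const.mul h2)).neg)).contDiffAt

theorem IsWittenSum.witten_eq (h : σ.IsWittenSum c α) (i : ι) (k : Fin n → ℤ) {t : E n}
    (ht : t ∈ (Φ.chart i).target) (u : E n) :
    fderiv ℝ (Φ.onSheet α i k) t u
      + 2 * Real.pi * (Φ.dArea i k t u : ℂ) * Φ.onSheet α i k t = 0 := by
  obtain ⟨a, ha⟩ := δ.surj ((Φ.chart i).symm t)
  have hi : δ.p a ∈ (Φ.chart i).source := ha ▸ (Φ.chart i).map_target ht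
  obtain ⟨A, b, m, hb, -, hloc⟩ := σ.exists_onSheet a i hi
  have ht' : t = slEquiv A a + b := by rw [← hb, ha, (Φ.chart i).right_inv ht]
  subst ht'
  obtain ⟨v, rfl⟩ := (slEquiv A).surjective u
  obtain ⟨-, h2, h3⟩ := hloc k
  rw [h2 v, (h3 α).fderiv_eq, (h3 α).self_of_nhds]
  have h4 := (σ.hasFDerivAt_exp_ψ (-(2 * Real.pi)) (covAct k A - m) a).const_mul
    (c (covAct k A - m))
  have h5 : HasFDerivAt (fun w => (slEquiv A).symm (w - b))
      ((slEquiv A).symm : E n →L[ℝ] E n) (slEquiv A a + b) :=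
    (slEquiv A).symm.hasFDerivAt.comp _ ((hasFDerivAt_id _).sub_const b)
  have h6 : (slEquiv A).symm (slEquiv A a + b - b) = a := by simp
  have h7 := HasFDerivAt.comp (slEquiv A a + b) (by rw [h6]; exact h4) h5
  have h8 : (fun w => total α (σ.S (covAct k A - m) ((slEquiv A).symm (w - b)))) =
      (fun z => c (covAct k A - m) *
        Complex.exp ((-(2 * Real.pi) * σ.ψ (covAct k A - m) z : ℝ))) ∘
          fun w => (slEquiv A).symm (w - b) := by
    ext w
    simp [h.2]
  beta_reduce
  rw [h6, h.2, h8, h7.fderiv]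
  simp
  ring

theorem IsWittenSum.iteratedFDeriv_eq (h : σ.IsWittenSum c α) {i : ι} {a : E n}
    (hi : δ.p a ∈ (Φ.chart i).source) (k : Fin n → ℤ) (l : ℕ) :
    ∃ m, Φ.sheet i k (δ.p a) = δ.push a (σ.Y a + intCov m) ∧
      ∀ w : Fin l → E n, iteratedFDeriv ℝ l (Φ.onSheet α i k) (Φ.chart i (δ.p a))
        (fun j => chartDiff n (Φ.chart i) (δ.p a) (δ.D a (w j))) =
          iteratedFDeriv ℝ l (fun z => Real.exp (-(2 * Real.pi * intCov m z)) •
            (c m * Complex.exp (-(2 * Real.pi * σ.f z : ℝ)))) a w := by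
  obtain ⟨A, b, m, hb, hD, hloc⟩ := σ.exists_onSheet a i hi
  obtain ⟨h1, -, h3⟩ := hloc k
  refine ⟨_, h1, fun w => ?_⟩
  set m' := covAct k A - m
  set G : E n → ℂ := fun z => Real.exp (-(2 * Real.pi * intCov m' z)) •
    (c m' * Complex.exp (-(2 * Real.pi * σ.f z : ℝ)))
  have hG : ContDiff ℝ ∞ G := by
    have h1 : ContDiff ℝ ∞ fun z => Real.exp (-(2 * Real.pi * intCov m' z)) := by fun_prop
    exact h1.smul (contDiff_const.mul (Complex.contDiff_exp.comp (Complex.ofRealCLM.contDiff.comp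
      (contDiff_const.mul σ.contDiff_f)).neg))
  have h4 : (fun w => total α (σ.S m' ((slEquiv A).symm (w - b)))) =
      fun w => (G ∘ (slEquiv A).symm) (w - b) := by
    ext w
    simp only [h.2, G, Function.comp_apply, ψ, Complex.real_smul]
    rw [mul_left_comm, Complex.ofReal_exp, ← Complex.exp_add]
    congr 2
    push_cast
    ring
  rw [hb, ((h3 α).iteratedFDeriv ℝ l).self_of_nhds, h4, iteratedFDeriv_comp_sub]
  have h5 := ((slEquiv A).symm : E n →L[ℝ] E n).iteratedFDeriv_comp_right hG
    (slEquiv A a + b - b) (i := l) (by exact_mod_cast le_top)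
  change iteratedFDeriv ℝ l (G ∘ (slEquiv A).symm) _ = _ at h5
  rw [h5, ContinuousMultilinearMap.compContinuousLinearMap_apply]
  simp [hD]

/-- Every point of B has a lift in a compact set, where covector norms grow linearly and derivatives
at most exponentially in ‖m‖. Super-exponential decay of `c` wins, uniformly over B. -/
theorem IsWittenSum.mem_wittenKernel [CompactSpace B] (h : σ.IsWittenSum c α) (hc : RapidSeq c) :
    α ∈ Φ.wittenKernel := by
  refine ⟨⟨h.mem_smoothFunctions, fun K _ k l ε hε => ?_⟩,
    fun i m t ht u => h.witten_eq i m ht u⟩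
  obtain ⟨D, hD, hDs⟩ := δ.exists_fundamentalDomain
  obtain ⟨C, hC, hCD⟩ := σ.exists_norm_le hD
  have hf : ContDiff ℝ ∞ fun z => Complex.exp (-(2 * Real.pi * σ.f z : ℝ)) :=
    Complex.contDiff_exp.comp (Complex.ofRealCLM.contDiff.comp
      (contDiff_const.mul σ.contDiff_f)).neg
  obtain ⟨M, R, hM, hMR⟩ := exists_iteratedFDeriv_bound hf hD l
  obtain ⟨Y₀, hY₀⟩ := hD.exists_bound_of_continuousOn σ.contDiff_Y.continuous.continuousOn
  have hcot : ∀ a ∈ D, ∀ m, Φ.cotNorm (δ.p a) (δ.push a (σ.Y a + intCov m))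
      ≤ C * (|Y₀| + n * ‖m‖) := fun a ha m => by
    refine (cotNorm_le (Φ := Φ) (hCD a ha) _).2.trans ?_
    gcongr
    exact (norm_add_le _ _).trans (add_le_add ((hY₀ a ha).trans (le_abs_self _))
      (norm_intCov_le m))
  have hcotk : ∀ a ∈ D, ∀ m, Φ.cotNorm (δ.p a) (δ.push a (σ.Y a + intCov m)) ^ k
      ≤ Real.exp (k * C * |Y₀|) * Real.exp (k * C * n * ‖m‖) := fun a ha m => by
    calc _ ≤ Real.exp (C * (|Y₀| + n * ‖m‖)) ^ k := by
          refine pow_le_pow_left₀ (Φ.cotNorm_nonneg _ _) ((hcot a ha m).trans ?_) k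
          linarith [Real.add_one_le_exp (C * (|Y₀| + n * ‖m‖))]
      _ = _ := by
          rw [← Real.exp_nat_mul, ← Real.exp_add]
          congr 1
          ring
  -- The rates of |y|^k and of the derivatives, plus 1, which leaves a factor e^{-‖m‖}.
  obtain ⟨N, hN⟩ := hc (k * C * n + R + 1)
  set Z : ℝ := Real.exp (k * C * |Y₀|) * (M * C ^ l) * |N| with hZ
  have hZ0 : 0 ≤ Z := by positivity
  -- By `hcot`, a covector longer than this threshold has ‖m‖ > Z/ε, and then Z e^{-‖m‖} ≤ ε.
  refine ⟨C * (|Y₀| + n * (Z / ε)), fun i s x _ hi hx v hv => ?_⟩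
  obtain ⟨a, ha, rfl⟩ := hDs x
  obtain ⟨m, hm, hder⟩ := h.iteratedFDeriv_eq hi s l
  obtain ⟨w, rfl⟩ : ∃ w : Fin l → E n, v = fun j => δ.D a (w j) :=
    ⟨fun j => (δ.D a).symm (v j), by simp⟩
  rw [hm] at hx ⊢
  rw [hder]
  have hmz : Z / ε < ‖m‖ := by
    have h1 := hx.trans_le (hcot a ha m)
    have h2 := lt_of_mul_lt_mul_left h1 hC.le
    exact lt_of_mul_lt_mul_left (lt_of_add_lt_add_left h2) (Nat.cast_nonneg n)
  have hsmul : (fun z => Real.exp (-(2 * Real.pi * intCov m z)) •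
      (c m * Complex.exp (-(2 * Real.pi * σ.f z : ℝ)))) = c m • fun z =>
        Real.exp (-(2 * Real.pi * intCov m z)) • Complex.exp (-(2 * Real.pi * σ.f z : ℝ)) := by
    ext z
    simp [mul_left_comm]
  have hsm : ContDiff ℝ ∞ fun z =>
      Real.exp (-(2 * Real.pi * intCov m z)) • Complex.exp (-(2 * Real.pi * σ.f z : ℝ)) :=
    (show ContDiff ℝ ∞ fun z => Real.exp (-(2 * Real.pi * intCov m z)) by fun_prop).smul hf
  have hest : ‖iteratedFDeriv ℝ l (fun z => Real.exp (-(2 * Real.pi * intCov m z)) •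
      (c m * Complex.exp (-(2 * Real.pi * σ.f z : ℝ)))) a w‖
        ≤ ‖c m‖ * (M * Real.exp (R * ‖m‖)) * C ^ l := by
    refine (ContinuousMultilinearMap.le_opNorm _ _).trans ?_
    refine mul_le_mul ?_ ?_ (by positivity) (by positivity)
    · rw [hsmul, iteratedFDeriv_const_smul_apply
        (hsm.contDiffAt.of_le (by exact_mod_cast le_top)), norm_smul]
      gcongr
      exact hMR m a ha
    · calc ∏ j, ‖w j‖ ≤ ∏ _j : Fin l, C :=
            Finset.prod_le_prod (fun _ _ => norm_nonneg _) fun j _ => hCD a ha _ (hv j)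
        _ = C ^ l := by simp
  have hcm : ‖c m‖ ≤ |N| * Real.exp (-(k * C * n + R + 1) * ‖m‖) :=
    (hN m).trans (by gcongr; exact le_abs_self N)
  calc _ ≤ (Real.exp (k * C * |Y₀|) * Real.exp (k * C * n * ‖m‖)) *
        (|N| * Real.exp (-(k * C * n + R + 1) * ‖m‖) * (M * Real.exp (R * ‖m‖)) * C ^ l) :=
        mul_le_mul (hcotk a ha m) (hest.trans (by gcongr)) (norm_nonneg _) (by positivity)
    _ = Z * Real.exp (-‖m‖) := by
        have : Real.exp (-‖m‖) = Real.exp (k * C * n * ‖m‖) *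
            Real.exp (-(k * C * n + R + 1) * ‖m‖) * Real.exp (R * ‖m‖) := by
          rw [← Real.exp_add, ← Real.exp_add]
          congr 1
          ring
        rw [this, hZ]
        ring
    _ ≤ ε := by
        rw [Real.exp_neg, ← div_eq_mul_inv, div_le_iff₀ (Real.exp_pos _)]
        rw [div_lt_iff₀ hε] at hmz
        nlinarith [Real.add_one_le_exp ‖m‖]

end GlobalPotential

end Witten

/-! ### Sections of the mirror line bundle as equivariant functions -/

section Sections

variable {n : ℕ} {B : Type*} [TopologicalSpace B] [ChartedSpace (E n) B]

theorem MirrorX.mk_add (x : B) (v : Tan n x) {ν : Tan n x} (hν : ν ∈ lattice n x) :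
    MirrorX.mk x (v + ν) = MirrorX.mk x v :=
  congrArg (Sigma.mk x) (QuotientAddGroup.mk_add_of_mem v hν)

namespace IntegralPotentials

theorem syzTerm_zero (α : (x : B) → Cot n x → ℂ) (x : B) (y : Cot n x) :
    syzTerm α x y 0 = fun μ => α x (y + μ.1) := by
  funext μ
  simp [syzTerm]

/-- Changing the lift `y` by `μ` only reindexes the series by translation and pulls out the phase
e^{-2πi⟨μ,v⟩}. -/
theorem syzTerm_add (α : (x : B) → Cot n x → ℂ) {x : B} (y : Cot n x) (v : Tan n x) {μ : Cot n x}
    (hμ : μ ∈ dualLattice n x) (μ' : dualLattice n x) : syzTerm α x (y + μ) v μ' =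
      Complex.exp (-(2 * Real.pi * μ v : ℝ) * Complex.I) *
        syzTerm α x y v (Equiv.addLeft (⟨μ, hμ⟩ : dualLattice n x) μ') := by
  unfold syzTerm
  simp only [Equiv.coe_addLeft, AddSubgroup.coe_add]
  rw [add_assoc, mul_left_comm, ← Complex.exp_add]
  congr 2
  simp only [add_apply]
  push_cast
  ring

theorem summable_syzTerm_add {α : (x : B) → Cot n x → ℂ} {x : B} {y : Cot n x} {v : Tan n x}
    (h : Summable (syzTerm α x y v)) {μ : Cot n x} (hμ : μ ∈ dualLattice n x) :
    Summable (syzTerm α x (y + μ) v) := by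
  rw [funext (syzTerm_add α y v hμ)]
  exact (((Equiv.addLeft (⟨μ, hμ⟩ : dualLattice n x)).summable_iff).2 h).mul_left _

end IntegralPotentials

variable [HasGroupoid B (specialIntegralAffineGroupoid n)] {g : RiemMetric n B} {ι : Type*}
  {Φ : IntegralPotentials g ι}

namespace IntegralPotentials

theorem mk_add_mem_iff (x : B) (y : Cot n x) {μ : Cot n x} (hμ : μ ∈ dualLattice n x) :
    DualX.mk x (y + μ) ∈ Φ.lagrangian ↔ DualX.mk x y ∈ Φ.lagrangian := by
  rw [(DualX.mk_eq_mk_iff x (y + μ) y).2 (by simpa using hμ)]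

/-- An element of the fibre at `q` vanishes on vectors `v` that do not represent `q`, so the values
recorded by `eval` are all of it. -/
theorem eval_ext {s t : Φ.RoughSection} (h : ∀ x y v, Φ.eval s x y v = Φ.eval t x y v) :
    s = t := by
  funext ⟨x, w⟩
  apply Subtype.ext
  funext (y : Cot n x) (v : Tan n x)
  by_cases hv : MirrorX.mk x v = ⟨x, w⟩
  · have hw : QuotientAddGroup.mk v = w := eq_of_heq (Sigma.mk.inj hv).2
    subst hw
    exact h x y v
  · have h1 : ∀ r : Φ.RoughSection, (r ⟨x, w⟩).1 y v = 0 := fun r => by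
      by_contra h0
      exact hv ((r ⟨x, w⟩).2.1 y v h0).2
    rw [h1, h1]

theorem eval_eq_zero (s : Φ.RoughSection) {x : B} {y : Cot n x}
    (h : DualX.mk x y ∉ Φ.lagrangian) (v : Tan n x) : Φ.eval s x y v = 0 := by
  by_contra h0
  exact h ((s (MirrorX.mk x v)).2.1 y v h0).1

theorem eval_add_dual (s : Φ.RoughSection) (x : B) (y : Cot n x) (v : Tan n x) {μ : Cot n x}
    (hμ : μ ∈ dualLattice n x) : Φ.eval s x (y + μ) v =
      Complex.exp (-(Real.pi * μ v : ℝ) * Complex.I) * Φ.eval s x y v :=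
  (s (MirrorX.mk x v)).2.2.1 y v μ hμ

theorem eval_add_lattice (s : Φ.RoughSection) (x : B) (y : Cot n x) (v : Tan n x) {ν : Tan n x}
    (hν : ν ∈ lattice n x) : Φ.eval s x y (v + ν) =
      Complex.exp ((Real.pi * y ν : ℝ) * Complex.I) * Φ.eval s x y v := by
  unfold eval
  rw [MirrorX.mk_add x v hν]
  exact (s (MirrorX.mk x v)).2.2.2 y v ν hν

/-- A function on `T^*B ⊕ TB` is equivariant, that is, given by a section of the mirror line
bundle. -/
structure IsEquivariant (Φ : IntegralPotentials g ι) (t : (x : B) → Cot n x → Tan n x → ℂ) :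
    Prop where
  support : ∀ x y v, t x y v ≠ 0 → DualX.mk x y ∈ Φ.lagrangian
  add_dual : ∀ x y v, ∀ μ ∈ dualLattice n x,
    t x (y + μ) v = Complex.exp (-(Real.pi * μ v : ℝ) * Complex.I) * t x y v
  add_lattice : ∀ x y v, ∀ ν ∈ lattice n x,
    t x y (v + ν) = Complex.exp ((Real.pi * y ν : ℝ) * Complex.I) * t x y v

open Classical in
/-- The section of the mirror line bundle given by an equivariant function. -/
def ofEval {t : (x : B) → Cot n x → Tan n x → ℂ} (ht : Φ.IsEquivariant t) : Φ.RoughSection :=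
  fun ⟨x, w⟩ => ⟨fun y (v : Tan n x) => if QuotientAddGroup.mk v = w then t x y v else 0, by
    refine ⟨fun y (v : Tan n x) h => ?_, fun y (v : Tan n x) μ hμ => ?_,
      fun y (v : Tan n x) (ν : Tan n x) hν => ?_⟩
    · have h' := ite_ne_right_iff.1 h
      exact ⟨ht.support _ _ _ h'.2, congrArg (Sigma.mk x) h'.1⟩
    · beta_reduce
      rw [ht.add_dual _ _ _ _ hμ, mul_ite, mul_zero]
    · beta_reduce
      have h' : (QuotientAddGroup.mk (v + ν) : Tan n x ⧸ lattice n x) = QuotientAddGroup.mk v :=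
        QuotientAddGroup.mk_add_of_mem v hν
      rw [ht.add_lattice _ _ _ _ hν, mul_ite, mul_zero, h']⟩

theorem eval_ofEval {t : (x : B) → Cot n x → Tan n x → ℂ} (ht : Φ.IsEquivariant t) :
    Φ.eval (ofEval ht) = t := by
  funext x y v
  exact if_pos rfl

theorem eval_add (s t : Φ.RoughSection) (x : B) (y : Cot n x) (v : Tan n x) :
    Φ.eval (s + t) x y v = Φ.eval s x y v + Φ.eval t x y v := rfl

theorem eval_smul (c : ℂ) (s : Φ.RoughSection) (x : B) (y : Cot n x) (v : Tan n x) :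
    Φ.eval (c • s) x y v = c * Φ.eval s x y v := rfl

theorem isEquivariant_eval (s : Φ.RoughSection) : Φ.IsEquivariant (Φ.eval s) where
  support _ _ v h := by
    by_contra hy
    exact h (eval_eq_zero s hy v)
  add_dual x y v _ hμ := eval_add_dual s x y v hμ
  add_lattice x y v _ hν := eval_add_lattice s x y v hν

/-- Over each `x` the lifts of the point of `L_g` form one Λ*-orbit, so one lift determines an
equivariant function. -/
theorem IsEquivariant.eq_of_eq {t r : (x : B) → Cot n x → Tan n x → ℂ} (ht : Φ.IsEquivariant t)
    (hr : Φ.IsEquivariant r)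
    (h : ∀ x, ∃ y, (∀ y', DualX.mk x y' ∈ Φ.lagrangian →
      y' - y ∈ dualLattice n x) ∧ ∀ v, t x y v = r x y v) : t = r := by
  funext x y v
  obtain ⟨y₀, hd, hv⟩ := h x
  by_cases hy : DualX.mk x y ∈ Φ.lagrangian
  · rw [← add_sub_cancel y₀ y, ht.add_dual _ _ _ _ (hd y hy), hr.add_dual _ _ _ _ (hd y hy), hv]
  · rw [not_not.1 (mt (ht.support x y v) hy), not_not.1 (mt (hr.support x y v) hy)]

/-! ### The SYZ transform of a function on the path space -/

theorem exp_add_int (r : ℝ) (k : ℤ) :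
    Complex.exp ((2 * Real.pi * (r + k) : ℝ) * Complex.I)
      = Complex.exp ((2 * Real.pi * r : ℝ) * Complex.I) := by
  rw [← Complex.exp_periodic.int_mul k ((2 * Real.pi * r : ℝ) * Complex.I)]
  congr 1
  push_cast
  ring

theorem isEquivariant_syzTransform {α : (x : B) → Cot n x → ℂ}
    (hα : ∀ x y, (⟨x, y⟩ : CotangentBundle n B) ∉ Φ.pathSpace → α x y = 0) :
    Φ.IsEquivariant (syzTransform α) where
  support x y v h := by
    by_contra hy
    apply h
    have : ∀ μ, syzTerm α x y v μ = 0 := fun μ => by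
      unfold syzTerm
      rw [hα x _ (fun h => hy ((mk_add_mem_iff x y μ.2).1 h)), zero_mul]
    simp [syzTransform, this]
  add_dual x y v μ hμ := by
    unfold syzTransform
    rw [tsum_congr (syzTerm_add α y v hμ), tsum_mul_left,
      (Equiv.addLeft (⟨μ, hμ⟩ : dualLattice n x)).tsum_eq (syzTerm α x y v), mul_right_comm,
      ← Complex.exp_add, mul_comm (tsum _), ← mul_assoc, ← Complex.exp_add]
    congr 2
    simp only [add_apply]
    push_cast
    ring
  add_lattice x y v ν hν := by
    have h1 : ∀ μ, syzTerm α x y (v + ν) μ = syzTerm α x y v μ := fun μ => by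
      obtain ⟨k, hk⟩ := μ.2 ν hν
      unfold syzTerm
      rw [map_add, hk, exp_add_int]
    unfold syzTransform
    rw [tsum_congr h1, mul_left_comm, ← Complex.exp_add, map_add]
    congr 2
    push_cast
    ring

end IntegralPotentials

variable {δ : Development B n}

namespace GlobalPotential

open IntegralPotentials

variable (σ : GlobalPotential Φ δ)

/-- The coefficient of a section in the holomorphic frame `e^{-2πf} 1̌` over the universal cover. -/
def hol (s : Φ.RoughSection) (z : E n × E n) : ℂ :=
  Complex.exp (2 * Real.pi * σ.f z.1 - Real.pi * Complex.I * σ.Y z.1 z.2) *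
    Φ.eval s (δ.p z.1) (δ.push z.1 (σ.Y z.1)) (δ.D z.1 z.2)

theorem Q_Y_mem_pathSpace (a : E n) : DualX.mk (δ.p a) (δ.push a (σ.Y a)) ∈ Φ.lagrangian := by
  have := σ.S_mem_pathSpace 0 a
  unfold S at this
  rw [intCov_zero, add_zero] at this
  exact this

theorem exists_covector {a : E n} {y : Cot n (δ.p a)} (hy : DualX.mk (δ.p a) y ∈ Φ.lagrangian) :
    ∃ m, y = δ.push a (σ.Y a + intCov m) := by
  obtain ⟨m, hm⟩ := σ.exists_S (q := ⟨δ.p a, y⟩) hy rfl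
  exact ⟨m, eq_of_heq (TotalSpace.mk.inj hm).2⟩

theorem eval_push (s : Φ.RoughSection) (m : Fin n → ℤ) (a v : E n) :
    Φ.eval s (δ.p a) (δ.push a (σ.Y a + intCov m)) (δ.D a v) =
      Complex.exp (-(2 * Real.pi * σ.f a) + Real.pi * Complex.I * σ.Y a v
        - Real.pi * Complex.I * intCov m v) * σ.hol s (a, v) := by
  rw [δ.push_add, eval_add_dual s _ _ _ ((δ.mem_dualLattice_iff a _).2 ⟨m, rfl⟩),
    δ.push_apply_D, hol, ← mul_assoc, ← Complex.exp_add]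
  congr 2
  push_cast
  ring

theorem sub_mem_dualLattice {a : E n} {y : Cot n (δ.p a)}
    (hy : DualX.mk (δ.p a) y ∈ Φ.lagrangian) : y - δ.push a (σ.Y a) ∈ dualLattice n (δ.p a) := by
  obtain ⟨m, rfl⟩ := σ.exists_covector hy
  rw [δ.push_add, add_sub_cancel_left]
  exact (δ.mem_dualLattice_iff a _).2 ⟨m, rfl⟩

theorem eval_push_Y (s : Φ.RoughSection) (a v : E n) :
    Φ.eval s (δ.p a) (δ.push a (σ.Y a)) (δ.D a v) =
      Complex.exp (-(2 * Real.pi * σ.f a) + Real.pi * Complex.I * σ.Y a v) * σ.hol s (a, v) := by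
  have h := σ.eval_push s 0 a v
  rw [intCov_zero, add_zero] at h
  simpa using h

/-- The frame factor e^{-iπ⟨Y,v⟩} cancels the multiplier e^{iπ⟨Y,k⟩} of the line bundle. -/
theorem hol_periodic (s : Φ.RoughSection) (a v : E n) (k : Fin n → ℤ) :
    σ.hol s (a, v + fun i => (k i : ℝ)) = σ.hol s (a, v) := by
  have hk : δ.D a (fun i => (k i : ℝ)) ∈ lattice n (δ.p a) :=
    (δ.mem_lattice_iff a _).2 fun j => ⟨k j, by simp⟩
  simp only [hol]
  rw [(δ.D a).map_add, eval_add_lattice s _ _ _ hk, δ.push_apply_D, ← mul_assoc, ← Complex.exp_add]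
  congr 2
  rw [map_add]
  push_cast
  ring

end GlobalPotential

end Sections

/-! ### The SYZ transform as a Fourier series -/

section SYZ

variable {n : ℕ} {B : Type*} [TopologicalSpace B] [ChartedSpace (E n) B]

variable [HasGroupoid B (specialIntegralAffineGroupoid n)]

/-- Uniqueness of Fourier coefficients on a fibre of `TB / Λ`. -/
theorem Development.fourier_unique (δ : Development B n) {x : B} {u w : dualLattice n x → ℂ}
    (hu : Summable u) (hw : Summable w)
    (h : ∀ v : Tan n x, ∑' μ, u μ * Complex.exp ((2 * Real.pi * μ.1 v : ℝ) * Complex.I)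
      = ∑' μ, w μ * Complex.exp ((2 * Real.pi * μ.1 v : ℝ) * Complex.I)) : u = w := by
  obtain ⟨a, rfl⟩ := δ.surj x
  have hn : ∀ (μ : dualLattice n (δ.p a)) (v : Tan n (δ.p a)),
      ‖Complex.exp ((2 * Real.pi * μ.1 v : ℝ) * Complex.I)‖ = 1 := fun μ v =>
    Complex.norm_exp_ofReal_mul_I _
  have hs : ∀ {u : dualLattice n (δ.p a) → ℂ}, Summable u → ∀ v : Tan n (δ.p a),
      Summable fun μ => u μ * Complex.exp ((2 * Real.pi * μ.1 v : ℝ) * Complex.I) :=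
    fun hu v => Summable.of_norm (by simpa only [norm_mul, hn, mul_one] using hu.norm)
  have h0 := eq_zero_of_tsum_mFourier (u := fun m => (u - w) (δ.dualLatticeEquiv a m))
    ((δ.dualLatticeEquiv a).summable_iff.2 (hu.sub hw)) (fun v => by
      have h1 := (hs hu (δ.D a v)).tsum_sub (hs hw (δ.D a v))
      rw [h, sub_self, ← (δ.dualLatticeEquiv a).tsum_eq] at h1
      rw [← h1]
      refine tsum_congr fun m => ?_
      rw [δ.dualLatticeEquiv_apply, δ.push_apply_D, Pi.sub_apply, sub_mul]
      congr 3 <;> (push_cast; ring))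
  funext μ
  obtain ⟨m, rfl⟩ := (δ.dualLatticeEquiv a).surjective μ
  exact sub_eq_zero.1 (congrFun h0 m)

variable {g : RiemMetric n B} {ι : Type*}
  {Φ : IntegralPotentials g ι} {δ : Development B n} {σ : GlobalPotential Φ δ}

open IntegralPotentials

theorem Development.eq_of_syzTransform_eq (δ : Development B n) {α β : (x : B) → Cot n x → ℂ}
    {x : B} {y : Cot n x} (hα : Summable (syzTerm α x y 0)) (hβ : Summable (syzTerm β x y 0))
    (h : ∀ v, syzTransform α x y v = syzTransform β x y v) (μ : dualLattice n x) :
    α x (y + μ.1) = β x (y + μ.1) := by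
  rw [syzTerm_zero] at hα hβ
  exact congrFun (δ.fourier_unique hα hβ fun v => mul_right_cancel₀ (Complex.exp_ne_zero _) (h v)) μ

namespace GlobalPotential

variable {c : (Fin n → ℤ) → ℂ} {α : (x : B) → Cot n x → ℂ}

/-- Since `ψ m = f + ⟨m, ·⟩`, the real exponential and the character combine to e^{-2πf(a)}
e^{2πi⟨m, v + ia⟩}. -/
theorem hasSum_sheets (σ : GlobalPotential Φ δ) (hc : RapidSeq c) (a v : E n) :
    HasSum (fun m => c m * Complex.exp (-(2 * Real.pi * σ.ψ m a : ℝ)) *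
        Complex.exp ((2 * Real.pi * intCov m v : ℝ) * Complex.I))
      (Complex.exp (-(2 * Real.pi * σ.f a)) * theta c (a, v)) := by
  have h := (hc.summable_theta (a, v)).hasSum.mul_left (Complex.exp (-(2 * Real.pi * σ.f a)))
  refine h.congr_fun fun m => ?_
  rw [mul_left_comm, mul_assoc, ← Complex.exp_add, ← Complex.exp_add, expLin_apply, ψ]
  congr 2
  push_cast
  ring

theorem hasSum_syzTerm (hc : RapidSeq c) {a : E n}
    (h : ∀ m, total α (σ.S m a) = c m * Complex.exp (-(2 * Real.pi * σ.ψ m a : ℝ))) (v : E n) :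
    HasSum (syzTerm α (δ.p a) (δ.push a (σ.Y a)) (δ.D a v))
      (Complex.exp (-(2 * Real.pi * σ.f a)) * theta c (a, v)) := by
  rw [← (δ.dualLatticeEquiv a).hasSum_iff]
  refine (σ.hasSum_sheets hc a v).congr_fun fun m => ?_
  simp only [Function.comp_apply, syzTerm]
  rw [δ.dualLatticeEquiv_apply, ← δ.push_add, ← h m, δ.push_apply_D]
  rfl

theorem syzTransform_push_Y (hc : RapidSeq c) {a : E n}
    (h : ∀ m, total α (σ.S m a) = c m * Complex.exp (-(2 * Real.pi * σ.ψ m a : ℝ))) (v : E n) :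
    syzTransform α (δ.p a) (δ.push a (σ.Y a)) (δ.D a v) =
      Complex.exp (-(2 * Real.pi * σ.f a) + Real.pi * Complex.I * σ.Y a v) * theta c (a, v) := by
  rw [syzTransform, (hasSum_syzTerm hc h v).tsum_eq, δ.push_apply_D, mul_right_comm,
    ← Complex.exp_add]
  congr 2
  push_cast
  ring

theorem IsWittenSum.summable_syzTerm (h : σ.IsWittenSum c α) (hc : RapidSeq c) (x : B)
    (y : Cot n x) (v : Tan n x) : Summable (syzTerm α x y v) := by
  obtain ⟨a, rfl⟩ := δ.surj x
  by_cases hy : DualX.mk (δ.p a) y ∈ Φ.lagrangian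
  · obtain ⟨w, rfl⟩ := (δ.D a).surjective v
    have h1 := summable_syzTerm_add (hasSum_syzTerm hc (fun m => h.2 m a) w).summable
      (σ.sub_mem_dualLattice hy)
    rwa [add_sub_cancel] at h1
  · refine summable_zero.congr fun μ => ?_
    unfold syzTerm
    rw [h.1 _ _ fun h' => hy ((mk_add_mem_iff _ y μ.2).1 h'), zero_mul]

theorem hol_eq_theta {s : Φ.RoughSection} (hc : RapidSeq c) (h : σ.IsWittenSum c α)
    (hs : Φ.eval s = syzTransform α) : σ.hol s = theta c := by
  funext ⟨a, v⟩
  have h1 := σ.eval_push_Y s a v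
  rw [hs, syzTransform_push_Y hc (fun m => h.2 m a)] at h1
  exact (mul_left_cancel₀ (Complex.exp_ne_zero _) h1).symm

/-- Every section with rapidly decaying Fourier coefficients is an SYZ transform. -/
theorem exists_isWittenSum_of_hol_eq (σ : GlobalPotential Φ δ) {s : Φ.RoughSection}
    (hc : RapidSeq c) (hs : σ.hol s = theta c) :
    ∃ α, σ.IsWittenSum c α ∧ Φ.eval s = syzTransform α := by
  classical
  -- `α` is defined over `x` from the single lift `l x`; agreement with the formula at all other
  -- lifts is only proved at the end.
  choose l hl using δ.surj
  let α : (x : B) → Cot n x → ℂ := fun x y =>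
    if h : DualX.mk x y ∈ Φ.lagrangian then
      (fun m => c m * Complex.exp (-(2 * Real.pi * σ.ψ m (l x) : ℝ)))
        (σ.exists_S (q := ⟨x, y⟩) h (hl x).symm).choose
    else 0
  have hα0 : ∀ x y, (⟨x, y⟩ : CotangentBundle n B) ∉ Φ.pathSpace → α x y = 0 := fun x y h =>
    dif_neg h
  have hα1 : ∀ x m, total α (σ.S m (l x)) =
      c m * Complex.exp (-(2 * Real.pi * σ.ψ m (l x) : ℝ)) := by
    intro x m
    have h1 : ∀ q : CotangentBundle n B, q = σ.S m (l x) → q.1 = x →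
        total α q = c m * Complex.exp (-(2 * Real.pi * σ.ψ m (l x) : ℝ)) := by
      rintro ⟨x', y⟩ hq rfl
      have hmem : DualX.mk x' y ∈ Φ.lagrangian := by
        have := σ.S_mem_pathSpace m (l x')
        rw [← hq] at this
        exact this
      change dite _ _ _ = _
      rw [dif_pos hmem]
      have h2 := (σ.exists_S (q := ⟨x', y⟩) hmem (hl x').symm).choose_spec
      rw [σ.S_injective _ (h2.symm.trans hq)]
    exact h1 _ rfl (hl x)
  have hloc : ∀ x, ∃ y, (∀ y', DualX.mk x y' ∈ Φ.lagrangian → y' - y ∈ dualLattice n x) ∧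
      (∀ v, Φ.eval s x y v = syzTransform α x y v) ∧ ∀ v, Summable (syzTerm α x y v) := by
    intro x
    have h1 : ∀ a, (∀ m, total α (σ.S m a) = c m * Complex.exp (-(2 * Real.pi * σ.ψ m a : ℝ))) →
        ∃ y, (∀ y', DualX.mk (δ.p a) y' ∈ Φ.lagrangian → y' - y ∈ dualLattice n (δ.p a)) ∧
          (∀ v, Φ.eval s (δ.p a) y v = syzTransform α (δ.p a) y v) ∧
          ∀ v, Summable (syzTerm α (δ.p a) y v) := by
      intro a ha
      refine ⟨δ.push a (σ.Y a), fun _ hy => σ.sub_mem_dualLattice hy, fun v => ?_, fun v => ?_⟩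
      · obtain ⟨w, rfl⟩ := (δ.D a).surjective v
        rw [σ.eval_push_Y, hs, syzTransform_push_Y hc ha]
      · obtain ⟨w, rfl⟩ := (δ.D a).surjective v
        exact (hasSum_syzTerm hc ha w).summable
    have h2 := h1 (l x) (hα1 x)
    rwa [hl x] at h2
  have hev : Φ.eval s = syzTransform α :=
    (isEquivariant_eval s).eq_of_eq (isEquivariant_syzTransform hα0) fun x => by
      obtain ⟨y, h1, h2, -⟩ := hloc x
      exact ⟨y, h1, h2⟩
  refine ⟨α, ⟨hα0, fun m a => ?_⟩, hev⟩
  have hsum : Summable fun μ : dualLattice n (δ.p a) => α (δ.p a) (δ.push a (σ.Y a) + μ.1) := by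
    obtain ⟨y, h1, -, h3⟩ := hloc (δ.p a)
    have h4 := summable_syzTerm_add (h3 0) (h1 _ (σ.Q_Y_mem_pathSpace a))
    rw [add_sub_cancel] at h4
    rwa [syzTerm_zero] at h4
  have hsum' : ∀ v, HasSum (fun μ : dualLattice n (δ.p a) =>
      (c ((δ.dualLatticeEquiv a).symm μ) *
        Complex.exp (-(2 * Real.pi * σ.ψ ((δ.dualLatticeEquiv a).symm μ) a : ℝ))) *
        Complex.exp ((2 * Real.pi * μ.1 (δ.D a v) : ℝ) * Complex.I))
      (Complex.exp (-(2 * Real.pi * σ.f a)) * theta c (a, v)) := fun v => by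
    rw [← (δ.dualLatticeEquiv a).hasSum_iff]
    refine (σ.hasSum_sheets hc a v).congr_fun fun m => ?_
    simp only [Function.comp_apply, Equiv.symm_apply_apply]
    rw [δ.dualLatticeEquiv_apply, δ.push_apply_D]
  -- At an arbitrary lift `a`, the values of `α` and the expected values c_m e^{-2πψ_m(a)} are
  -- Fourier coefficients of the same section over the same fibre. This replaces a transformation
  -- law of `c` under deck transformations.
  have h5 := δ.fourier_unique hsum (w := fun μ => c ((δ.dualLatticeEquiv a).symm μ) *
      Complex.exp (-(2 * Real.pi * σ.ψ ((δ.dualLatticeEquiv a).symm μ) a : ℝ)))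
      ((hsum' 0).summable.congr fun μ => by simp) fun v => by
    obtain ⟨w, rfl⟩ := (δ.D a).surjective v
    rw [(hsum' w).tsum_eq]
    have h6 := σ.eval_push_Y s a w
    rw [hev, hs, syzTransform, δ.push_apply_D] at h6
    refine mul_right_cancel₀ (Complex.exp_ne_zero ((Real.pi * σ.Y a w : ℝ) * Complex.I))
      (h6.trans ?_)
    rw [mul_right_comm _ (theta c (a, w)), ← Complex.exp_add]
    congr 2
    push_cast
    ring
  have h7 := congrFun h5 (δ.dualLatticeEquiv a m)
  simp only [Equiv.symm_apply_apply] at h7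
  rw [← h7, δ.dualLatticeEquiv_apply, ← δ.push_add]
  rfl

end GlobalPotential

end SYZ

/-! ### Holomorphic sections in the frame e^{-2πf} 1̌ -/

section Holomorphic

variable {n : ℕ} {B : Type*} [TopologicalSpace B] [ChartedSpace (E n) B]

theorem mfderiv_symm_chartDiff {e : OpenPartialHomeomorph B (E n)}
    (he : e ∈ (specialIntegralAffineGroupoid n).maximalAtlas B) {x : B} (hx : x ∈ e.source)
    (v : Tan n x) :
    (show E n from mfderiv 𝓘(ℝ, E n) 𝓘(ℝ, E n) e.symm (e x) (chartDiff n e x v)) = v := by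
  have h : e.MDifferentiable 𝓘(ℝ, E n) 𝓘(ℝ, E n) :=
    ⟨fun y hy => (mdifferentiableAt_of_mem_maximalAtlas he hy).mdifferentiableWithinAt,
      fun y hy => (mdifferentiableAt_symm_of_mem_maximalAtlas he hy).mdifferentiableWithinAt⟩
  exact congrArg (fun L : E n →L[ℝ] E n => L v) (h.symm_comp_deriv hx)

variable [HasGroupoid B (specialIntegralAffineGroupoid n)]
  {g : RiemMetric n B} {ι : Type*}
  {Φ : IntegralPotentials g ι} {δ : Development B n}

theorem IntegralPotentials.coeff_chart (s : Φ.RoughSection) {i : ι} {x : B}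
    (hx : x ∈ (Φ.chart i).source) (v : Tan n x) :
    Φ.coeff s i (Φ.chart i x, chartDiff n (Φ.chart i) x v) =
      Complex.exp (-(Real.pi * Φ.dpot i x v : ℝ) * Complex.I) * Φ.eval s x (Φ.dpot i x) v := by
  let G : B → E n → ℂ := fun x' u =>
    Complex.exp (-(Real.pi * Φ.dpot i x' (show Tan n x' from u) : ℝ) * Complex.I) *
      Φ.eval s x' (Φ.dpot i x') (show Tan n x' from u)
  change G ((Φ.chart i).symm (Φ.chart i x)) (show E n from mfderiv 𝓘(ℝ, E n) 𝓘(ℝ, E n)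
    (Φ.chart i).symm (Φ.chart i x) (chartDiff n (Φ.chart i) x v)) = G x v
  rw [mfderiv_symm_chartDiff (Φ.chart_mem i) hx, (Φ.chart i).left_inv hx]

namespace GlobalPotential

open IntegralPotentials

variable (σ : GlobalPotential Φ δ)

theorem exists_coeff_local (s : Φ.RoughSection) (a : E n) (i : ι)
    (ha : δ.p a ∈ (Φ.chart i).source) :
    ∃ (A : Matrix.SpecialLinearGroup (Fin n) ℤ) (b : E n) (m : Fin n → ℤ),
      Φ.chart i (δ.p a) = slEquiv A a + b ∧
      (∀ u, fderiv ℝ (Φ.φ i ∘ (Φ.chart i).symm) (slEquiv A a + b) (slEquiv A u)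
        = (σ.Y a - intCov m) u) ∧
      ∀ᶠ z in 𝓝 a, ∀ v, Φ.coeff s i (slEquiv A z + b, slEquiv A v) =
        Complex.exp (2 * Real.pi * Complex.I * intCov m v - 2 * Real.pi * σ.f z) *
          σ.hol s (z, v) := by
  obtain ⟨A, b, m, c, h⟩ := σ.exists_local a i ha
  refine ⟨A, b, m, h.self_of_nhds.2.1, fun u => ?_, ?_⟩
  · have h1 := h.self_of_nhds.2.2.2.2.2.2 0 u
    have h2 : intCov (covAct 0 A) u = 0 := by
      rw [← intCov_slEquiv, intCov_zero]; rfl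
    rw [intCov_sub, add_apply, sub_apply, h2, zero_sub, ← sub_eq_add_neg] at h1
    rw [sub_apply, ← h1]
    simp [dArea]
  · filter_upwards [h] with z hz v
    have h3 : δ.push z (σ.Y z - intCov m) = δ.push z (σ.Y z + intCov (-m)) := by
      rw [intCov_neg, sub_eq_add_neg]
    rw [← hz.2.1, ← hz.2.2.2.2.1 v, coeff_chart s hz.1, hz.2.2.2.1, h3, σ.eval_push,
      δ.push_apply_D, ← mul_assoc, ← Complex.exp_add, intCov_neg]
    congr 2
    simp only [add_apply, neg_apply]
    push_cast
    ring

/-- Sections that are holomorphic are given by functions that are holomorphic in the coordinates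
`v + ia`. -/
theorem mem_holomorphicSections_iff (s : Φ.RoughSection) :
    s ∈ Φ.holomorphicSections ↔ ContDiff ℝ ∞ (σ.hol s) ∧ ∀ z u,
      fderiv ℝ (σ.hol s) z (u, 0) = Complex.I * fderiv ℝ (σ.hol s) z (0, u) := by
  -- The coefficient over `U_i` and `hol` differ by a smooth nowhere zero factor and an affine
  -- change of coordinates. Up to this factor, ∇_V acts on `hol` as `d_V + 2πi⟨Y, V₂⟩ - 2π⟨Y, V₁⟩`.
  have hloc : ∀ (a : E n) (i : ι), δ.p a ∈ (Φ.chart i).source →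
      ∃ P : E n ≃L[ℝ] E n, ∃ t ∈ (Φ.chart i).target, t = Φ.chart i (δ.p a) ∧ ∀ v : E n,
        (ContDiffAt ℝ ∞ (Φ.coeff s i) (t, P v) ↔ ContDiffAt ℝ ∞ (σ.hol s) (a, v)) ∧
        (DifferentiableAt ℝ (σ.hol s) (a, v) → ∃ e : ℂ, e ≠ 0 ∧ ∀ V : E n × E n,
          Φ.covDeriv i (Φ.coeff s i) (t, P v) (P V.1, P V.2) = e * (fderiv ℝ (σ.hol s) (a, v) V +
            (2 * Real.pi * Complex.I * σ.Y a V.2 - 2 * Real.pi * σ.Y a V.1) *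
              σ.hol s (a, v))) := by
    intro a i ha
    obtain ⟨A, b, m, hb, hdφ, h⟩ := σ.exists_coeff_local s a i ha
    refine ⟨slEquiv A, slEquiv A a + b, hb ▸ (Φ.chart i).map_source ha, hb.symm, fun v => ?_⟩
    let L : E n × E n → ℂ := fun z =>
      2 * Real.pi * Complex.I * intCov m z.2 - 2 * Real.pi * σ.f z.1
    let T : E n × E n → E n × E n := fun z => (slEquiv A z.1 + b, slEquiv A z.2)
    let T' : E n × E n → E n × E n := fun w =>
      ((slEquiv A).symm (w.1 - b), (slEquiv A).symm w.2)
    have hT' : ∀ z, T' (T z) = z := fun z => by simp [T, T']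
    have hT : ∀ w, T (T' w) = w := fun w => by simp [T, T']
    have hTs : ContDiff ℝ ∞ T := by fun_prop
    have hTs' : ContDiff ℝ ∞ T' := by fun_prop
    have hL : ContDiff ℝ ∞ L := by
      refine ContDiff.sub (contDiff_const.mul ?_) (contDiff_const.mul ?_)
      · exact Complex.ofRealCLM.contDiff.comp ((intCov m).contDiff.comp contDiff_snd)
      · exact Complex.ofRealCLM.contDiff.comp (σ.contDiff_f.comp contDiff_fst)
    have h1 : Φ.coeff s i ∘ T =ᶠ[𝓝 (a, v)] fun z => Complex.exp (L z) * σ.hol s z := by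
      rw [nhds_prod_eq]
      filter_upwards [h.prod_inl (𝓝 v)] with z hz using hz z.2
    have h2 : Φ.coeff s i =ᶠ[𝓝 (T (a, v))]
        (fun z => Complex.exp (L z) * σ.hol s z) ∘ T' := by
      have hc : Tendsto T' (𝓝 (T (a, v))) (𝓝 (a, v)) := by
        have := hTs'.continuous.tendsto (T (a, v))
        rwa [hT'] at this
      filter_upwards [hc.eventually h1] with w hw
      rw [Function.comp_apply, hT] at hw
      exact hw
    refine ⟨⟨fun hc => ?_, fun hc => ?_⟩, fun hd => ⟨Complex.exp (L (a, v)),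
      Complex.exp_ne_zero _, fun V => ?_⟩⟩
    · have h3 : σ.hol s =ᶠ[𝓝 (a, v)] fun z => Complex.exp (-L z) * (Φ.coeff s i ∘ T) z := by
        filter_upwards [h1] with z hz
        rw [hz, ← mul_assoc, ← Complex.exp_add]
        simp
      exact (hL.neg.cexp.contDiffAt.mul
        (ContDiffAt.comp (a, v) hc hTs.contDiffAt)).congr_of_eventuallyEq h3
    · refine ContDiffAt.congr_of_eventuallyEq ?_ h2
      refine ContDiffAt.comp _ ?_ hTs'.contDiffAt
      rw [show T' (slEquiv A a + b, slEquiv A v) = (a, v) from hT' (a, v)]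
      exact hL.cexp.contDiffAt.mul hc
    · have hLd : HasFDerivAt L ((2 * Real.pi * Complex.I) • Complex.ofRealCLM.comp
          ((intCov m).comp (ContinuousLinearMap.snd ℝ (E n) (E n))) - (2 * Real.pi : ℂ) •
          Complex.ofRealCLM.comp ((σ.Y a).comp (ContinuousLinearMap.fst ℝ (E n) (E n))))
          (a, v) := by
        refine HasFDerivAt.sub (HasFDerivAt.const_mul ?_ _) (HasFDerivAt.const_mul ?_ _)
        · exact (Complex.ofRealCLM.comp ((intCov m).comp
            (ContinuousLinearMap.snd ℝ (E n) (E n)))).hasFDerivAt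
        · exact Complex.ofRealCLM.hasFDerivAt.comp (a, v)
            ((σ.hasFDerivAt a).comp (a, v) (ContinuousLinearMap.fst ℝ (E n) (E n)).hasFDerivAt)
      have hTd : HasFDerivAt T' ((((slEquiv A).symm : E n →L[ℝ] E n).comp
          (ContinuousLinearMap.fst ℝ (E n) (E n))).prod (((slEquiv A).symm : E n →L[ℝ] E n).comp
          (ContinuousLinearMap.snd ℝ (E n) (E n)))) (T (a, v)) := by
        refine HasFDerivAt.prodMk ?_ ?_
        · exact ((slEquiv A).symm : E n →L[ℝ] E n).hasFDerivAt.comp _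
            ((ContinuousLinearMap.fst ℝ (E n) (E n)).hasFDerivAt.sub_const b)
        · exact (((slEquiv A).symm : E n →L[ℝ] E n).comp
            (ContinuousLinearMap.snd ℝ (E n) (E n))).hasFDerivAt
      have h4 := HasFDerivAt.comp (T (a, v)) (by rw [hT']; exact hLd.cexp.mul hd.hasFDerivAt) hTd
      have h5 := h4.congr_of_eventuallyEq h2
      have h6 : Φ.coeff s i (T (a, v)) = Complex.exp (L (a, v)) * σ.hol s (a, v) :=
        h1.self_of_nhds
      change fderiv ℝ (Φ.coeff s i) (T (a, v)) _ + 2 * Real.pi * Complex.I *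
        (fderiv ℝ (Φ.φ i ∘ (Φ.chart i).symm) (slEquiv A a + b) (slEquiv A V.2) : ℂ) *
          Φ.coeff s i (T (a, v)) = _
      rw [h5.fderiv, h6, hdφ]
      simp
      ring
  constructor
  · intro hs
    have hC : ContDiff ℝ ∞ (σ.hol s) := by
      rw [contDiff_iff_contDiffAt]
      rintro ⟨a, v⟩
      obtain ⟨i, hi⟩ := Φ.cover (δ.p a)
      obtain ⟨P, t, ht, -, h⟩ := hloc a i hi
      exact (h v).1.1 ((hs i).1.contDiffAt
        (((Φ.chart i).open_target.prod isOpen_univ).mem_nhds ⟨ht, mem_univ _⟩))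
    refine ⟨hC, ?_⟩
    rintro ⟨a, v⟩ u
    obtain ⟨i, hi⟩ := Φ.cover (δ.p a)
    obtain ⟨P, t, ht, -, h⟩ := hloc a i hi
    obtain ⟨e, he, hV⟩ := (h v).2 (hC.contDiffAt.differentiableAt (by simp))
    -- For V = (u, 0), JV = (0, -u) the zeroth order terms are -2π⟨Y,u⟩ + i(-2πi⟨Y,u⟩) = 0, so only
    -- the Cauchy–Riemann operator on `hol` remains.
    have h1 := (hs i).2 (t, P v) ⟨ht, mem_univ _⟩ (P u, P 0)
    have h2 : complexStructure (P u, P 0) = (P 0, P (-u)) := by simp [complexStructure]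
    have h3 : ((0 : E n), -u) = -(0, u) := by simp
    rw [h2, hV (u, 0), hV (0, -u), h3, map_neg] at h1
    simp only [map_zero, Complex.ofReal_zero, map_neg, Complex.ofReal_neg, Prod.snd_neg,
      Prod.fst_neg, neg_zero] at h1
    apply mul_left_cancel₀ he
    linear_combination h1 + 2 * Real.pi * (σ.Y a u) * σ.hol s (a, v) * e * Complex.I_mul_I
  · rintro ⟨hC, hCR⟩ i
    have hpt : ∀ z ∈ (Φ.chart i).target ×ˢ (univ : Set (E n)), ∃ a v, ∃ P : E n ≃L[ℝ] E n,
        ∃ t, z = (t, P v) ∧ (ContDiffAt ℝ ∞ (Φ.coeff s i) (t, P v)) ∧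
        ∃ e : ℂ, ∀ V : E n × E n,
          Φ.covDeriv i (Φ.coeff s i) (t, P v) (P V.1, P V.2) = e * (fderiv ℝ (σ.hol s) (a, v) V +
            (2 * Real.pi * Complex.I * σ.Y a V.2 - 2 * Real.pi * σ.Y a V.1) *
              σ.hol s (a, v)) := by
      rintro ⟨w, r⟩ ⟨hw, -⟩
      obtain ⟨a, ha⟩ := δ.surj ((Φ.chart i).symm w)
      have hi : δ.p a ∈ (Φ.chart i).source := ha ▸ (Φ.chart i).map_target hw
      obtain ⟨P, t, ht, hta, h⟩ := hloc a i hi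
      obtain ⟨v, rfl⟩ := P.surjective r
      obtain ⟨e, -, he⟩ := (h v).2 (hC.contDiffAt.differentiableAt (by simp))
      refine ⟨a, v, P, t, ?_, (h v).1.2 hC.contDiffAt, e, he⟩
      rw [hta, ha, (Φ.chart i).right_inv hw]
    refine ⟨fun z hz => ?_, fun z hz V => ?_⟩
    · obtain ⟨a, v, P, t, rfl, h, -⟩ := hpt z hz
      exact h.contDiffWithinAt
    · obtain ⟨a, v, P, t, rfl, -, e, he⟩ := hpt z hz
      obtain ⟨V₁, V₂⟩ := V
      obtain ⟨u, rfl⟩ := P.surjective V₁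
      obtain ⟨w, rfl⟩ := P.surjective V₂
      have h2 : complexStructure (P u, P w) = (P w, P (-u)) := by simp [complexStructure]
      have h3 : ∀ r q : E n, fderiv ℝ (σ.hol s) (a, v) (r, q) =
          Complex.I * fderiv ℝ (σ.hol s) (a, v) (0, r) + fderiv ℝ (σ.hol s) (a, v) (0, q) := by
        intro r q
        rw [← hCR, ← map_add]
        simp
      have h4 : ((0 : E n), -u) = -(0, u) := by simp
      rw [h2, he (u, w), he (w, -u), h3 u w, h3 w (-u), h4]
      simp only [map_neg, Complex.ofReal_neg]
      linear_combination (e * fderiv ℝ (σ.hol s) (a, v) (0, w)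
        - 2 * Real.pi * (σ.Y a u) * σ.hol s (a, v) * e) * Complex.I_mul_I

end GlobalPotential

end Holomorphic

/-! ### The SYZ transform as a linear isomorphism -/

section Transform

variable {n : ℕ} {B : Type*} [TopologicalSpace B] [ChartedSpace (E n) B]

theorem IntegralPotentials.syzTransform_add {α β : (x : B) → Cot n x → ℂ} {x : B} {y : Cot n x}
    {v : Tan n x} (hα : Summable (syzTerm α x y v)) (hβ : Summable (syzTerm β x y v)) :
    syzTransform (α + β) x y v = syzTransform α x y v + syzTransform β x y v := by
  unfold syzTransform
  rw [← add_mul, ← hα.tsum_add hβ]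
  congr 1
  exact tsum_congr fun μ => add_mul _ _ _

theorem IntegralPotentials.syzTransform_smul (c : ℂ) (α : (x : B) → Cot n x → ℂ) (x : B)
    (y : Cot n x) (v : Tan n x) :
    syzTransform (c • α) x y v = c * syzTransform α x y v := by
  unfold syzTransform
  rw [← mul_assoc, ← tsum_mul_left]
  congr 1
  exact tsum_congr fun μ => mul_assoc _ _ _

variable [HasGroupoid B (specialIntegralAffineGroupoid n)] {g : RiemMetric n B} {ι : Type*}
  {Φ : IntegralPotentials g ι} {δ : Development B n}

open IntegralPotentials

/-- The SYZ transform is an isomorphism from the kernel of the Witten differential to the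
holomorphic sections. -/
theorem GlobalPotential.exists_syzEquiv [CompactSpace B] (σ : GlobalPotential Φ δ) :
    ∃ F : Φ.wittenKernel ≃ₗ[ℂ] Φ.holomorphicSections, ∀ α : Φ.wittenKernel,
      (∀ x y v, Summable (syzTerm α.1 x y v)) ∧ Φ.eval (F α).1 = syzTransform α.1 := by
  have hsum : ∀ α : Φ.wittenKernel, ∀ x y v, Summable (syzTerm α.1 x y v) := fun α => by
    obtain ⟨c, hc, h⟩ := σ.exists_isWittenSum α.2
    exact h.summable_syzTerm hc
  let s : Φ.wittenKernel → Φ.RoughSection := fun α =>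
    ofEval (isEquivariant_syzTransform α.2.1.1.1)
  have hs : ∀ α, Φ.eval (s α) = syzTransform α.1 := fun α => eval_ofEval _
  have hmem : ∀ α, s α ∈ Φ.holomorphicSections := fun α => by
    obtain ⟨c, hc, h⟩ := σ.exists_isWittenSum α.2
    rw [σ.mem_holomorphicSections_iff, hol_eq_theta hc h (hs α)]
    exact ⟨hc.contDiff_theta, hc.theta_holomorphic⟩
  let L : Φ.wittenKernel →ₗ[ℂ] Φ.holomorphicSections :=
    { toFun := fun α => ⟨s α, hmem α⟩
      map_add' := fun α β => Subtype.ext <| eval_ext fun x y v => by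
        change _ = Φ.eval (s α + s β) x y v
        rw [eval_add, hs, hs, hs]
        exact syzTransform_add (hsum α x y v) (hsum β x y v)
      map_smul' := fun c α => Subtype.ext <| eval_ext fun x y v => by
        change _ = Φ.eval (c • s α) x y v
        rw [eval_smul, hs, hs]
        exact syzTransform_smul c α.1 x y v }
  have hinj : Function.Injective L := by
    intro α β h
    have h1 : s α = s β := congrArg Subtype.val h
    apply Subtype.ext
    funext x y
    -- Relative to the lift `y`, the Fourier coefficient at `μ = 0` is the value at `(x, y)` itself.
    have h2 := δ.eq_of_syzTransform_eq (hsum α x y 0) (hsum β x y 0)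
      (fun v => by rw [← hs, ← hs, h1]) 0
    simpa using h2
  have hsurj : Function.Surjective L := by
    rintro ⟨t, ht⟩
    obtain ⟨hC, hCR⟩ := (σ.mem_holomorphicSections_iff t).1 ht
    obtain ⟨c, hc, h⟩ := exists_theta (hC.of_le (by simp)) (σ.hol_periodic t) hCR
    obtain ⟨α, hα, hev⟩ := σ.exists_isWittenSum_of_hol_eq hc h
    refine ⟨⟨α, hα.mem_wittenKernel hc⟩, Subtype.ext <| eval_ext fun x y v => ?_⟩
    change Φ.eval (s _) x y v = _
    rw [hs, hev]
  exact ⟨LinearEquiv.ofBijective L ⟨hinj, hsurj⟩, fun α => ⟨hsum α, hs α⟩⟩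

end Transform

/-! ### Bohr–Sommerfeld fibres and real polarized sections -/

section RealPolarization

variable {n : ℕ} {B : Type*} [TopologicalSpace B] [ChartedSpace (E n) B]
  [HasGroupoid B (specialIntegralAffineGroupoid n)] {g : RiemMetric n B} {ι : Type*}
  {Φ : IntegralPotentials g ι}

namespace IntegralPotentials

/-- Along the line through 0 and `v`, flatness is the equation t' = -iπ⟨y,v⟩ t; multiplying by
e^{iπr⟨y,v⟩} gives a constant. -/
theorem FlatAlongFibre.eq_mul_exp {x : B} {t : Cot n x → Tan n x → ℂ}
    (ht : Φ.FlatAlongFibre x t) {y : Cot n x} (hy : DualX.mk x y ∈ Φ.lagrangian) (v : Tan n x) :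
    t y v = t y 0 * Complex.exp (-(Real.pi * y v : ℝ) * Complex.I) := by
  have hd : ∀ r : ℝ, HasDerivAt (fun r : ℝ => t y (r • v) *
      Complex.exp (r * ((Real.pi * y v : ℝ) * Complex.I))) 0 r := by
    intro r
    have h1 := ht y hy (r • v) v
    unfold HasLineDerivAt at h1
    have h2 : HasDerivAt (fun r : ℝ => t y (r • v))
        (-((Real.pi * y v : ℝ) * Complex.I * t y (r • v))) r := by
      have h3 : HasDerivAt (fun q : ℝ => q - r) 1 r := (hasDerivAt_id r).sub_const r
      have h4 := HasDerivAt.scomp (𝕜 := ℝ) r (by rw [sub_self]; exact h1) h3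
      rw [one_smul] at h4
      refine h4.congr_of_eventuallyEq (Eventually.of_forall fun q => ?_)
      simp only [Function.comp_apply, ← add_smul, add_sub_cancel]
    have h5 : HasDerivAt (fun r : ℝ => Complex.exp (r * ((Real.pi * y v : ℝ) * Complex.I)))
        (Complex.exp (r * ((Real.pi * y v : ℝ) * Complex.I)) *
          (1 * ((Real.pi * y v : ℝ) * Complex.I))) r :=
      ((Complex.ofRealCLM.hasDerivAt).mul_const _).cexp
    refine (h2.mul h5).congr_deriv ?_
    ring
  have h := is_const_of_deriv_eq_zero (fun r => (hd r).differentiableAt) (fun r => (hd r).deriv) 1 0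
  simp only [one_smul, zero_smul, Complex.ofReal_one, Complex.ofReal_zero, one_mul, zero_mul,
    Complex.exp_zero, mul_one] at h
  rw [← h, mul_assoc, ← Complex.exp_add]
  simp

theorem sub_mem_of_lagrangian {x : B} {y z : Cot n x} (hy : DualX.mk x y ∈ Φ.lagrangian)
    (hz : DualX.mk x z ∈ Φ.lagrangian) : y - z ∈ dualLattice n x := by
  have key : ∀ i j, x ∈ (Φ.chart i).source → x ∈ (Φ.chart j).source →
      Φ.dpot i x - Φ.dpot j x ∈ dualLattice n x := by
    intro i j hi hj
    obtain ⟨m, a, h⟩ := Φ.integral i j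
    have hd : ∀ k, x ∈ (Φ.chart k).source →
        HasMFDerivAt 𝓘(ℝ, E n) 𝓘(ℝ, ℝ) (Φ.φ k) x (Φ.dpot k x) := fun k hk =>
      (((Φ.smooth k).contMDiffAt ((Φ.chart k).open_source.mem_nhds hk)).mdifferentiableAt
        (by simp)).hasMFDerivAt
    have h1 : HasMFDerivAt 𝓘(ℝ, E n) 𝓘(ℝ, ℝ) (fun z => intCov m (Φ.chart j z) + a) x
        ((intCov m).comp (chartDiff n (Φ.chart j) x)) :=
      HasMFDerivAt.comp x (((intCov m).hasFDerivAt.add_const a).hasMFDerivAt)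
        (mdifferentiableAt_of_mem_maximalAtlas (Φ.chart_mem j) hj).hasMFDerivAt
    have h2 : Φ.φ i =ᶠ[𝓝 x] Φ.φ j + fun z => intCov m (Φ.chart j z) + a := by
      filter_upwards [(Φ.chart i).open_source.mem_nhds hi, (Φ.chart j).open_source.mem_nhds hj]
        with z hz1 hz2
      rw [Pi.add_apply, intCov_apply, ← h z ⟨hz1, hz2⟩]
      ring
    have h3 := hasMFDerivAt_unique (hd i hi) (((hd j hj).add h1).congr_of_eventuallyEq h2)
    have h4 : Φ.dpot i x - Φ.dpot j x = (intCov m).comp (chartDiff n (Φ.chart j) x) := by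
      rw [h3]
      exact add_sub_cancel_left _ _
    rw [h4]
    intro v hv
    exact intCov_int m (hv _ (Φ.chart_mem j) hj)
  obtain ⟨i, hi, h1⟩ := (mk_mem_lagrangian_iff x y).1 hy
  obtain ⟨j, hj, h2⟩ := (mk_mem_lagrangian_iff x z).1 hz
  have h3 := add_mem (sub_mem h1 h2) (key i j hi hj)
  have h4 : y - z = y - Φ.dpot i x - (z - Φ.dpot j x) + (Φ.dpot i x - Φ.dpot j x) := by abel
  rwa [h4]

/-- A covariantly constant section over a fibre vanishes unless the holonomy is trivial. -/
theorem mem_dualLattice_of_flat {x : B} {t : Cot n x → Tan n x → ℂ} (ht : Φ.FlatAlongFibre x t)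
    {y : Cot n x} (hy : DualX.mk x y ∈ Φ.lagrangian)
    (hν : ∀ v, ∀ ν ∈ lattice n x,
      t y (v + ν) = Complex.exp ((Real.pi * y ν : ℝ) * Complex.I) * t y v) {v : Tan n x}
    (hv : t y v ≠ 0) : y ∈ dualLattice n x := by
  intro ν hm
  have h0 : t y 0 ≠ 0 := fun h => hv (by rw [ht.eq_mul_exp hy, h, zero_mul])
  have h1 := hν 0 ν hm
  rw [zero_add, ht.eq_mul_exp hy, mul_comm] at h1
  have h2 := mul_right_cancel₀ h0 h1
  rw [Complex.exp_eq_exp_iff_exists_int] at h2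
  obtain ⟨k, hk⟩ := h2
  refine ⟨-k, ?_⟩
  have h3 : ((2 * Real.pi * Complex.I) * (y ν : ℂ)) = (2 * Real.pi * Complex.I) * (-k : ℂ) := by
    push_cast at hk
    linear_combination -hk
  have h4 := mul_left_cancel₀ Complex.two_pi_I_ne_zero h3
  push_cast
  exact_mod_cast h4

theorem zero_mem_lagrangian_of_mem {x : B} {y : Cot n x} (hy : DualX.mk x y ∈ Φ.lagrangian)
    (hd : y ∈ dualLattice n x) : DualX.mk x 0 ∈ Φ.lagrangian := by
  rwa [← mk_add_mem_iff x 0 hd, zero_add]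

theorem mem_dualLattice_of_lagrangian {x : B} {y : Cot n x} (h0 : DualX.mk x 0 ∈ Φ.lagrangian)
    (hy : DualX.mk x y ∈ Φ.lagrangian) : y ∈ dualLattice n x := by
  simpa using sub_mem_of_lagrangian hy h0

theorem fibreSection_self (x : B) {y : Cot n x} (hy : DualX.mk x y ∈ Φ.lagrangian) (v : Tan n x) :
    Φ.fibreSection x x y v = Complex.exp (-(Real.pi * y v : ℝ) * Complex.I) := if_pos ⟨rfl, hy⟩

theorem isEquivariant_fibreSection {x₀ : B} (h0 : DualX.mk x₀ 0 ∈ Φ.lagrangian) :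
    Φ.IsEquivariant (Φ.fibreSection x₀) where
  support x y v h := by
    by_contra hy
    exact h (if_neg fun h' => hy h'.2)
  add_dual x y v μ hμ := by
    unfold fibreSection
    rw [mk_add_mem_iff x y hμ, mul_ite, mul_zero, ← Complex.exp_add, add_apply]
    congr 2
    push_cast
    ring
  add_lattice x y v ν hν := by
    unfold fibreSection
    rw [mul_ite, mul_zero]
    by_cases h : x = x₀ ∧ DualX.mk x y ∈ Φ.lagrangian
    · simp only [if_pos h]
      obtain ⟨rfl, hy⟩ := h
      obtain ⟨k, hk⟩ := mem_dualLattice_of_lagrangian h0 hy ν hν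
      rw [← Complex.exp_add, map_add, hk,
        -- The section gains e^{-iπk} and the bundle asks for e^{iπk}; these agree because `k =
        -- ⟨y,ν⟩` is an integer.
        ← Complex.exp_periodic.int_mul k (-(Real.pi * (y v + k) : ℝ) * Complex.I)]
      congr 1
      push_cast
      ring
    · simp only [if_neg h]

theorem flatAlongFibre_fibreSection (Φ : IntegralPotentials g ι) (x₀ x : B) :
    Φ.FlatAlongFibre x (Φ.fibreSection x₀ x) := by
  intro y hy v u
  by_cases hx : x = x₀
  · subst hx
    rw [funext (Φ.fibreSection_self x hy)]
    have h1 : HasDerivAt (fun r : ℝ => (-(Real.pi * y v : ℝ) * Complex.I : ℂ)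
        + (r : ℂ) * (-(Real.pi * y u : ℝ) * Complex.I)) (1 * (-(Real.pi * y u : ℝ) * Complex.I))
        (0 : ℝ) := ((Complex.ofRealCLM.hasDerivAt).mul_const _).const_add _
    refine (h1.cexp.congr_of_eventuallyEq (Eventually.of_forall fun r => ?_)).congr_deriv ?_
    · simp only [map_add, map_smul, smul_eq_mul]
      congr 1
      push_cast
      ring
    · simp
      ring
  · have : Φ.fibreSection x₀ x y = fun _ => 0 := funext fun v => if_neg fun h => hx h.1
    rw [this]
    simpa [HasLineDerivAt] using hasDerivAt_const (0 : ℝ) (0 : ℂ)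

theorem isBohrSommerfeld_iff (x : B) : Φ.IsBohrSommerfeld x ↔ DualX.mk x 0 ∈ Φ.lagrangian := by
  constructor
  · rintro ⟨t, ht0, ht⟩
    obtain ⟨y, v, hv⟩ : ∃ y v, (t 0).1 y v ≠ 0 := by
      by_contra! h
      exact ht0 0 (Subtype.ext (funext fun y => funext fun v => h y v))
    obtain ⟨hy, hq⟩ := (t 0).2.1 y v hv
    have hq' : (QuotientAddGroup.mk v : Tan n x ⧸ lattice n x) = 0 := eq_of_heq (Sigma.mk.inj hq).2
    refine zero_mem_lagrangian_of_mem hy (mem_dualLattice_of_flat ht hy (fun w ν hν => ?_)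
      (v := v) ?_)
    · rw [QuotientAddGroup.mk_add_of_mem w hν]
      exact (t (QuotientAddGroup.mk w)).2.2.2 y w ν hν
    · rw [hq']
      exact hv
  · intro h0
    refine ⟨fun w => ofEval (isEquivariant_fibreSection h0) ⟨x, w⟩, fun w hw => ?_, ?_⟩
    · obtain ⟨v, rfl⟩ := QuotientAddGroup.mk_surjective w
      have h1 : Φ.eval (ofEval (isEquivariant_fibreSection h0)) x 0 v = 0 :=
        congrFun (congrFun (congrArg Subtype.val hw) 0) v
      rw [eval_ofEval, Φ.fibreSection_self x h0] at h1
      exact Complex.exp_ne_zero _ h1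
    · change Φ.FlatAlongFibre x (Φ.eval (ofEval (isEquivariant_fibreSection h0)) x)
      rw [eval_ofEval]
      exact Φ.flatAlongFibre_fibreSection x x

/-- Over an intersection point flatness and equivariance express everything by the value at `y = 0`,
`v = 0`. Elsewhere the nontrivial holonomy kills the section. -/
theorem eval_realPolarized {s : Φ.RoughSection} (hs : s ∈ Φ.realPolarized) (x : B) (y : Cot n x)
    (v : Tan n x) : Φ.eval s x y v = Φ.eval s x 0 0 * Φ.fibreSection x x y v := by
  by_cases hy : DualX.mk x y ∈ Φ.lagrangian
  · by_cases h0 : DualX.mk x 0 ∈ Φ.lagrangian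
    · have h1 := eval_add_dual s x 0 0 (mem_dualLattice_of_lagrangian h0 hy)
      rw [zero_add, map_zero, mul_zero, Complex.ofReal_zero, neg_zero, zero_mul, Complex.exp_zero,
        one_mul] at h1
      rw [FlatAlongFibre.eq_mul_exp (hs x) hy, h1, Φ.fibreSection_self x hy]
    · rw [eval_eq_zero s h0, zero_mul]
      by_contra hv
      exact h0 (zero_mem_lagrangian_of_mem hy (mem_dualLattice_of_flat (hs x) hy
        (fun w ν hν => eval_add_lattice s x y w hν) hv))
  · rw [eval_eq_zero s hy]
    unfold fibreSection
    rw [if_neg fun h => hy h.2, mul_zero]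

/-- A real polarized section is given by its values over the Bohr–Sommerfeld fibres. -/
theorem exists_realEquiv (Φ : IntegralPotentials g ι) :
    ∃ R : Φ.realPolarized ≃ₗ[ℂ] (Φ.BSFibre → ℂ), ∀ s x, R s x = Φ.eval s.1 x.1 0 0 := by
  classical
  let L : Φ.realPolarized →ₗ[ℂ] (Φ.BSFibre → ℂ) :=
    { toFun := fun s x => Φ.eval s.1 x.1 0 0
      map_add' := fun _ _ => rfl
      map_smul' := fun _ _ => rfl }
  have hinj : Function.Injective L := by
    intro s t h
    refine Subtype.ext (eval_ext fun x y v => ?_)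
    rw [eval_realPolarized s.2, eval_realPolarized t.2]
    congr 1
    by_cases hx : DualX.mk x 0 ∈ Φ.lagrangian
    · exact congrFun h ⟨x, (isBohrSommerfeld_iff x).2 hx⟩
    · rw [eval_eq_zero _ hx, eval_eq_zero _ hx]
  have hsurj : Function.Surjective L := by
    intro c
    let d : B → ℂ := fun x => if h : Φ.IsBohrSommerfeld x then c ⟨x, h⟩ else 0
    let t : (x : B) → Cot n x → Tan n x → ℂ := fun x y v => d x * Φ.fibreSection x x y v
    have hd : ∀ x, DualX.mk x 0 ∉ Φ.lagrangian → d x = 0 := fun x h =>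
      dif_neg fun h' => h ((isBohrSommerfeld_iff x).1 h')
    have ht : Φ.IsEquivariant t := by
      refine ⟨fun x y v h => (ite_ne_right_iff.1 (right_ne_zero_of_mul h)).1.2,
        fun x y v μ hμ => ?_, fun x y v ν hν => ?_⟩
      · by_cases h0 : DualX.mk x 0 ∈ Φ.lagrangian
        · simp only [t]
          rw [(isEquivariant_fibreSection h0).add_dual x y v μ hμ, mul_left_comm]
        · simp [t, hd x h0]
      · by_cases h0 : DualX.mk x 0 ∈ Φ.lagrangian
        · simp only [t]
          rw [(isEquivariant_fibreSection h0).add_lattice x y v ν hν, mul_left_comm]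
        · simp [t, hd x h0]
    have hflat : ofEval ht ∈ Φ.realPolarized := by
      intro x y hy v u
      rw [eval_ofEval]
      refine (HasDerivAt.const_mul (d x)
        (Φ.flatAlongFibre_fibreSection x x y hy v u)).congr_deriv ?_
      ring
    refine ⟨⟨ofEval ht, hflat⟩, funext fun x => ?_⟩
    change Φ.eval (ofEval ht) x.1 0 0 = c x
    rw [eval_ofEval]
    simp only [t]
    rw [Φ.fibreSection_self x.1 ((isBohrSommerfeld_iff x.1).1 x.2)]
    have : d x.1 = c x := dif_pos x.2
    simp [this]
  exact ⟨LinearEquiv.ofBijective L ⟨hinj, hsurj⟩, fun s x => rfl⟩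

theorem exists_realBasis (Φ : IntegralPotentials g ι) [Finite Φ.BSFibre] :
    ∃ b : Module.Basis Φ.BSFibre ℂ Φ.realPolarized,
      ∀ x, Φ.eval (b x).1 = Φ.fibreSection x.1 := by
  classical
  obtain ⟨R, hR⟩ := Φ.exists_realEquiv
  refine ⟨Module.Basis.ofEquivFun R, fun x => ?_⟩
  have h1 : R (Module.Basis.ofEquivFun R x) = Pi.single x 1 := by simp
  funext x' y v
  rw [eval_realPolarized (Module.Basis.ofEquivFun R x).2]
  by_cases hx : x' = x.1
  · subst hx
    rw [← hR _ x, h1]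
    simp
  · have h2 : Φ.fibreSection x.1 x' y v = 0 := if_neg fun h => hx h.1
    rw [h2]
    by_cases h0 : DualX.mk x' 0 ∈ Φ.lagrangian
    · have h3 : (⟨x', (isBohrSommerfeld_iff x').2 h0⟩ : Φ.BSFibre) ≠ x := fun h =>
        hx (congrArg Subtype.val h)
      rw [← hR _ ⟨x', (isBohrSommerfeld_iff x').2 h0⟩, h1, Pi.single_eq_of_ne h3, zero_mul]
    · rw [eval_eq_zero _ h0, zero_mul]

/-- Bohr–Sommerfeld fibres correspond to intersection points. -/
def bohrSommerfeldEquiv (Φ : IntegralPotentials g ι) : Φ.BSFibre ≃ Φ.Intersection where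
  toFun x := ⟨DualX.mk x.1 0, rfl, (isBohrSommerfeld_iff x.1).1 x.2⟩
  invFun p := ⟨p.1.1, (isBohrSommerfeld_iff _).2 (by
    obtain ⟨⟨x, w⟩, hw, hp⟩ := p
    obtain rfl : w = 0 := hw
    exact hp)⟩
  left_inv _ := rfl
  right_inv p := by
    obtain ⟨⟨x, w⟩, hw, hp⟩ := p
    obtain rfl : w = 0 := hw
    rfl

end IntegralPotentials

end RealPolarization

/-! ### Intersection points and the basis of the Witten kernel -/

section WittenBasis

variable {n : ℕ} {B : Type*} [TopologicalSpace B] [ChartedSpace (E n) B]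
  [HasGroupoid B (specialIntegralAffineGroupoid n)] {g : RiemMetric n B} {ι : Type*}
  {Φ : IntegralPotentials g ι} {δ : Development B n}

namespace GlobalPotential

open IntegralPotentials

variable {σ : GlobalPotential Φ δ} {c : (Fin n → ℤ) → ℂ} {α : (x : B) → Cot n x → ℂ}

/-! ### The Witten state of an intersection point -/

theorem S_of_zero {m : Fin n → ℤ} {a : E n} (h : σ.Y a + intCov m = 0) :
    σ.S m a = ⟨δ.p a, 0⟩ := by
  unfold S
  rw [h]
  rfl

theorem eq_of_S_eq_zero {m : Fin n → ℤ} {a z : E n} (h : σ.Y a + intCov m = 0) {x : B}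
    (hz : σ.S m z = ⟨x, 0⟩) : z = a := by
  have hx : δ.p z = x := congrArg TotalSpace.proj hz
  subst hx
  have h1 : σ.Y z + intCov m = 0 := δ.Q_injective z hz
  exact σ.Y_injective (add_right_cancel (h1.trans h.symm))

theorem component_eq {m : Fin n → ℤ} {a : E n} (h : σ.Y a + intCov m = 0) :
    Φ.component (δ.p a) = range (σ.S m) := by
  rw [IntegralPotentials.component, ← S_of_zero h, connectedComponentIn_S]

open Classical in
/-- The primitive of the area form on the sheet with label `m`. -/
def area (σ : GlobalPotential Φ δ) (m : Fin n → ℤ) (a : E n) (x : B) (y : Cot n x) : ℝ :=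
  if h : ∃ z, σ.S m z = ⟨x, y⟩ then σ.ψ m h.choose - σ.ψ m a else 0

theorem total_area {m : Fin n → ℤ} {a : E n} (h : σ.Y a + intCov m = 0) (z : E n) :
    total (σ.area m a) (σ.S m z) = σ.ψ m z - σ.ψ m a := by
  have h1 : ∃ z', σ.S m z' = ⟨(σ.S m z).1, (σ.S m z).2⟩ := ⟨z, rfl⟩
  have h2 : h1.choose = z := σ.S_injective_of_zero h h1.choose_spec
  refine (dif_pos h1).trans ?_
  rw [h2]

theorem isAreaPrimitive_area {m : Fin n → ℤ} {a : E n} (h : σ.Y a + intCov m = 0) :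
    Φ.IsAreaPrimitive (δ.p a) (σ.area m a) := by
  constructor
  · have h1 := total_area h a
    rw [S_of_zero h, sub_self] at h1
    exact h1
  · intro i k t ht hmem
    rw [component_eq h] at hmem
    obtain ⟨z, hz⟩ := hmem
    have hpz : δ.p z = (Φ.chart i).symm t := congrArg TotalSpace.proj hz
    have hi : δ.p z ∈ (Φ.chart i).source := hpz ▸ (Φ.chart i).map_target ht
    obtain ⟨A, b, r, hb, -, hloc⟩ := σ.exists_onSheet z i hi
    have ht' : t = slEquiv A z + b := by rw [← hb, hpz, (Φ.chart i).right_inv ht]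
    obtain ⟨h1, h2, h3⟩ := hloc k
    have hm : covAct k A - r = m := by
      apply σ.S_injective z
      change δ.Q z (σ.Y z + intCov (covAct k A - r)) = σ.S m z
      rw [hz, Development.Q, ← h1, hpz]
    rw [hm] at h2 h3
    rw [ht']
    have h6 : (slEquiv A).symm (slEquiv A z + b - b) = z := by simp
    have h5 : HasFDerivAt (fun w => (slEquiv A).symm (w - b))
        ((slEquiv A).symm : E n →L[ℝ] E n) (slEquiv A z + b) :=
      (slEquiv A).symm.hasFDerivAt.comp _ ((hasFDerivAt_id _).sub_const b)
    have h7 := (HasFDerivAt.comp (slEquiv A z + b) (by rw [h6]; exact σ.hasFDerivAt_ψ m z)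
      h5).sub_const (σ.ψ m a)
    refine (h7.congr_of_eventuallyEq ((h3 (σ.area m a)).trans
      (Eventually.of_forall fun w => total_area h _))).congr_fderiv ?_
    ext1 u
    obtain ⟨v, rfl⟩ := (slEquiv A).surjective u
    rw [h2]
    simp

theorem total_wittenState {m : Fin n → ℤ} {a : E n} (h : σ.Y a + intCov m = 0) (z : E n) :
    total (Φ.wittenState (δ.p a) (σ.area m a)) (σ.S m z) =
      Complex.exp (-(2 * Real.pi * (σ.ψ m z - σ.ψ m a) : ℝ)) := by
  have h1 : (⟨(σ.S m z).1, (σ.S m z).2⟩ : CotangentBundle n B) ∈ Φ.component (δ.p a) := by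
    rw [component_eq h]
    exact ⟨z, rfl⟩
  rw [← total_area h z]
  exact if_pos h1

theorem total_wittenState_of_notMem {m : Fin n → ℤ} {a : E n} (h : σ.Y a + intCov m = 0)
    {q : CotangentBundle n B} (hq : q ∉ range (σ.S m)) :
    total (Φ.wittenState (δ.p a) (σ.area m a)) q = 0 := by
  rw [← component_eq h] at hq
  exact if_neg hq

theorem wittenState_mem [CompactSpace B] {m : Fin n → ℤ} {a : E n} (h : σ.Y a + intCov m = 0) :
    Φ.wittenState (δ.p a) (σ.area m a) ∈ Φ.wittenKernel := by
  set β := Φ.wittenState (δ.p a) (σ.area m a) with hβ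
  let c : (Fin n → ℤ) → ℂ := fun k => total β (σ.S k 0) * Complex.exp ((2 * Real.pi * σ.ψ k 0 : ℝ))
  have hform : ∀ k z, total β (σ.S k z) = c k * Complex.exp (-(2 * Real.pi * σ.ψ k z : ℝ)) := by
    intro k z
    by_cases hk : σ.S k 0 ∈ range (σ.S m)
    · obtain ⟨w, hw⟩ := hk
      obtain ⟨γ, hγ, -, hS⟩ := σ.exists_deck hw.symm
      -- If the sheet `k` covers the same component, a deck transformation carries `ψ m` to `ψ k` up
      -- to a constant, which goes into `c k`.
      have h1 := σ.ψ_deck γ.continuous (fun z => congrFun hγ z) hS z 0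
      have h2 : ∀ z, total β (σ.S k z) =
          Complex.exp (-(2 * Real.pi * (σ.ψ m (γ z) - σ.ψ m a) : ℝ)) := fun z => by
        rw [hS z]
        exact total_wittenState h (γ z)
      simp only [c]
      rw [h2, h2, ← Complex.exp_add, ← Complex.exp_add]
      congr 1
      have h3 : σ.ψ m (γ z) = σ.ψ m (γ 0) - σ.ψ k 0 + σ.ψ k z := by linarith
      rw [h3]
      push_cast
      ring
    · have hz : ∀ z, total β (σ.S k z) = 0 := fun z => by
        refine total_wittenState_of_notMem h fun ⟨w, hw⟩ => hk ?_
        exact σ.range_S_eq hw.symm ⟨0, rfl⟩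
      simp only [c]
      rw [hz, hz]
      simp
  have hsupp : ∀ x y, (⟨x, y⟩ : CotangentBundle n B) ∉ Φ.pathSpace → β x y = 0 := by
    intro x y hxy
    refine total_wittenState_of_notMem h (q := ⟨x, y⟩) ?_
    rintro ⟨z, hz⟩
    exact hxy (hz ▸ σ.S_mem_pathSpace m z)
  refine IsWittenSum.mem_wittenKernel (σ := σ) (c := c) ⟨hsupp, hform⟩
    (rapidSeq_of_bounded fun z => ⟨Real.exp (2 * Real.pi * σ.f z), fun k => ?_⟩)
  -- `ψ m` is minimal at `a`, so the state is at most 1 in absolute value. This bound at every `z`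
  -- is the input of `rapidSeq_of_bounded`.
  have h1 : ‖total β (σ.S k z)‖ ≤ 1 := by
    by_cases hk : σ.S k z ∈ range (σ.S m)
    · obtain ⟨w, hw⟩ := hk
      rw [← hw, total_wittenState h, Complex.norm_exp, ← Complex.ofReal_neg, Complex.ofReal_re,
        Real.exp_le_one_iff]
      have := σ.ψ_le_of_zero h w
      have h2 : 0 ≤ 2 * Real.pi * (σ.ψ m w - σ.ψ m a) := by
        have := Real.pi_pos
        apply mul_nonneg <;> linarith
      linarith
    · rw [total_wittenState_of_notMem h hk]
      simp
  rw [hform, norm_mul, Complex.norm_exp, ← Complex.ofReal_neg, Complex.ofReal_re] at h1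
  calc ‖c k‖ * Real.exp (-(2 * Real.pi * intCov k z))
      = ‖c k‖ * Real.exp (-(2 * Real.pi * σ.ψ k z)) * Real.exp (2 * Real.pi * σ.f z) := by
        rw [mul_assoc ‖c k‖, ← Real.exp_add, ψ]
        congr 2
        ring
    _ ≤ 1 * Real.exp (2 * Real.pi * σ.f z) := by gcongr
    _ = _ := one_mul _

/-! ### Intersection points -/

theorem exists_zero (σ : GlobalPotential Φ δ) (p : Φ.Intersection) {a : E n}
    (ha : δ.p a = p.1.1) : ∃ m, σ.Y a + intCov m = 0 := by
  obtain ⟨⟨x, w⟩, hw, hp⟩ := p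
  obtain rfl : w = 0 := hw
  obtain rfl : δ.p a = x := ha
  obtain ⟨m, hm⟩ := σ.exists_covector (a := a) (y := 0) hp
  exact ⟨m, δ.push_injective a (hm.symm.trans (δ.push_zero a).symm)⟩

theorem intersection_ext {p q : Φ.Intersection} (h : p.1.1 = q.1.1) : p = q := by
  obtain ⟨⟨x, w⟩, hw, hp⟩ := p
  obtain ⟨⟨x', w'⟩, hw', hp'⟩ := q
  obtain rfl : w = 0 := hw
  obtain rfl : w' = 0 := hw'
  obtain rfl : x = x' := h
  rfl

/-- Lift the points into a compact set. There `m = -Y` is bounded, so finitely many labels occur,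
and `Y` being injective, the label determines the lift. -/
theorem finite_intersection [CompactSpace B] (σ : GlobalPotential Φ δ) : Finite Φ.Intersection := by
  obtain ⟨K, hK, hKs⟩ := δ.exists_fundamentalDomain
  obtain ⟨C, hC⟩ := hK.exists_bound_of_continuousOn σ.contDiff_Y.continuous.continuousOn
  choose a haK ha using fun p : Φ.Intersection => hKs p.1.1
  choose m hm using fun p => σ.exists_zero p (ha p)
  have hbound : ∀ p, ‖m p‖ ≤ max C 0 := fun p => by
    refine (pi_norm_le_iff_of_nonneg (le_max_right _ _)).2 fun j => le_max_of_le_left ?_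
    have h1 : ‖intCov (m p)‖ ≤ C := by
      rw [eq_neg_of_add_eq_zero_right (hm p), norm_neg]
      exact hC _ (haK p)
    have h2 := (intCov (m p)).le_opNorm (Pi.single j 1)
    rw [intCov_single, Pi.norm_single, norm_one, mul_one] at h2
    rw [Int.norm_eq_abs]
    exact h2.trans h1
  have : Finite {m : Fin n → ℤ | ‖m‖ ≤ max C 0} := finite_setOf_norm_le _
  refine Finite.of_injective (fun p => (⟨m p, hbound p⟩ : {m : Fin n → ℤ | ‖m‖ ≤ max C 0}))
    fun p q h => ?_
  have h1 : m p = m q := congrArg Subtype.val h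
  have h2 := hm p
  rw [h1] at h2
  have h3 : a p = a q := σ.Y_injective (add_right_cancel (h2.trans (hm q).symm))
  exact intersection_ext (by rw [← ha, ← ha, h3])

/-! ### The maximum principle -/

theorem IsWittenSum.norm_total (h : σ.IsWittenSum c α) (m : Fin n → ℤ) (a : E n) :
    ‖total α (σ.S m a)‖ = ‖c m‖ * Real.exp (-(2 * Real.pi * σ.ψ m a)) := by
  rw [h.2, norm_mul, Complex.norm_exp, ← Complex.ofReal_neg, Complex.ofReal_re]

/-- A nonzero function in the kernel of the Witten differential does not vanish at all
intersection points. -/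
theorem IsWittenSum.exists_zero_ne [CompactSpace B] (h : σ.IsWittenSum c α) (hc : RapidSeq c)
    {m₀ : Fin n → ℤ} {a₀ : E n} (h0 : total α (σ.S m₀ a₀) ≠ 0) :
    ∃ m a, σ.Y a + intCov m = 0 ∧ α (δ.p a) 0 ≠ 0 := by
  obtain ⟨K, hK, hKs⟩ := δ.exists_fundamentalDomain
  have hKne : K.Nonempty := (hKs (δ.p a₀)).imp fun _ h => h.1
  let N : (Fin n → ℤ) → E n → ℝ := fun m a => ‖total α (σ.S m a)‖
  have hNψ : ∀ m a, N m a = ‖c m‖ * Real.exp (-(2 * Real.pi * σ.ψ m a)) := h.norm_total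
  have hN : ∀ m, Continuous (N m) := fun m => by
    have h1 : Continuous (σ.ψ m) := σ.contDiff_f.continuous.add (intCov m).continuous
    simp only [funext (hNψ m)]
    fun_prop
  choose b hbK hb using fun m => hK.exists_isMaxOn hKne (hN m).continuousOn
  -- Any point of the path space also lies over the fundamental domain, possibly on a sheet with
  -- another label, where it is bounded by the maximum `b k`.
  have hred : ∀ m a, ∃ k, N m a ≤ N k (b k) := fun m a => by
    obtain ⟨a', ha', hp⟩ := hKs (δ.p a)
    obtain ⟨k, hk⟩ := σ.exists_S (σ.S_mem_pathSpace m a) (a := a') hp.symm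
    refine ⟨k, ?_⟩
    simp only [N]
    rw [hk]
    exact hb k ha'
  set v := N m₀ a₀ with hv
  have hv0 : 0 < v := norm_pos_iff.2 h0
  -- The maxima over `K` are dominated by a summable sequence, so only finitely many reach the
  -- positive value `v`; a global maximum of |α| therefore exists.
  have hfin : {m | v ≤ N m (b m)}.Finite := by
    obtain ⟨C₁, hC₁⟩ := hK.exists_bound_of_continuousOn (continuous_id (X := E n)).continuousOn
    obtain ⟨C₂, hC₂⟩ := hK.exists_bound_of_continuousOn
      (f := fun a => Real.exp (-(2 * Real.pi * σ.f a)))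
      (by have := σ.contDiff_f.continuous; fun_prop)
    obtain ⟨u, hu, hcu⟩ := hc.exists_bound (2 * Real.pi * n * C₁)
    have hlim := (hu.mul_left |C₂|).tendsto_cofinite_zero
    have h1 := hlim.eventually (gt_mem_nhds hv0)
    refine (eventually_cofinite.1 h1).subset fun m hm => not_lt.2 ?_
    refine le_trans hm ?_
    rw [hNψ]
    calc ‖c m‖ * Real.exp (-(2 * Real.pi * σ.ψ m (b m)))
        = Real.exp (-(2 * Real.pi * σ.f (b m))) *
          (‖c m‖ * Real.exp (-(2 * Real.pi * intCov m (b m)))) := by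
          rw [mul_left_comm, ← Real.exp_add, ψ]
          congr 2
          ring
      _ ≤ |C₂| * u m := by
          refine mul_le_mul ?_ (le_trans ?_ (hcu m)) (by positivity) (abs_nonneg _)
          · have := hC₂ (b m) (hbK m)
            rw [Real.norm_of_nonneg (Real.exp_pos _).le] at this
            exact this.trans (le_abs_self _)
          · gcongr
            have h2 := (abs_le.1 (abs_intCov_le m (b m))).1
            have h3 : n * ‖m‖ * ‖b m‖ ≤ n * ‖m‖ * C₁ := by
              gcongr
              exact hC₁ _ (hbK m)
            have h4 : 2 * Real.pi * (-(n * ‖m‖ * C₁)) ≤ 2 * Real.pi * intCov m (b m) := by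
              gcongr
              linarith
            linarith
  obtain ⟨k₀, hk₀⟩ := hred m₀ a₀
  obtain ⟨m, hmT, hmax⟩ := hfin.exists_maximalFor (fun m => N m (b m)) _ ⟨k₀, hk₀⟩
  have hmax' : ∀ k z, N k z ≤ N m (b m) := fun k z => by
    obtain ⟨k', hk'⟩ := hred k z
    refine hk'.trans ?_
    by_cases hv' : v ≤ N k' (b k')
    · rcases le_total (N k' (b k')) (N m (b m)) with h1 | h1
      · exact h1
      · exact hmax hv' h1
    · exact (not_le.1 hv').le.trans hmT
  have hpos : 0 < N m (b m) := hv0.trans_le hmT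
  have hcm : 0 < ‖c m‖ := by
    rw [hNψ] at hpos
    exact (pos_iff_pos_of_mul_pos hpos).2 (Real.exp_pos _)
  -- As c_m ≠ 0, a maximum of |c_m| e^{-2πψ_m} is a minimum of `ψ m` over all of ℝⁿ, not only over
  -- `K`.
  have hmin : IsLocalMin (σ.ψ m) (b m) := Eventually.of_forall fun z => by
    have h1 := hmax' m z
    rw [hNψ, hNψ, mul_le_mul_iff_right₀ hcm, Real.exp_le_exp, neg_le_neg_iff,
      mul_le_mul_iff_right₀ (by positivity)] at h1
    exact h1
  have hz := hmin.hasFDerivAt_eq_zero (σ.hasFDerivAt_ψ m (b m))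
  refine ⟨m, b m, hz, fun h1 => ?_⟩
  have h2 : N m (b m) = 0 := by
    simp only [N]
    rw [S_of_zero hz]
    exact norm_eq_zero.2 h1
  exact hpos.ne' h2

/-- The basis of Witten states. -/
theorem exists_wittenBasis [CompactSpace B] (σ : GlobalPotential Φ δ) :
    ∃ (𝒜 : Φ.Intersection → (x : B) → Cot n x → ℝ)
      (w : Module.Basis Φ.Intersection ℂ Φ.wittenKernel),
      (∀ p, Φ.IsAreaPrimitive p.1.1 (𝒜 p)) ∧
      ∀ p, (w p).1 = Φ.wittenState p.1.1 (𝒜 p) := by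
  classical
  have := σ.finite_intersection
  have := Fintype.ofFinite Φ.Intersection
  choose a ha using fun p : Φ.Intersection => δ.surj p.1.1
  choose m hm using fun p => σ.exists_zero p (ha p)
  let ws : Φ.Intersection → Φ.wittenKernel := fun p => ⟨_, wittenState_mem (hm p)⟩
  have hws : ∀ p q : Φ.Intersection, (ws p).1 q.1.1 0 = if q = p then 1 else 0 := by
    intro p q
    by_cases hpq : q = p
    · subst hpq
      rw [if_pos rfl, ← ha q]
      have h1 := total_wittenState (hm q) (a q)
      rw [S_of_zero (hm q), sub_self, mul_zero, Complex.ofReal_zero, neg_zero,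
        Complex.exp_zero] at h1
      exact h1
    · rw [if_neg hpq]
      refine total_wittenState_of_notMem (hm p) (q := ⟨q.1.1, 0⟩) ?_
      rintro ⟨z, hz⟩
      have h1 := eq_of_S_eq_zero (hm p) hz
      have h2 : δ.p z = q.1.1 := congrArg TotalSpace.proj hz
      exact hpq (intersection_ext (by rw [← h2, h1, ha]))
  -- Evaluation at the constant paths. Each state is 1 at its own point and 0 at the others, whose
  -- constant paths lie in other components.
  let L : Φ.wittenKernel →ₗ[ℂ] (Φ.Intersection → ℂ) :=
    { toFun := fun α p => α.1 p.1.1 0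
      map_add' := fun _ _ => rfl
      map_smul' := fun _ _ => rfl }
  have hLws : ∀ p, L (ws p) = Pi.single p 1 := fun p => by
    funext q
    rw [Pi.single_apply]
    exact hws p q
  have hinj : Function.Injective L := by
    rw [← LinearMap.ker_eq_bot, LinearMap.ker_eq_bot']
    intro α hα
    obtain ⟨c, hc, h⟩ := σ.exists_isWittenSum α.2
    by_contra hne
    obtain ⟨x, y, hxy⟩ : ∃ x y, α.1 x y ≠ 0 := by
      by_contra! h0
      exact hne (Subtype.ext (funext fun x => funext fun y => h0 x y))
    have hmem : (⟨x, y⟩ : CotangentBundle n B) ∈ Φ.pathSpace := by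
      by_contra h0
      exact hxy (h.1 x y h0)
    obtain ⟨z, rfl⟩ := δ.surj x
    obtain ⟨k, hk⟩ := σ.exists_S hmem (a := z) rfl
    obtain ⟨k', z', hz', hne'⟩ := h.exists_zero_ne hc (m₀ := k) (a₀ := z) (by rw [← hk]; exact hxy)
    have hlag : DualX.mk (δ.p z') 0 ∈ Φ.lagrangian := by
      have h1 := σ.S_mem_pathSpace k' z'
      rw [S_of_zero hz'] at h1
      exact h1
    exact hne' (congrFun hα ⟨DualX.mk (δ.p z') 0, rfl, hlag⟩)
  have hsurj : Function.Surjective L := fun d => ⟨∑ p, d p • ws p, by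
    rw [map_sum]
    simp only [map_smul, hLws]
    funext q
    simp [Finset.sum_apply, Pi.single_apply]⟩
  let R := LinearEquiv.ofBijective L ⟨hinj, hsurj⟩
  refine ⟨fun p => σ.area (m p) (a p), Module.Basis.ofEquivFun R, fun p => ?_, fun p => ?_⟩
  · have h1 := isAreaPrimitive_area (hm p)
    rwa [ha] at h1
  · have h1 : Module.Basis.ofEquivFun R p = ws p := R.injective (by
      change R _ = L (ws p)
      rw [hLws]
      simp)
    rw [h1]
    simp only [ws]
    rw [ha]

end GlobalPotential

end WittenBasis

end SemiFlat

end

set_option maxHeartbeats 400000 in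
open SemiFlat in
theorem mainTheorem1 (n : ℕ) (B : Type*) [TopologicalSpace B] [CompactSpace B] [T2Space B]
    [ChartedSpace (E n) B] [HasGroupoid B (specialIntegralAffineGroupoid n)]
    (hB : IsCompleteAffine n B) (g : RiemMetric n B) {ι : Type*} (Φ : IntegralPotentials g ι) :
    ∃ (κ : Φ.BSFibre ≃ Φ.Intersection)
      (𝒜 : Φ.Intersection → (x : B) → Cot n x → ℝ)
      (b : Module.Basis Φ.BSFibre ℂ Φ.realPolarized)
      (w : Module.Basis Φ.Intersection ℂ Φ.wittenKernel)
      (F : Φ.wittenKernel ≃ₗ[ℂ] Φ.holomorphicSections)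
      (Ψ : Φ.realPolarized ≃ₗ[ℂ] Φ.holomorphicSections),
      -- Bohr–Sommerfeld fibres correspond to intersection points lying over the same point of `B`
      (∀ x, (κ x).1.1 = x.1) ∧
      -- the real polarized sections are spanned by the Bohr–Sommerfeld fibres
      (∀ x, Φ.eval (b x).1 = Φ.fibreSection x.1) ∧
      -- Witten deformation of the intersection points
      (∀ p, Φ.IsAreaPrimitive p.1.1 (𝒜 p)) ∧
      (∀ p, (w p).1 = Φ.wittenState p.1.1 (𝒜 p)) ∧
      -- the isomorphism `F` is the SYZ transform, given by absolutely convergent series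
      (∀ α : Φ.wittenKernel, (∀ x y v, Summable (IntegralPotentials.syzTerm α.1 x y v)) ∧
        Φ.eval (F α).1 = IntegralPotentials.syzTransform α.1) ∧
      -- the resulting isomorphism of the spaces of polarized sections
      (∀ x, Φ.eval (Ψ (b x)).1 =
        IntegralPotentials.syzTransform (Φ.wittenState x.1 (𝒜 (κ x)))) := by
  obtain ⟨δ⟩ := exists_development hB
  obtain ⟨σ⟩ := exists_globalPotential Φ δ
  obtain ⟨F, hF⟩ := σ.exists_syzEquiv
  obtain ⟨𝒜, w, h𝒜, hw⟩ := σ.exists_wittenBasis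
  have := σ.finite_intersection
  have : Finite Φ.BSFibre := Finite.of_equiv _ Φ.bohrSommerfeldEquiv.symm
  obtain ⟨b, hb⟩ := Φ.exists_realBasis
  -- `Ψ` sends the basis of Bohr–Sommerfeld fibres to the image under `F` of the basis of Witten
  -- states, indexed through the bijection with intersection points.
  refine ⟨Φ.bohrSommerfeldEquiv, 𝒜, b, w, F, b.equiv (w.map F) Φ.bohrSommerfeldEquiv,
    fun _ => rfl, hb, h𝒜, hw, hF, fun x => ?_⟩
  rw [Module.Basis.equiv_apply, Module.Basis.map_apply, (hF _).2, hw]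
  rfl
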